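/- Let $X$ be a topological space, let $D(X)$ and $D(\mathbb Z)$ be the unbounded derived categories of sheaves of abelian groups on $X$ and of abelian groups, and let $\pi^{-1}\colon D(\mathbb Z)\to D(X)$ be the (exact) constant sheaf functor. Assume that $\pi^{-1}$ has a left adjoint $\mathbb L(X,-)\colon D(X)\to D(\mathbb Z)$, with unit $\epsilon_F\colon F\to\pi^{-1}\mathbb L(X,F)$, and put $H_i(X,F):=H^{-i}(\mathbb L(X,F))$. For an open subset $U\subseteq X$ let $\mathbb Z_U$ be the extension by zero of the constant sheaf $\mathbb Z$ on $U$, and put $H_i(U,\mathbb Z):=H_i(X,\mathbb Z_U)$. Let $(X,\omega)$ be a topological space with a duality theory, that is: an exact (triangulated) functor $\omega\colon D(X)\to D(\mathbb Z)$ with a right adjoint $\omega^!\colon D(\mathbb Z)\to D(X)$, dualizing complex $D_X^\omega:=\omega^!(\mathbb Z)$, together with a morphism $$\delta_G\colon \pi^{-1}G\otimes^{\mathbb L}D_X^\omega\to\omega^!G,\qquad G\in D(\mathbb Z),$$ natural in $G$, compatible with shifts, and equal for $G=\mathbb Z$ to the canonical isomorphism $\mathbb Z\otimes^{\mathbb L}D_X^\omega\simeq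 D_X^\omega$. Put $H^i_\omega(X,F):=H^i(\omega(F))$. For $F\in D(X)$ let $$\Phi_F\colon\omega(F\otimes^{\mathbb L}D_X^\omega)\to\mathbb L(X,F)$$ be the morphism, natural in $F$, that corresponds by adjunction to the composite $$F\otimes^{\mathbb L}D_X^\omega\xrightarrow{\ \epsilon_F\otimes 1\ }\pi^{-1}\mathbb L(X,F)\otimes^{\mathbb L}D_X^\omega\xrightarrow{\ \delta_{\mathbb L(X,F)}\ }\omega^!\,\mathbb L(X,F).$$ It induces maps $H^{-i}_\omega(X,F\otimes^{\mathbb L}D_X^\omega)\to H_i(X,F)$. Then the following conditions are equivalent: 1. $H^{-i}_\omega(X,F\otimes^{\mathbb L}D_X^\omega)\to H_i(X,F)$ is an isomorphism for every $F\in D(X)$ and every $i\in\mathbb Z$. 2. There is a basis $\mathfrak B$ of open subsets of $X$ such that $H^{-i}_\omega(X,\mathbb Z_U\otimes D_X^\omega)\to H_i(U,\mathbb Z)$ is an isomorphism for every $U\in\mathfrak B$ and every $i\in\mathbb Z$. 3. The natural morphism $\mathbb Z\to\mathbb R\mathcal Hom^\bullet(D_X^\omega,D_X^\omega)$ in $D(X)$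 is an isomorphism. -/

import Mathlib

open CategoryTheory Limits MonoidalCategory TopologicalSpace

universe w₁ w₂ u v

noncomputable section

namespace SheafDuality

/-! ### The internal Hom complex in a closed monoidal category -/

section InternalHom

variable {C : Type u} [Category.{v} C] [Preadditive C] [MonoidalCategory C] [MonoidalClosed C]

instance ihom_additive [MonoidalPreadditive C] (A : C) : (ihom A).Additive :=
  (ihom.adjunction A).right_adjoint_additive

lemma pre_zero_app [MonoidalPreadditive C] (A B Z : C) : (MonoidalClosed.pre (0 : B ⟶ A)).app Z = 0 := by
  apply MonoidalClosed.uncurry_injective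
  rw [MonoidalClosed.uncurry_pre]
  simp [MonoidalClosed.uncurry_eq]

variable [HasProducts.{0} C]

/-- The degree `n` term `∏_{p + n = q} Hom(K^p, L^q)` of the internal Hom complex. -/
abbrev homX (K L : CochainComplex C ℤ) (n : ℤ) : C :=
  ∏ᶜ fun i : {pq : ℤ × ℤ // pq.1 + n = pq.2} => (ihom (K.X i.1.1)).obj (L.X i.1.2)

/-- The projection of `∏_{p + n = q} Hom(K^p, L^q)` to the factor of index `(p, q)`. -/
def homProj (K L : CochainComplex C ℤ) (n p q : ℤ) (h : p + n = q) :
    homX K L n ⟶ (ihom (K.X p)).obj (L.X q) :=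
  Pi.π (fun i : {pq : ℤ × ℤ // pq.1 + n = pq.2} => (ihom (K.X i.1.1)).obj (L.X i.1.2))
    ⟨(p, q), h⟩

/-- The differential `f ↦ d_L ∘ f - (-1)^n f ∘ d_K` of the internal Hom complex. -/
def homD (K L : CochainComplex C ℤ) (n m : ℤ) : homX K L n ⟶ homX K L m :=
  if hm : n + 1 = m then
    Pi.lift fun i =>
      homProj K L n i.1.1 (i.1.2 - 1) (by have := i.2; lia) ≫
          (ihom (K.X i.1.1)).map (L.d (i.1.2 - 1) i.1.2) +
        m.negOnePow • (homProj K L n (i.1.1 + 1) i.1.2 (by have := i.2; lia) ≫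
          (MonoidalClosed.pre (K.d i.1.1 (i.1.1 + 1))).app (L.X i.1.2))
  else 0

lemma homD_homProj (K L : CochainComplex C ℤ) (n m : ℤ) (hm : n + 1 = m) (p q : ℤ)
    (h : p + m = q) :
    homD K L n m ≫ homProj K L m p q h =
      homProj K L n p (q - 1) (by lia) ≫ (ihom (K.X p)).map (L.d (q - 1) q) +
        m.negOnePow • (homProj K L n (p + 1) q (by lia) ≫
          (MonoidalClosed.pre (K.d p (p + 1))).app (L.X q)) := by
  simp [homD, homProj, hm]

variable [MonoidalPreadditive C]

/-- The internal Hom complex `Hom^•(K, L)`. -/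
def homComplex (K L : CochainComplex C ℤ) : CochainComplex C ℤ where
  X n := homX K L n
  d n m := homD K L n m
  shape n m h := by
    have h' : ¬ n + 1 = m := h
    simp [homD, h']
  d_comp_d' n m k hnm hmk := by
    obtain rfl : n + 1 = m := hnm
    obtain rfl : n + 1 + 1 = k := hmk
    refine Pi.hom_ext _ _ fun i => ?_
    obtain ⟨⟨p, q⟩, h⟩ := i
    change (_ ≫ _) ≫ homProj K L (n + 1 + 1) p q h = 0 ≫ _
    rw [Category.assoc, homD_homProj K L _ _ rfl, Preadditive.comp_add, Linear.comp_units_smul,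
      ← Category.assoc, ← Category.assoc, homD_homProj K L _ _ rfl, homD_homProj K L _ _ rfl]
    simp only [Preadditive.add_comp, Linear.units_smul_comp, Category.assoc, ← Functor.map_comp,
      ← NatTrans.comp_app, ← MonoidalClosed.pre_map]
    simp [pre_zero_app, Int.negOnePow_succ]

variable [HasZeroObject C]

/-- The morphism `𝟙 ⟶ Hom^•(L, L)` from the unit object placed in degree `0` given by the
identity of `L`. -/
def homUnit (L : CochainComplex C ℤ) :
    (HomologicalComplex.single C (ComplexShape.up ℤ) 0).obj (𝟙_ C) ⟶ homComplex L L :=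
  HomologicalComplex.mkHomFromSingle
    (Pi.lift fun i => MonoidalClosed.curry
      ((ρ_ (L.X i.1.1)).hom ≫ (L.XIsoOfEq (by have := i.2; lia)).hom))
    (by
      intro k hk
      obtain rfl : (0 : ℤ) + 1 = k := hk
      refine Pi.hom_ext _ _ fun i => ?_
      obtain ⟨⟨p, q⟩, h⟩ := i
      change (_ ≫ homD L L 0 (0 + 1)) ≫ homProj L L (0 + 1) p q h = 0 ≫ _
      obtain rfl : p + 1 = q := by simpa using h
      rw [Category.assoc, homD_homProj L L _ _ rfl, Preadditive.comp_add, Linear.comp_units_smul]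
      simp [homProj, ← MonoidalClosed.curry_natural_right, MonoidalClosed.curry_pre_app])

end InternalHom

/-! ### Sheaves of abelian groups on a topological space -/

/-- The category of abelian groups (as modules over the ring of integers). -/
abbrev ModZ := ModuleCat.{u} (ULift.{u} ℤ)

/-- The category of sheaves of abelian groups on `X`. -/
abbrev Shv (X : TopCat.{u}) := Sheaf (Opens.grothendieckTopology X) ModZ.{u}

section Sheaves

variable (X : TopCat.{u})

instance : HasColimits (Shv X) := ⟨fun _ _ => inferInstance⟩
instance : HasLimits (Shv X) := ⟨fun _ _ => inferInstance⟩
instance : HasColimitsOfSize.{0, 0} (Shv X) := hasColimitsOfSizeShrink.{0, 0, u, u} _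
instance : HasLimitsOfSize.{0, 0} (Shv X) := hasLimitsOfSizeShrink.{0, 0, u, u} _

open MonoidalClosed.FunctorCategory in
instance : MonoidalClosed ((Opens X)ᵒᵖ ⥤ ModZ.{u}) := inferInstance

/-- The tensor product of sheaves (the sheafification of the presheaf tensor product). -/
instance : MonoidalCategory (Shv X) :=
  Sheaf.monoidalCategory (Opens.grothendieckTopology X) ModZ.{u}

instance : BraidedCategory (Shv X) :=
  Sheaf.braidedCategory (Opens.grothendieckTopology X) ModZ.{u}

/-- The sheaf of homomorphisms, right adjoint to the tensor product. -/
instance : MonoidalClosed (Shv X) :=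
  Monoidal.Reflective.monoidalClosed
    (sheafificationAdjunction (Opens.grothendieckTopology X) ModZ.{u})

attribute [local instance] preservesBinaryBiproducts_of_preservesBinaryCoproducts in
instance (F : Shv X) : (tensorLeft F).Additive :=
  Functor.additive_of_preservesBinaryBiproducts _

attribute [local instance] preservesBinaryBiproducts_of_preservesBinaryCoproducts in
instance (F : Shv X) : (tensorRight F).Additive :=
  Functor.additive_of_preservesBinaryBiproducts _

instance : MonoidalPreadditive (Shv X) where
  whiskerLeft_zero {F _ _} := (tensorLeft F).map_zero _ _
  zero_whiskerRight {F _ _} := (tensorRight F).map_zero _ _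
  whiskerLeft_add {F _ _} _ _ := (tensorLeft F).map_add
  add_whiskerRight {F _ _} _ _ := (tensorRight F).map_add

instance (F : Shv X) : PreservesColimitsOfSize.{0, 0} ((curriedTensor (Shv X)).flip.obj F) :=
  haveI : PreservesColimits ((curriedTensor (Shv X)).flip.obj F) :=
    inferInstanceAs (PreservesColimits (tensorRight F))
  preservesColimitsOfSize_shrink.{0, u, 0, u} _

instance (K L : CochainComplex (Shv X) ℤ) : HomologicalComplex.HasTensor K L :=
  fun _ => inferInstance

/-- The inverse image functor `π⁻¹ : Mod(ℤ) ⥤ Shv(X)` of the projection of `X` to a point: it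
sends an abelian group to the corresponding constant sheaf. -/
abbrev constSheaf : ModZ.{u} ⥤ Shv X := constantSheaf (Opens.grothendieckTopology X) ModZ.{u}

instance : PreservesFiniteLimits (constSheaf X) :=
  inferInstanceAs (PreservesFiniteLimits (Functor.const _ ⋙ presheafToSheaf _ _))

instance : PreservesFiniteColimits (constSheaf X) :=
  inferInstanceAs (PreservesFiniteColimits (Functor.const _ ⋙ presheafToSheaf _ _))

variable {X} in
/-- The sheaf `ℤ_U`, the extension by zero of the constant sheaf `ℤ` on the open subset `U`: it is
the sheaf associated with `V ↦ ℤ` if `V ⊆ U` and `V ↦ 0` otherwise. -/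
def extZ (U : Opens X) : Shv X :=
  (presheafToSheaf (Opens.grothendieckTopology X) ModZ.{u}).obj
    (yoneda.obj U ⋙ ModuleCat.free (ULift.{u} ℤ))

/-- The tensor product of complexes of sheaves, `(K, L) ↦ K ⊗ L`. -/
abbrev tensorComplex :
    CochainComplex (Shv X) ℤ ⥤ CochainComplex (Shv X) ℤ ⥤ CochainComplex (Shv X) ℤ :=
  (curriedTensor (Shv X)).map₂CochainComplex

variable {X} in
/-- A complex of sheaves `P` is K-flat if `- ⊗ P` preserves quasi-isomorphisms (equivalently,
acyclic complexes). -/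
def IsKFlat (P : CochainComplex (Shv X) ℤ) : Prop :=
  ∀ ⦃K L : CochainComplex (Shv X) ℤ⦄ (f : K ⟶ L),
    QuasiIso f → QuasiIso (((tensorComplex X).flip.obj P).map f)

variable {X} in
lemma isKFlat_of_isZero {P : CochainComplex (Shv X) ℤ} (hP : IsZero P) : IsKFlat P := by
  have key (K : CochainComplex (Shv X) ℤ) : IsZero (((tensorComplex X).flip.obj P).obj K) := by
    rw [IsZero.iff_id_eq_zero]
    have h : ((tensorComplex X).obj K).map (0 : P ⟶ P) = 0 := by
      ext n : 1
      apply HomologicalComplex.mapBifunctor.hom_ext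
      intro i j h
      have e := HomologicalComplex.ι_mapBifunctorMap (𝟙 K) (0 : P ⟶ P) (curriedTensor (Shv X))
        (ComplexShape.up ℤ) i j n h
      refine e.trans ?_
      rw [HomologicalComplex.zero_f, HomologicalComplex.zero_f, Functor.map_zero, zero_comp,
        comp_zero]
      exact comp_zero.symm
    rw [hP.eq_of_src 0 (𝟙 P), CategoryTheory.Functor.map_id] at h
    exact h
  intro K L f _
  have : IsIso (((tensorComplex X).flip.obj P).map f) := (key K).isIso (key L) _
  infer_instance

end Sheaves

/-! ### Derived categories -/

section Derived

/-- The (unbounded) derived category `D(ℤ)` of abelian groups. -/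
abbrev DZ [HasDerivedCategory.{w₁} ModZ.{u}] := DerivedCategory ModZ.{u}

/-- The (unbounded) derived category `D(X)` of sheaves of abelian groups on `X`. -/
abbrev DX (X : TopCat.{u}) [HasDerivedCategory.{w₂} (Shv X)] := DerivedCategory (Shv X)

/-- The group `ℤ` as an object of `D(ℤ)`. -/
def intDZ [HasDerivedCategory.{w₁} ModZ.{u}] : DZ.{w₁, u} :=
  (DerivedCategory.singleFunctor ModZ.{u} 0).obj (𝟙_ ModZ.{u})

section TensorRHom

variable {X : TopCat.{u}} [HasDerivedCategory.{w₂} (Shv X)]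

/-- A K-flat complex together with a morphism to `K` in the derived category; it is a K-flat
resolution of `K` when `map` is an isomorphism. -/
structure KFlatModel (K : DX X) where
  P : CochainComplex (Shv X) ℤ
  flat : IsKFlat P
  map : DerivedCategory.Q.obj P ⟶ K

open ZeroObject in
instance (K : DX X) : Nonempty (KFlatModel K) :=
  ⟨{ P := 0, flat := isKFlat_of_isZero (isZero_zero _), map := 0 }⟩

/-- A chosen K-flat resolution of `K`. -/
def flatModel (K : DX X) : KFlatModel K :=
  Classical.epsilon fun M => IsIso M.map

/-- The functor `F ↦ F ⊗ P` from complexes to the derived category, for the chosen K-flat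
resolution `P` of the given object of `D(X)`. -/
abbrev preTensor (K : DX X) : CochainComplex (Shv X) ℤ ⥤ DX X :=
  (tensorComplex X).flip.obj (flatModel K).P ⋙ DerivedCategory.Q

lemma preTensor_inverts (K : DX X) :
    (HomologicalComplex.quasiIso (Shv X) (.up ℤ)).IsInvertedBy (preTensor K) := by
  intro A B f hf
  have := (flatModel K).flat f hf
  change IsIso (DerivedCategory.Q.map _)
  infer_instance

/-- The derived tensor product `- ⊗^L K : D(X) ⥤ D(X)`. -/
def derivedTensor (K : DX X) : DX X ⥤ DX X :=
  Localization.lift (preTensor K) (preTensor_inverts K) DerivedCategory.Q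

/-- The derived tensor product is computed by the chosen K-flat resolution. -/
def derivedTensorFactors (K : DX X) :
    DerivedCategory.Q ⋙ derivedTensor K ≅ preTensor K :=
  Localization.fac (preTensor K) (preTensor_inverts K) DerivedCategory.Q

instance (K : DX X) : Localization.Lifting DerivedCategory.Q
    (HomologicalComplex.quasiIso (Shv X) (.up ℤ)) (preTensor K) (derivedTensor K) :=
  ⟨derivedTensorFactors K⟩

instance (K : DX X) : (derivedTensor K).CommShift ℤ :=
  Functor.commShiftOfLocalization DerivedCategory.Q
    (HomologicalComplex.quasiIso (Shv X) (.up ℤ)) ℤ (preTensor K) (derivedTensor K)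

/-- The canonical isomorphism `ℤ_X ⊗^L K ⟶ K`. -/
def tensorUnit (K : DX X) :
    (derivedTensor K).obj ((DerivedCategory.singleFunctor (Shv X) 0).obj (𝟙_ (Shv X))) ⟶ K :=
  (derivedTensor K).map ((DerivedCategory.singleFunctorIsoCompQ (Shv X) 0).hom.app (𝟙_ (Shv X))) ≫
    (derivedTensorFactors K).hom.app _ ≫
    DerivedCategory.Q.map (HomologicalComplex.leftUnitor (flatModel K).P).hom ≫ (flatModel K).map

/-- A K-injective complex together with a morphism to it in the derived category; it is a
K-injective resolution of `K` when `map` is an isomorphism. -/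
structure KInjModel (K : DX X) where
  I : CochainComplex (Shv X) ℤ
  inj : I.IsKInjective
  map : K ⟶ DerivedCategory.Q.obj I

open ZeroObject in
instance (K : DX X) : Nonempty (KInjModel K) :=
  ⟨{ I := 0
     inj := ⟨fun f _ => ⟨Homotopy.ofEq ((isZero_zero _).eq_of_tgt f 0)⟩⟩
     map := 0 }⟩

/-- A chosen K-injective resolution of `K`. -/
def injModel (K : DX X) : KInjModel K :=
  Classical.epsilon fun M => IsIso M.map

/-- The derived internal Hom `RHHom(K, L)`: the complex of sheaves `Hom^•(K', I)` where `I` is a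
K-injective resolution of `L` and `K'` is any complex representing `K`; for `K'` we take the
chosen K-injective resolution of `K`. -/
def RHHom (K L : DX X) : DX X :=
  DerivedCategory.Q.obj (homComplex (injModel K).I (injModel L).I)

/-- The natural morphism `ℤ_X ⟶ RHHom(K, K)`. -/
def unitRHHom (K : DX X) :
    (DerivedCategory.singleFunctor (Shv X) 0).obj (𝟙_ (Shv X)) ⟶ RHHom K K :=
  (DerivedCategory.singleFunctorIsoCompQ (Shv X) 0).hom.app (𝟙_ (Shv X)) ≫
    DerivedCategory.Q.map (homUnit (injModel K).I)

end TensorRHom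

section Duality

variable (X : TopCat.{u}) [HasDerivedCategory.{w₁} ModZ.{u}] [HasDerivedCategory.{w₂} (Shv X)]

/-- The inverse image functor `π⁻¹ : D(ℤ) ⥤ D(X)`. -/
abbrev piInv : DZ.{w₁, u} ⥤ DX X := (constSheaf X).mapDerivedCategory

/-- `ℤ_X = π⁻¹ ℤ` in `D(X)`: the canonical identification of `π⁻¹ ℤ` with the unit sheaf. -/
def piInvUnit : (piInv.{w₁, w₂, u} X).obj intDZ ⟶
    (DerivedCategory.singleFunctor (Shv X) 0).obj (𝟙_ (Shv X)) :=
  ((constSheaf X).mapDerivedCategorySingleFunctor 0).hom.app (𝟙_ ModZ.{u})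

/-- The functor `L(X, -) : D(X) ⥤ D(ℤ)`, left adjoint to `π⁻¹`. -/
abbrev homologyL [(piInv.{w₁, w₂, u} X).IsRightAdjoint] : DX X ⥤ DZ.{w₁, u} :=
  (piInv X).leftAdjoint

/-- The adjunction between `L(X, -)` and `π⁻¹`. -/
abbrev homologyLAdj [(piInv.{w₁, w₂, u} X).IsRightAdjoint] : homologyL.{w₁, w₂, u} X ⊣ piInv X :=
  Adjunction.ofIsRightAdjoint (piInv X)

/-- A duality theory on `X`: an exact functor `ω : D(X) ⥤ D(ℤ)` with a right adjoint. -/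
structure DualityTheory where
  /-- the functor `ω` -/
  omega : DX X ⥤ DZ.{w₁, u}
  [commShift : omega.CommShift ℤ]
  [triangulated : omega.IsTriangulated]
  /-- the right adjoint `ω^!` -/
  shriek : DZ.{w₁, u} ⥤ DX X
  /-- the adjunction between `ω` and `ω^!` -/
  adj : omega ⊣ shriek

namespace DualityTheory

attribute [instance] commShift triangulated

variable {X}
variable (Ω : DualityTheory.{w₁, w₂, u} X)

/-- The dualizing complex `D_X^ω = ω^!(ℤ)`. -/
def dualizing : DX X := Ω.shriek.obj intDZ

/-- `ω^!` commutes with shifts, as the right adjoint of `ω`. -/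
instance : Ω.shriek.CommShift ℤ := Ω.adj.rightAdjointCommShift ℤ

/-- The natural morphism `π⁻¹ G ⊗^L D_X^ω ⟶ ω^! G` for `G` in `D(ℤ)`: it is natural in `G`,
compatible with shifts and, for `G = ℤ`, the canonical isomorphism
`ℤ_X ⊗^L D_X^ω ⟶ D_X^ω = ω^! ℤ`. When `RHom(ω D_X^ω, G) = RHom(D_X^ω, ω^! G)`, as for cohomology
with compact support, it is obtained by applying `RHom(-, G)` to the counit `ω D_X^ω ⟶ ℤ`. -/
structure DualMorphism where
  /-- the natural transformation -/
  hom : piInv.{w₁, w₂, u} X ⋙ derivedTensor Ω.dualizing ⟶ Ω.shriek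
  [commShift : NatTrans.CommShift hom ℤ]
  app_int : hom.app intDZ =
    (derivedTensor Ω.dualizing).map (piInvUnit X) ≫ tensorUnit Ω.dualizing

variable [(piInv.{w₁, w₂, u} X).IsRightAdjoint] {Ω}

/-- The comparison morphism `Φ_F : ω(F ⊗^L D_X^ω) ⟶ L(X, F)`, natural in `F`: it corresponds by
the adjunction to `F ⊗^L D_X^ω ⟶ π⁻¹ L(X, F) ⊗^L D_X^ω ⟶ ω^! L(X, F)`. -/
def DualMorphism.comparison (δ : Ω.DualMorphism) :
    derivedTensor Ω.dualizing ⋙ Ω.omega ⟶ homologyL.{w₁, w₂, u} X where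
  app F := (Ω.adj.homEquiv _ _).symm
    ((derivedTensor Ω.dualizing).map ((homologyLAdj X).unit.app F) ≫
      δ.hom.app ((homologyL X).obj F))
  naturality F G f := by
    have h1 := δ.hom.naturality ((homologyL.{w₁, w₂, u} X).map f)
    have h2 := (homologyLAdj.{w₁, w₂, u} X).unit.naturality f
    dsimp at h1 h2 ⊢
    rw [← Adjunction.homEquiv_naturality_left_symm, ← Adjunction.homEquiv_naturality_right_symm,
      Category.assoc, ← h1, ← Functor.map_comp_assoc, ← Functor.map_comp_assoc, h2]

/-- The map `H_ω^{-i}(X, F ⊗^L D_X^ω) ⟶ H_i(X, F) = H^{-i}(L(X, F))` induced by `Φ_F`. -/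
abbrev DualMorphism.comparisonH (δ : Ω.DualMorphism) (F : DX X) (i : ℤ) :
    (DerivedCategory.homologyFunctor ModZ.{u} (-i)).obj
        (Ω.omega.obj ((derivedTensor Ω.dualizing).obj F)) ⟶
      (DerivedCategory.homologyFunctor ModZ.{u} (-i)).obj ((homologyL X).obj F) :=
  (DerivedCategory.homologyFunctor ModZ.{u} (-i)).map (δ.comparison.app F)

end DualityTheory

variable {X} in
/-- The sheaf `ℤ_U` as an object of `D(X)`. -/
def extZD (U : Opens X) : DX X := (DerivedCategory.singleFunctor (Shv X) 0).obj (extZ U)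

end Duality

end Derived

end SheafDuality

end

/-! The morphism Φ_F can be tested by mapping it into the shifts ℤ[n], because these detect zero
objects of D(ℤ). Indeed, if Hom(A, ℤ[n]) = 0 for all n, the resolution 0 → ℤ → ℚ → ℚ/ℤ → 0 shows
that Hom(H, ℚ) → Hom(H, ℚ/ℤ) is bijective for every cohomology group H of A, and this forces H = 0
(`eq_zero_of_lift_characters`, `isIso_of_hom_int_bijective`). The two adjunctions turn Hom(Φ_F,
ℤ[n]) into the map f ↦ δ ∘ (f ⊗ D) from Hom(F, π⁻¹ℤ[n]) to Hom(F ⊗ D, ω^! ℤ[n]). Since δ respects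
shifts and is canonical at ℤ, only Hom(F[-n], ℤ_X) → Hom(F[-n] ⊗ D, D) remains
(`isIso_comparison_iff`), and tensor-Hom adjunction makes this composition with ℤ_X → RHom(D, D)
(`tensorUnitMap_bijective_iff`). So if the latter is an isomorphism, every Φ_F is one. Conversely,
the Φ of the ℤ_U for U in a basis give bijectivity on all ℤ_U[-n], and these detect isomorphisms in
D(X) (`isIso_of_sphere_bijective`). The rest is foundation: unbounded complexes need K-injective and
K-flat resolutions, so that the chosen models really are resolutions. Monomorphic quasi-isomorphisms
are described by a left lifting property (`llp_monoQuasiIsoTest`) and generated by a set, so the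
small object argument yields `exists_isKInjective_quasiIso`. Cell complexes built from the flat
sheaves ℤ_U yield `exists_preservesAcyclic_quasiIso`. Finally `quasiIso_homComplexPre` compares RHom
with K-injective source, as in the definition, with RHom with K-flat source, as the adjunction
requires. -/

noncomputable section

namespace SheafDuality

/-! ### Monomorphic quasi-isomorphisms as a class defined by left lifting. -/

section Abelian

open HomologicalComplex CochainComplex HomComplex

variable {C : Type u} [Category.{v} C]

section SmallObject

open MorphismProperty

/-- A small family of monomorphisms in a Grothendieck abelian category permits the small object
argument. -/
lemma hasSmallObjectArgument_of_le_monomorphisms [Abelian C] [IsGrothendieckAbelian.{v} C]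
    (I : MorphismProperty C) [IsSmall.{v} I] (hI : I ≤ monomorphisms C) :
    HasSmallObjectArgument.{v} I := by
  -- κ exceeds the number of subobjects of each source in the family, so Hom from such a source
  -- commutes with κ-indexed colimits of monomorphisms.
  obtain ⟨κ, hκ', hκ⟩ := HasCardinalLT.exists_regular_cardinal_forall.{v}
    (fun i : Shrink.{v} I.toSet => Subobject ((equivShrink _).symm i).1.left)
  have : Fact κ.IsRegular := ⟨hκ'⟩
  have : Nonempty κ.ord.ToType := by simpa using hκ'.ne_zero
  have := WellFoundedLT.toOrderBot κ.ord.ToType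
  exact ⟨κ, inferInstance, inferInstance,
    { preservesColimit {A B X Y} i hi f hf := by
        let hf' : (monomorphisms C).TransfiniteCompositionOfShape κ.ord.ToType f :=
          { toTransfiniteCompositionOfShape := hf.toTransfiniteCompositionOfShape
            map_mem j hj := by
              have := (hf.attachCells j hj).pushouts_coproducts
              simp only [ofHoms_homFamily] at this
              refine (?_ : _ ≤ monomorphisms C) _ this
              simp only [pushouts_le_iff, coproducts_le_iff]
              exact hI }
        have (j j' : κ.ord.ToType) (φ : j ⟶ j') : Mono (hf'.F.map φ) := hf'.mem_map φ
        apply IsGrothendieckAbelian.preservesColimit_coyoneda_obj_of_mono (Y := hf'.F) (κ := κ)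
        have h := hκ (equivShrink _ ⟨Arrow.mk i, hi⟩)
        rwa [Equiv.symm_apply_apply] at h }⟩

end SmallObject

variable [Abelian C]

lemma exact_int (K : CochainComplex C ℤ) (hK : K.Acyclic) (i j k : ℤ) (hij : i + 1 = j)
    (hjk : j + 1 = k) : (ShortComplex.mk (K.d i j) (K.d j k) (K.d_comp_d i j k)).Exact := by
  have := hK j
  rwa [K.exactAt_iff' i j k (by simp [← hij]) (by simp [hjk])] at this

lemma acyclic_of_exact (K : CochainComplex C ℤ)
    (hK : ∀ i j k : ℤ, i + 1 = j → j + 1 = k →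
      (ShortComplex.mk (K.d i j) (K.d j k) (K.d_comp_d i j k)).Exact) : K.Acyclic := fun j => by
  rw [K.exactAt_iff' (j - 1) j (j + 1) (by simp) (by simp)]
  exact hK _ _ _ (by simp) rfl

/-- A complex is acyclic if all its cocycles with values in injective objects are coboundaries. -/
lemma acyclic_of_injective_test [EnoughInjectives C] (K : CochainComplex C ℤ)
    (hK : ∀ (E : C) [Injective E] (i j k : ℤ) (_ : i + 1 = j) (_ : j + 1 = k) (φ : K.X j ⟶ E),
      K.d i j ≫ φ = 0 → ∃ g : K.X k ⟶ E, K.d j k ≫ g = φ) : K.Acyclic := by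
  refine acyclic_of_exact K fun i j k hij hjk => ?_
  -- The test cocycle is the cokernel of `K.d i j` embedded in an injective: if it factors through
  -- `K.d j k`, it kills the kernel of `K.d j k`.
  obtain ⟨g, hg⟩ := hK _ i j k hij hjk (cokernel.π (K.d i j) ≫ Injective.ι _) (by simp)
  rw [ShortComplex.exact_iff_kernel_ι_comp_cokernel_π_zero]
  dsimp
  rw [← cancel_mono (Injective.ι _), Category.assoc, ← hg, kernel.condition_assoc, zero_comp,
    zero_comp]

/-- The morphism `cone (𝟙 L) ⟶ L⟦1⟧`. -/
def coneToShift (L : CochainComplex C ℤ) : mappingCone (𝟙 L) ⟶ L⟦(1 : ℤ)⟧ :=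
  Cocycle.equivHomShift.symm (mappingCone.fst (𝟙 L))

lemma comp_coneToShift_eq_iff {A L : CochainComplex C ℤ} (a : A ⟶ mappingCone (𝟙 L))
    (b : A ⟶ L⟦(1 : ℤ)⟧) :
    a ≫ coneToShift L = b ↔
      (Cochain.ofHom a).comp (mappingCone.fst (𝟙 L)).1 (zero_add 1) = (Cocycle.equivHomShift b).1 := by
  rw [← Cocycle.equivHomShift.injective.eq_iff, Cocycle.equivHomShift_comp, coneToShift,
    AddEquiv.apply_symm_apply, Cocycle.ext_iff]
  rfl

/-- A monomorphism in the category of complexes which is a quasi-isomorphism lifts against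
`cone (𝟙 L) ⟶ L⟦1⟧` for `L` a K-injective complex of injective objects. -/
lemma hasLiftingProperty_coneToShift {A B : CochainComplex C ℤ} (f : A ⟶ B) [Mono f]
    [hf : QuasiIso f] (L : CochainComplex C ℤ) [L.IsKInjective] [∀ n, Injective (L.X n)] :
    HasLiftingProperty f (coneToShift L) := ⟨fun {a b} sq => by
  let S := ShortComplex.mk f (cokernel.π f) (by simp)
  have hS : S.ShortExact := { exact := ShortComplex.exact_cokernel f }
  have hSp (p : ℤ) : (S.map (HomologicalComplex.eval C _ p)).ShortExact := hS.map_of_exact _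
  have hSe (p : ℤ) : Epi ((cokernel.π f).f p) := (hSp p).epi_g
  have hSe' (p : ℤ) : Epi (S.map (HomologicalComplex.eval C _ p)).g := (hSp p).epi_g
  have hSm (p : ℤ) : Mono (f.f p) := (hSp p).mono_f
  have hC : S.X₃.Acyclic := hS.acyclic_X₃ hf
  -- A morphism to `cone (𝟙 L)` is a 1-cocycle α together with a 0-cochain β such that δβ + α = 0.
  -- The lifting problem is thus to extend the β given on `A` to one for `αB` on `B`.
  let αB : Cocycle B L 1 := Cocycle.equivHomShift b
  have hαA : (Cochain.ofHom f).comp αB.1 (zero_add 1) =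
      (Cochain.ofHom a).comp (mappingCone.fst (𝟙 L)).1 (zero_add 1) := by
    rw [(comp_coneToShift_eq_iff _ _).1 sq.w, Cocycle.equivHomShift_comp]
    rfl
  let βA : Cochain A L 0 := (Cochain.ofHom a).comp (mappingCone.snd (𝟙 L)) (zero_add 0)
  have hβA : δ 0 1 βA + (Cochain.ofHom f).comp αB.1 (zero_add 1) = 0 := by
    rw [hαA, δ_ofHom_comp, mappingCone.δ_snd, Cochain.comp_neg]
    simp
  -- β' is only a degreewise extension. Its defect γ' vanishes on `A`, hence descends to a cocycle
  -- on the acyclic cokernel, where K-injectivity makes it a coboundary δε; subtracting ε corrects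
  -- β'.
  let β' : Cochain B L 0 := Cochain.ofHoms fun p => Injective.factorThru (βA.v p p (add_zero p)) (f.f p)
  have hβ' : (Cochain.ofHom f).comp β' (zero_add 0) = βA := by
    ext p
    simp [β']
  let γ' : Cochain B L 1 := δ 0 1 β' + αB.1
  have hγ' : (Cochain.ofHom f).comp γ' (zero_add 1) = 0 := by
    rw [Cochain.comp_add, ← δ_ofHom_comp, hβ', hβA]
  let γ : Cochain S.X₃ L 1 := Cochain.mk fun p q hpq => (hSp p).exact.desc (γ'.v p q hpq) (by
    have := Cochain.congr_v hγ' p q hpq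
    rwa [Cochain.zero_cochain_comp_v, Cochain.ofHom_v] at this)
  have hγ : (Cochain.ofHom (cokernel.π f)).comp γ (zero_add 1) = γ' := by
    ext p q hpq
    simp only [Cochain.zero_cochain_comp_v, Cochain.ofHom_v, γ]
    exact (hSp p).exact.g_desc _ _
  have hδγ : δ 1 2 γ = 0 := by
    ext p q hpq
    rw [← cancel_epi ((cokernel.π f).f p)]
    have : δ 1 2 γ' = 0 := by simp [γ', δ_δ]
    rw [← hγ, δ_ofHom_comp] at this
    simpa using Cochain.congr_v this p q hpq
  obtain ⟨ε, hε⟩ := IsKInjective.eq_δ_of_cocycle (Cocycle.mk γ 2 (by lia) hδγ) hC 0 (by lia)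
  let βB : Cochain B L 0 := β' - (Cochain.ofHom (cokernel.π f)).comp ε (zero_add 0)
  have hβB : δ 0 1 βB + αB.1.comp (Cochain.ofHom (𝟙 L)) (add_zero 1) = 0 := by
    rw [δ_sub, δ_ofHom_comp, hε]
    simp only [Cocycle.mk_coe, hγ, γ']
    rw [show Cochain.ofHom (𝟙 L) = Cochain.ofHom (𝟙 L) from rfl, Cochain.comp_id]
    abel
  have hβB' : (Cochain.ofHom f).comp βB (zero_add 0) = βA := by
    ext p
    have := HomologicalComplex.congr_hom (cokernel.condition f) p
    dsimp only [HomologicalComplex.comp_f, HomologicalComplex.zero_f] at this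
    rw [← hβ']
    simp [βB, reassoc_of% this]
  refine ⟨⟨⟨mappingCone.lift (𝟙 L) αB βB hβB, ?_, ?_⟩⟩⟩
  · ext p
    rw [mappingCone.ext_to_iff (𝟙 L) p _ rfl]
    constructor
    · have := Cochain.congr_v hαA p _ rfl
      simpa using this
    · have := Cochain.congr_v hβB' p p (add_zero p)
      simpa [βA] using this
  · rw [comp_coneToShift_eq_iff, mappingCone.lift_fst]⟩

lemma quasiIso_of_acyclic_cokernel {A B : CochainComplex C ℤ} (f : A ⟶ B) [Mono f]
    (hf : (cokernel f).Acyclic) : QuasiIso f := by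
  have hS : (ShortComplex.mk f (cokernel.π f) (by simp)).ShortExact :=
    { exact := ShortComplex.exact_cokernel f }
  rw [quasiIso_iff]
  intro i
  rw [quasiIsoAt_iff_isIso_homologyMap]
  have hz (j : ℤ) : IsZero ((cokernel f).homology j) := by
    rw [← exactAt_iff_isZero_homology]
    exact hf j
  have : Mono (HomologicalComplex.homologyMap f i) :=
    (hS.homology_exact₁ (i - 1) i (by simp)).mono_g ((hz _).eq_of_src _ _)
  have : Epi (HomologicalComplex.homologyMap f i) :=
    (hS.homology_exact₂ i).epi_f ((hz _).eq_of_tgt _ _)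
  exact isIso_of_mono_of_epi _

/-- A monomorphism which lifts against `cone (𝟙 L) ⟶ L⟦1⟧` for all `L` concentrated in a
single degree and injective there is a quasi-isomorphism. -/
lemma quasiIso_of_hasLiftingProperty_coneToShift [EnoughInjectives C] {A B : CochainComplex C ℤ}
    (f : A ⟶ B) [Mono f]
    (hf : ∀ (E : C) [Injective E] (n : ℤ),
      HasLiftingProperty f (coneToShift ((singleFunctor C n).obj E))) : QuasiIso f := by
  let S := ShortComplex.mk f (cokernel.π f) (by simp)
  have hS : S.ShortExact := { exact := ShortComplex.exact_cokernel f }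
  have hSp (p : ℤ) : (S.map (HomologicalComplex.eval C _ p)).ShortExact := hS.map_of_exact _
  have hSe (p : ℤ) : Epi ((cokernel.π f).f p) := (hSp p).epi_g
  have hSe' (p : ℤ) : Epi (S.map (HomologicalComplex.eval C _ p)).g := (hSp p).epi_g
  suffices S.X₃.Acyclic by
    exact quasiIso_of_acyclic_cokernel f this
  refine acyclic_of_injective_test _ fun E _ i j k hij hjk φ hφ => ?_
  -- With `E` in degree `k = j + 1`, φ becomes a 1-cocycle. A lift of the square with zero top
  -- bounds this cocycle by a cochain that vanishes on `A`, hence comes from the cokernel.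
  let L := (singleFunctor C k).obj E
  let α : Cocycle S.X₃ L 1 := Cocycle.toSingleMk φ hjk i hij hφ
  let αB : Cocycle B L 1 := α.precomp (cokernel.π f)
  let b : B ⟶ L⟦(1 : ℤ)⟧ := Cocycle.equivHomShift.symm αB
  have := hf E k
  have sq : CommSq (0 : A ⟶ mappingCone (𝟙 L)) f (coneToShift L) b := ⟨by
    symm
    rw [zero_comp, ← Cocycle.equivHomShift_symm_precomp, EmbeddingLike.map_eq_zero_iff]
    ext p q hpq
    have h1 := HomologicalComplex.congr_hom (cokernel.condition f) p
    dsimp only [HomologicalComplex.comp_f, HomologicalComplex.zero_f] at h1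
    simp [αB, reassoc_of% h1]⟩
  let βB : Cochain B L 0 := (Cochain.ofHom sq.lift).comp (mappingCone.snd _) (zero_add 0)
  have hβB : δ 0 1 βB + αB.1 = 0 := by
    have h := (comp_coneToShift_eq_iff _ _).1 sq.fac_right
    rw [AddEquiv.apply_symm_apply] at h
    rw [δ_ofHom_comp, mappingCone.δ_snd, Cochain.comp_neg, ← h]
    simp
  have hfβ : (Cochain.ofHom f).comp βB (zero_add 0) = 0 := by
    ext p
    have := HomologicalComplex.congr_hom sq.fac_left p
    dsimp only [HomologicalComplex.comp_f, HomologicalComplex.zero_f] at this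
    simp [βB, reassoc_of% this]
  obtain ⟨g, hg⟩ := Cochain.toSingleMk_surjective βB k (add_zero k)
  have hfg : f.f k ≫ g = 0 := by
    rw [← hg, ← Cochain.toSingleMk_precomp] at hfβ
    simpa using congr_arg (Cochain.toSingleEquiv (add_zero k)) hfβ
  obtain ⟨h, hh⟩ : ∃ h : (cokernel f).X k ⟶ E, (cokernel.π f).f k ≫ h = g :=
    ⟨(hSp k).exact.desc g hfg, (hSp k).exact.g_desc _ _⟩
  refine ⟨h, ?_⟩
  rw [← cancel_epi ((cokernel.π f).f j)]
  change (cokernel.π f).f j ≫ (cokernel f).d j k ≫ h = _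
  rw [(cokernel.π f).comm_assoc, hh, ← sub_eq_zero, ← neg_eq_zero]
  have hα : αB.1 = Cochain.toSingleMk ((cokernel.π f).f j ≫ φ) hjk :=
    (Cochain.toSingleMk_precomp _ _ _).symm
  rw [← hg, hα, Cochain.δ_toSingleMk _ _ _ j hjk, Int.negOnePow_one, Units.neg_smul, one_smul,
    ← Cochain.toSingleMk_neg, ← Cochain.toSingleMk_add] at hβB
  have := congr_arg (Cochain.toSingleEquiv hjk) hβB
  rw [Cochain.toSingleEquiv_toSingleMk, map_zero] at this
  rw [← this]
  abel

variable (C) in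
/-- The class of monomorphisms of complexes that are quasi-isomorphisms. -/
def monoQuasiIso : MorphismProperty (CochainComplex C ℤ) :=
  MorphismProperty.monomorphisms _ ⊓ HomologicalComplex.quasiIso C (.up ℤ)

variable (C) in
/-- A class of morphisms of complexes which detects by liftings the monomorphisms that are
quasi-isomorphisms. -/
def monoQuasiIsoTest : MorphismProperty (CochainComplex C ℤ) :=
  (MorphismProperty.monomorphisms _).rlp ⊔
    .ofHoms (fun i : {E : C // Injective E} × ℤ => coneToShift ((singleFunctor C i.2).obj i.1.1))

/-- Being an `llp`, the class is automatically closed under pushouts, transfinite compositions and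
retracts. The first half of the test class detects monomorphisms; the cones then detect
quasi-isomorphisms among them. -/
lemma llp_monoQuasiIsoTest [IsGrothendieckAbelian.{v} C] :
    (monoQuasiIsoTest C).llp = monoQuasiIso C := by
  have hmono : (MorphismProperty.monomorphisms (CochainComplex C ℤ)).rlp.llp =
      MorphismProperty.monomorphisms _ :=
    IsGrothendieckAbelian.llp_rlp_monomorphisms (isSeparator_separator _)
  apply le_antisymm
  · intro A B f hf
    have hf₁ : MorphismProperty.monomorphisms _ f := by
      rw [← hmono]
      exact fun _ _ g hg => hf g (Or.inl hg)
    have : Mono f := hf₁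
    exact ⟨hf₁, quasiIso_of_hasLiftingProperty_coneToShift f
      fun E hE n => hf _ (Or.inr ⟨(⟨⟨E, hE⟩, n⟩ : {E : C // Injective E} × ℤ)⟩)⟩
  · rintro A B f ⟨hf₁, hf₂⟩ X Y g (hg | hg)
    · rw [← hmono] at hf₁
      exact hf₁ _ hg
    · obtain ⟨⟨⟨E, hE⟩, n⟩⟩ := hg
      have : Mono f := hf₁
      have : QuasiIso f := hf₂
      have hinj (m : ℤ) : Injective (((singleFunctor C n).obj E).X m) := by
        by_cases h : m = n
        · subst h
          exact Injective.of_iso (HomologicalComplex.singleObjXSelf (.up ℤ) m E).symm hE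
        · exact (HomologicalComplex.isZero_single_obj_X (.up ℤ) n E m h).injective
      have : ((singleFunctor C n).obj E).IsStrictlyGE n :=
        inferInstanceAs (IsStrictlyGE ((HomologicalComplex.single _ _ _).obj E) n)
      have := isKInjective_of_injective ((singleFunctor C n).obj E) n
      exact hasLiftingProperty_coneToShift f _

/-- A class of monomorphisms and quasi-isomorphisms generates only such morphisms. -/
lemma llp_rlp_le_monoQuasiIso [IsGrothendieckAbelian.{v} C]
    {J : MorphismProperty (CochainComplex C ℤ)} (hJ : J ≤ monoQuasiIso C) :
    J.rlp.llp ≤ monoQuasiIso C := by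
  rw [← llp_monoQuasiIsoTest] at hJ ⊢
  exact (MorphismProperty.antitone_llp (MorphismProperty.antitone_rlp hJ)).trans
    (MorphismProperty.llp_rlp_llp _).le

end Abelian

/-! ### Enlarging a complex, by a bounded amount, until its image in an acyclic complex is acyclic.
-/

section KInjectiveResolutions

open HomologicalComplex CochainComplex HomComplex

variable {C : Type u} [Category.{v} C] [Abelian C] [IsGrothendieckAbelian.{v} C]

section AB5

omit [IsGrothendieckAbelian.{v} C] in
/-- Kernels commute with filtered colimits. -/
lemma kernel_hom_eq_zero_of_isColimit {J : Type*} [Category* J] [IsFiltered J]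
    [HasColimitsOfShape J C] [HasExactColimitsOfShape J C] {F : J ⥤ C} {c : Cocone F}
    (hc : IsColimit c) {Y : C} (f : c.pt ⟶ Y) {W : C} (h : kernel f ⟶ W)
    (hh : ∀ j, kernel.map (c.ι.app j ≫ f) f (c.ι.app j) (𝟙 Y) (by simp) ≫ h = 0) : h = 0 := by
  have : IsConnected J := IsFiltered.isConnected J
  let α : F ⟶ (Functor.const J).obj Y :=
    { app j := c.ι.app j ≫ f
      naturality i j g := by simp }
  let S := ShortComplex.mk (kernel.ι α) α (by simp)
  have hS : S.Exact := ShortComplex.exact_kernel α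
  have hS' : (S.map colim).Exact := hS.map colim
  let e : colimit F ≅ c.pt := (colimit.isColimit F).coconePointUniqueUpToIso hc
  have he (j : J) : colimit.ι F j ≫ e.hom = c.ι.app j :=
    IsColimit.comp_coconePointUniqueUpToIso_hom _ _ _
  let e' : colimit ((Functor.const J).obj Y) ≅ Y :=
    (colimit.isColimit _).coconePointUniqueUpToIso (isColimitConstCocone J Y)
  have he' (j : J) : colimit.ι ((Functor.const J).obj Y) j ≫ e'.hom = 𝟙 Y :=
    IsColimit.comp_coconePointUniqueUpToIso_hom _ _ _
  have hα : colimMap α ≫ e'.hom = e.hom ≫ f := by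
    refine colimit.hom_ext fun j => ?_
    rw [ι_colimMap_assoc, he', reassoc_of% he]
    simp [α]
  have hker : colimMap (kernel.ι α) ≫ e.hom ≫ f = 0 := by
    rw [← hα]
    refine colimit.hom_ext fun j => ?_
    rw [ι_colimMap_assoc, ι_colimMap_assoc, ← NatTrans.comp_app_assoc, kernel.condition]
    simp
  let u : colimit (kernel α) ⟶ kernel f := kernel.lift f (colimMap (kernel.ι α) ≫ e.hom)
    (by simpa using hker)
  have h0 : (kernel.ι f ≫ e.inv) ≫ colimMap α = 0 := by
    rw [← cancel_mono e'.hom, zero_comp, Category.assoc, hα]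
    simp
  -- Exactness of filtered colimits: the kernels at the stages of the diagram jointly cover `kernel
  -- f`.
  have hu : Epi u := by
    obtain ⟨A, π, _, x, hx⟩ : ∃ (A : C) (π : A ⟶ kernel f) (_ : Epi π) (x : A ⟶ colimit (kernel α)),
        π ≫ kernel.ι f ≫ e.inv = x ≫ colimMap (kernel.ι α) :=
      hS'.exact_up_to_refinements (kernel.ι f ≫ e.inv) h0
    have : x ≫ u = π := by
      rw [← cancel_mono (kernel.ι f)]
      change (x ≫ kernel.lift f (colimMap (kernel.ι α) ≫ e.hom) _) ≫ kernel.ι f = _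
      rw [Category.assoc, kernel.lift_ι, ← Category.assoc]
      exact (congr_arg (· ≫ e.hom) hx.symm).trans (by simp)
    exact epi_of_epi_fac this
  rw [← cancel_epi u, comp_zero]
  refine colimit.hom_ext fun j => ?_
  have : colimit.ι (kernel α) j ≫ u =
      kernel.lift (c.ι.app j ≫ f) ((kernel.ι α).app j) (by
        change (kernel.ι α).app j ≫ α.app j = 0
        rw [← NatTrans.comp_app, kernel.condition]
        rfl) ≫ kernel.map (c.ι.app j ≫ f) f (c.ι.app j) (𝟙 Y) (by simp) := by
    rw [← cancel_mono (kernel.ι f)]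
    simp [u, he]
  rw [reassoc_of% this, hh]
  simp

instance : HasColimitsOfShape ℕ C :=
  hasColimitsOfShape_of_equivalence (AsSmall.equiv.{0, 0, v} (C := ℕ)).symm

instance : HasExactColimitsOfShape ℕ C :=
  have : IsFiltered (AsSmall.{v} ℕ) := .of_equivalence AsSmall.equiv
  HasExactColimitsOfShape.of_domain_equivalence C (AsSmall.equiv.{0, 0, v} (C := ℕ)).symm

end AB5

/-- A coproduct of copies of `G` which is big enough to cover any subobject of `S`. -/
abbrev coverObj (G S : C) : C := ∐ fun _ : Shrink.{v} (Subobject S) => G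

open Classical in
-- One morphism `G ⟶ R` is kept for each subobject of `S` that occurs as an image; morphisms with
-- the same image in `K` are killed by the same morphisms out of `K`. The point is that `coverObj G
-- S` depends on neither `R` nor `K`.
lemma exists_coverObj_epi {G : C} (hG : IsSeparator G) {R K S : C} (r : R ⟶ K) [Epi r]
    (m : K ⟶ S) [Mono m] : ∃ t : coverObj G S ⟶ R, Epi (t ≫ r) := by
  let P (s : Subobject S) (g : G ⟶ R) : Prop := (Subobject.map m).obj (imageSubobject (g ≫ r)) = s
  let t : coverObj G S ⟶ R := Sigma.desc fun s =>
    if h : ∃ g, P ((equivShrink _).symm s) g then h.choose else 0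
  refine ⟨t, Preadditive.epi_of_cancel_zero _ fun {W} h hh => ?_⟩
  rw [← cancel_epi r, comp_zero]
  refine (isSeparator_def G).1 hG _ _ fun g => ?_
  have hex : ∃ g', P ((equivShrink _).symm (equivShrink _
      ((Subobject.map m).obj (imageSubobject (g ≫ r))))) g' := ⟨g, by simp [P]⟩
  obtain ⟨g', hg', hg''⟩ : ∃ g' : G ⟶ R, imageSubobject (g' ≫ r) = imageSubobject (g ≫ r) ∧
      g' ≫ r ≫ h = 0 := by
    refine ⟨hex.choose, ?_, ?_⟩
    · exact Subobject.map_obj_injective m (hex.choose_spec.trans (Equiv.symm_apply_apply _ _))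
    · have := Sigma.ι (fun _ : Shrink.{v} (Subobject S) => G)
        (equivShrink _ ((Subobject.map m).obj (imageSubobject (g ≫ r)))) ≫= hh
      simp only [t, Category.assoc, colimit.ι_desc_assoc, comp_zero] at this
      dsimp at this
      rwa [dif_pos hex] at this
  have h1 : (imageSubobject (g' ≫ r)).arrow ≫ h = 0 := by
    rw [← cancel_epi (factorThruImageSubobject (g' ≫ r))]
    simpa using hg''
  rw [hg'] at h1
  rw [comp_zero, ← Category.assoc, ← imageSubobject_arrow_comp (g ≫ r), Category.assoc, h1, comp_zero]

/-- The complex obtained from `Y` by adding enough contractible complexes to kill the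
cohomology of `Y` in any acyclic complex. -/
abbrev enlarge (G : C) (Y : CochainComplex C ℤ) : CochainComplex C ℤ :=
  Y ⨿ ∐ fun i : Σ n : ℤ, Shrink.{v} (Subobject (Y.X n)) =>
    HomologicalComplex.double (𝟙 G) (show (ComplexShape.up ℤ).Rel (i.1 - 1) i.1 by simp)

/-- A cocycle of the image of `Y` in the acyclic `M` is, up to a cover, the differential of an
element lifted to `B`. Contractible two-term complexes on `G` are mapped to `B` so as to hit these
elements; how many are needed depends on `Y` alone, not on `B` or `M`. -/
lemma exists_enlarge {G : C} (hG : IsSeparator G) {Y B M : CochainComplex C ℤ} (b : Y ⟶ B)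
    (q : B ⟶ M) [Epi q] (hM : M.Acyclic) :
    ∃ b' : enlarge G Y ⟶ B, coprod.inl ≫ b' = b ∧ ∀ i j k : ℤ, i + 1 = j → j + 1 = k →
      ∀ (W : C) (z : W ⟶ Y.X j), z ≫ b.f j ≫ q.f j ≫ M.d j k = 0 →
      ∃ (T : C) (e : T ⟶ W) (_ : Epi e) (a : T ⟶ (enlarge G Y).X i),
        e ≫ z ≫ b.f j ≫ q.f j = a ≫ b'.f i ≫ q.f i ≫ M.d i j := by
  have hq (i : ℤ) : Epi (q.f i) := inferInstance
  have key (n : ℤ) : ∃ t : coverObj G (Y.X n) ⟶ pullback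
      (kernel.ι (b.f n ≫ q.f n ≫ M.d n (n + 1)) ≫ b.f n ≫ q.f n) (q.f (n - 1) ≫ M.d (n - 1) n),
      Epi (t ≫ pullback.fst _ _) := by
    have : Epi (pullback.fst (kernel.ι (b.f n ≫ q.f n ≫ M.d n (n + 1)) ≫ b.f n ≫ q.f n)
        (q.f (n - 1) ≫ M.d (n - 1) n)) := by
      obtain ⟨A, π, _, x, hx⟩ :=
        (exact_int M hM (n - 1) n (n + 1) (by simp) rfl).exact_up_to_refinements
          (kernel.ι (b.f n ≫ q.f n ≫ M.d n (n + 1)) ≫ b.f n ≫ q.f n)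
          (by rw [Category.assoc, Category.assoc]; exact kernel.condition _)
      obtain ⟨A', π', _, y, hy⟩ := surjective_up_to_refinements_of_epi (q.f (n - 1)) x
      refine epi_of_epi_fac (f := pullback.lift (π' ≫ π) y ?_) (h := π' ≫ π) (pullback.lift_fst _ _ _)
      dsimp only at hx
      rw [Category.assoc, hx, reassoc_of% hy]
    exact exists_coverObj_epi hG _ (kernel.ι _)
  choose t ht using key
  let D (i : Σ n : ℤ, Shrink.{v} (Subobject (Y.X n))) := HomologicalComplex.double (𝟙 G)
    (show (ComplexShape.up ℤ).Rel (i.1 - 1) i.1 by simp)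
  -- A morphism from the two-term complex with differential `𝟙 G` is the same as a morphism from `G`
  -- to the lower degree.
  let φ (i : Σ n : ℤ, Shrink.{v} (Subobject (Y.X n))) : D i ⟶ B :=
    (HomologicalComplex.evalCompCoyonedaCorepresentableByDoubleId _ (by lia) G).homEquiv.symm
      (Sigma.ι (fun _ => G) i.2 ≫ t i.1 ≫ pullback.snd _ _)
  refine ⟨coprod.desc b (Sigma.desc φ), coprod.inl_desc _ _, fun i j k hij hjk W z hz => ?_⟩
  obtain rfl : i = j - 1 := by lia
  obtain rfl := hjk
  obtain ⟨T, e, he, x, hx⟩ := surjective_up_to_refinements_of_epi (t j ≫ pullback.fst _ _)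
    (kernel.lift (b.f j ≫ q.f j ≫ M.d j (j + 1)) z hz)
  refine ⟨T, e, he, x ≫ Sigma.desc fun s => (doubleXIso₀ _ _).inv ≫
    (Sigma.ι D ⟨j, s⟩).f (j - 1) ≫ (coprod.inr : _ ⟶ enlarge G Y).f _, ?_⟩
  have hx' : e ≫ z = x ≫ (t j ≫ pullback.fst _ _) ≫ kernel.ι _ := by
    rw [Category.assoc, ← reassoc_of% hx, kernel.lift_ι]
  rw [reassoc_of% hx', Category.assoc]
  congr 1
  rw [pullback.condition]
  have hφ (s) : (doubleXIso₀ (𝟙 G) _).inv ≫ (φ ⟨j, s⟩).f (j - 1) =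
      Sigma.ι (fun _ => G) s ≫ t j ≫ pullback.snd _ _ :=
    (HomologicalComplex.evalCompCoyonedaCorepresentableByDoubleId _ (by lia) G).homEquiv.apply_symm_apply
      (Sigma.ι (fun _ => G) s ≫ t j ≫ pullback.snd _ _)
  refine Sigma.hom_ext _ _ fun s => ?_
  rw [colimit.ι_desc_assoc]
  dsimp only [Cofan.mk_pt, Cofan.mk_ι_app]
  simp only [Category.assoc]
  have h : (Sigma.ι D ⟨j, s⟩).f (j - 1) ≫ (coprod.inr : _ ⟶ enlarge G Y).f (j - 1) ≫
      (coprod.desc b (Sigma.desc φ)).f (j - 1) = (φ ⟨j, s⟩).f (j - 1) := by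
    rw [← HomologicalComplex.comp_f, ← HomologicalComplex.comp_f, coprod.inr_desc, colimit.ι_desc]
    rfl
  rw [reassoc_of% h, reassoc_of% (hφ s)]

/-- The iterations of `enlarge`. -/
def enlargeIter (G : C) (Y : CochainComplex C ℤ) : ℕ → CochainComplex C ℤ
  | 0 => Y
  | n + 1 => enlarge G (enlargeIter G Y n)

/-- The sequence of the iterations of `enlarge`. -/
def enlargeSeq (G : C) (Y : CochainComplex C ℤ) : ℕ ⥤ CochainComplex C ℤ :=
  Functor.ofSequence (X := enlargeIter G Y) fun _ => coprod.inl

/-- Compatible extensions to the iterations of `enlarge` of a morphism from `Y`. -/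
def enlargeExtend {G : C} (hG : IsSeparator G) {Y B M : CochainComplex C ℤ} (b : Y ⟶ B)
    (q : B ⟶ M) [Epi q] (hM : M.Acyclic) : (n : ℕ) → (enlargeIter G Y n ⟶ B)
  | 0 => b
  | n + 1 => (exists_enlarge hG (enlargeExtend hG b q hM n) q hM).choose

/-- The extension to the colimit of the iterations of `enlarge` of a morphism from `Y`. -/
def enlargeCocone {G : C} (hG : IsSeparator G) {Y B M : CochainComplex C ℤ} (b : Y ⟶ B)
    (q : B ⟶ M) [Epi q] (hM : M.Acyclic) : Cocone (enlargeSeq G Y) where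
  pt := B
  ι := NatTrans.ofSequence (enlargeExtend hG b q hM) fun n => by
    have h : (coprod.inl : _ ⟶ enlarge G (enlargeIter G Y n)) ≫ enlargeExtend hG b q hM (n + 1) =
      enlargeExtend hG b q hM n := (exists_enlarge hG (enlargeExtend hG b q hM n) q hM).choose_spec.1
    refine Eq.trans ?_ (h.trans (Category.comp_id _).symm)
    exact congr_arg (· ≫ _) (Functor.ofSequence_map_homOfLE_succ _ n)

/-- Every morphism to a complex `B` with an acyclic quotient `M` extends to a morphism from
`colimit (enlargeSeq G Y)`, whose image in `M` is acyclic. -/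
lemma exists_extension_acyclic_image {G : C} (hG : IsSeparator G) {Y B M : CochainComplex C ℤ}
    (b : Y ⟶ B) (q : B ⟶ M) [Epi q] (hM : M.Acyclic) :
    ∃ b' : colimit (enlargeSeq G Y) ⟶ B, (colimit.ι (enlargeSeq G Y) 0 : Y ⟶ _) ≫ b' = b ∧
      (image (b' ≫ q)).Acyclic := by
  let b' : colimit (enlargeSeq G Y) ⟶ B := colimit.desc _ (enlargeCocone hG b q hM)
  have hb' (n : ℕ) : (colimit.ι (enlargeSeq G Y) n : enlargeIter G Y n ⟶ _) ≫ b' =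
    enlargeExtend hG b q hM n := colimit.ι_desc _ _
  refine ⟨b', hb' 0, acyclic_of_exact _ fun i j k hij hjk => ?_⟩
  set N := image (b' ≫ q)
  let e : colimit (enlargeSeq G Y) ⟶ N := factorThruImage (b' ≫ q)
  let m : N ⟶ M := image.ι (b' ≫ q)
  have hem : e ≫ m = b' ≫ q := image.fac _
  have hemf (n : ℤ) : e.f n ≫ m.f n = b'.f n ≫ q.f n := HomologicalComplex.congr_hom hem n
  have : Epi (e.f j) := inferInstance
  have hm : Mono (m.f j) := inferInstance
  rw [ShortComplex.exact_iff_kernel_ι_comp_cokernel_π_zero]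
  change kernel.ι (N.d j k) ≫ cokernel.π (N.d i j) = 0
  let c : Cocone (enlargeSeq G Y ⋙ eval C _ j) := (eval C _ j).mapCocone (colimit.cocone _)
  have hc : IsColimit c := isColimitOfPreserves _ (colimit.isColimit _)
  obtain ⟨l, g, hg, hgm, key⟩ : ∃ (l : ∀ n, enlargeIter G Y n ⟶ colimit (enlargeSeq G Y))
      (g : ∀ n, enlargeIter G Y n ⟶ N) (hg : ∀ n, l n ≫ e = g n)
      (_ : ∀ n, g n ≫ m = enlargeExtend hG b q hM n ≫ q),
      ∀ {W : C} (h : kernel (e.f j ≫ N.d j k) ⟶ W),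
        (∀ n, kernel.map ((l n).f j ≫ e.f j ≫ N.d j k) (e.f j ≫ N.d j k) ((l n).f j) (𝟙 _)
          (by simp) ≫ h = 0) → h = 0 :=
    ⟨colimit.ι (enlargeSeq G Y), fun n => colimit.ι (enlargeSeq G Y) n ≫ e, fun n => rfl,
      fun n => (Category.assoc _ _ _).trans ((congr_arg (colimit.ι (enlargeSeq G Y) n ≫ ·) hem).trans
        ((Category.assoc _ _ _).symm.trans (congr_arg (· ≫ q) (hb' n)))),
      fun {W} h hh => kernel_hom_eq_zero_of_isColimit hc (e.f j ≫ N.d j k) h hh⟩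
  have hgm' (n : ℕ) (i : ℤ) := HomologicalComplex.congr_hom (hgm n) i
  dsimp only [HomologicalComplex.comp_f] at hgm'
  let p : kernel (e.f j ≫ N.d j k) ⟶ kernel (N.d j k) := kernel.map _ _ (e.f j) (𝟙 _) (by simp)
  have hp : Epi p := by
    obtain ⟨A, π, _, y, hy⟩ := surjective_up_to_refinements_of_epi (e.f j) (kernel.ι (N.d j k))
    have : kernel.lift _ y (by rw [← reassoc_of% hy, kernel.condition, comp_zero]) ≫ p = π := by
      rw [← cancel_mono (kernel.ι _), Category.assoc, kernel.lift_ι, kernel.lift_ι_assoc, ← hy]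
    exact epi_of_epi_fac this
  rw [← cancel_epi p, comp_zero]
  -- By AB5 it is enough to treat cocycles coming from a stage `n`; these have become coboundaries
  -- at stage `n + 1`.
  refine key _ fun n => ?_
  let z : kernel ((l n).f j ≫ e.f j ≫ N.d j k) ⟶ (enlargeIter G Y n).X j := kernel.ι _
  have hz' : z ≫ (l n).f j ≫ e.f j ≫ N.d j k = 0 := kernel.condition _
  have hz : z ≫ (enlargeExtend hG b q hM n).f j ≫ q.f j ≫ M.d j k = 0 := by
    rw [← reassoc_of% (hgm' n j), ← hg n, m.comm, HomologicalComplex.comp_f, Category.assoc,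
      reassoc_of% hz', zero_comp]
  obtain ⟨T, t, _, a, ha⟩ : ∃ (T : C) (t : T ⟶ _) (_ : Epi t)
      (a : T ⟶ (enlargeIter G Y (n + 1)).X i),
      t ≫ z ≫ (enlargeExtend hG b q hM n).f j ≫ q.f j =
        a ≫ (enlargeExtend hG b q hM (n + 1)).f i ≫ q.f i ≫ M.d i j :=
    (exists_enlarge hG (enlargeExtend hG b q hM n) q hM).choose_spec.2 i j k hij hjk _ z hz
  rw [← hgm' n j, ← reassoc_of% (hgm' (n + 1) i), m.comm] at ha
  simp only [← Category.assoc, cancel_mono] at ha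
  simp only [Category.assoc] at ha
  rw [← cancel_epi t, comp_zero]
  have h : kernel.map ((l n).f j ≫ e.f j ≫ N.d j k) (e.f j ≫ N.d j k) ((l n).f j) (𝟙 (N.X k))
      (by simp) ≫ p ≫ kernel.ι (N.d j k) = z ≫ (g n).f j := by
    simp [p, z, ← hg]
  rw [reassoc_of% h, reassoc_of% ha, cokernel.condition, comp_zero, comp_zero]

end KInjectiveResolutions

/-! ### Generators for the monomorphic quasi-isomorphisms, and K-injective resolutions. -/

section KInjectiveResolutions

open HomologicalComplex CochainComplex HomComplex MorphismProperty ZeroObject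

variable {C : Type u} [Category.{v} C] [Abelian C]

instance mono_mappingCone_inr {K L : CochainComplex C ℤ} (f : K ⟶ L) :
    Mono (mappingCone.inr f) := by
  have (n : ℤ) : Mono ((mappingCone.inr f).f n) :=
    mono_of_mono_fac (mappingCone.inr_f_snd_v f n)
  exact HomologicalComplex.mono_of_mono_f _ this

lemma acyclic_mappingCone_id (K : CochainComplex C ℤ) : (mappingCone (𝟙 K)).Acyclic := fun n => by
  rw [exactAt_iff_isZero_homology, IsZero.iff_id_eq_zero, ← HomologicalComplex.homologyMap_id,
    (mappingCone.homotopyToZeroOfId K).homologyMap_eq, HomologicalComplex.homologyMap_zero]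

lemma quasiIso_of_acyclic {K L : CochainComplex C ℤ} (f : K ⟶ L) (hK : K.Acyclic) (hL : L.Acyclic) :
    QuasiIso f := by
  rw [quasiIso_iff]
  exact fun n => (quasiIsoAt_iff_exactAt f n (hK n)).2 (hL n)

/-- A morphism which extends along `K ⟶ cone (𝟙 K)` is homotopic to zero. -/
def homotopyOfExtension {K L : CochainComplex C ℤ} {f : K ⟶ L} (g : mappingCone (𝟙 K) ⟶ L)
    (hg : mappingCone.inr (𝟙 K) ≫ g = f) : Homotopy f 0 :=
  (Homotopy.ofEq (by simp [hg])).trans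
    ((((mappingCone.homotopyToZeroOfId K).compLeft (mappingCone.inr (𝟙 K))).compRight g).trans
      (Homotopy.ofEq (by simp)))

/-- A morphism with the right lifting property against monomorphisms is a quasi-isomorphism. -/
lemma quasiIso_of_monomorphisms_rlp {X Y : CochainComplex C ℤ} (p : X ⟶ Y)
    (hp : (monomorphisms (CochainComplex C ℤ)).rlp p) : QuasiIso p := by
  have := hp (0 : (0 : CochainComplex C ℤ) ⟶ Y) (monomorphisms.infer_property _)
  have sq₁ : CommSq 0 (0 : (0 : CochainComplex C ℤ) ⟶ Y) p (𝟙 Y) := ⟨by simp⟩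
  let s : Y ⟶ X := sq₁.lift
  have hs : s ≫ p = 𝟙 Y := sq₁.fac_right
  have := hp (mappingCone.inr (𝟙 X)) (monomorphisms.infer_property _)
  -- `𝟙 X - p ≫ s` becomes zero after composition with `p`, so it can be extended to `cone (𝟙 X)`,
  -- which makes it null-homotopic.
  have sq₂ : CommSq (𝟙 X - p ≫ s) (mappingCone.inr (𝟙 X)) p 0 := ⟨by simp [hs]⟩
  have h := homotopyOfExtension sq₂.lift sq₂.fac_left
  rw [quasiIso_iff]
  intro n
  rw [quasiIsoAt_iff_isIso_homologyMap]
  refine ⟨HomologicalComplex.homologyMap s n, ?_, ?_⟩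
  · have := h.homologyMap_eq n
    rw [HomologicalComplex.homologyMap_sub, HomologicalComplex.homologyMap_comp,
      HomologicalComplex.homologyMap_zero, HomologicalComplex.homologyMap_id, sub_eq_zero] at this
    exact this.symm
  · rw [← HomologicalComplex.homologyMap_comp, hs, HomologicalComplex.homologyMap_id]

variable [IsGrothendieckAbelian.{v} C]

variable (C) in
/-- A colimit of complexes through which all the lifting problems of quasi-isomorphisms against
monomorphisms to a separator can be enlarged. -/
def genEnlarged : CochainComplex C ℤ := colimit (enlargeSeq (separator C) (separator (CochainComplex C ℤ)))

variable (C) in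
/-- A small family of morphisms which generates the class of monomorphisms of complexes that are
quasi-isomorphisms. -/
def genMonoQuasiIso : MorphismProperty (CochainComplex C ℤ) :=
  .ofHoms fun i : Σ K : Subobject (genEnlarged C),
    {S : Subobject (cokernel K.arrow) // QuasiIso S.arrow} => i.2.1.arrow

instance : IsSmall.{v} (genMonoQuasiIso C) := isSmall_ofHoms _

lemma genMonoQuasiIso_le : genMonoQuasiIso C ≤ monoQuasiIso C := by
  rintro _ _ _ ⟨i⟩
  exact ⟨monomorphisms.infer_property _, i.2.2⟩

instance : HasSmallObjectArgument.{v} (genMonoQuasiIso C) :=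
  hasSmallObjectArgument_of_le_monomorphisms _ (genMonoQuasiIso_le.trans inf_le_left)

lemma exists_mono_monomorphisms_rlp {D : Type u} [Category.{v} D] [Abelian D]
    [IsGrothendieckAbelian.{v} D] {X Y : D} (p : X ⟶ Y) :
    ∃ (B : D) (i : X ⟶ B) (r : B ⟶ Y), Mono i ∧ (monomorphisms D).rlp r ∧ i ≫ r = p := by
  let d := MorphismProperty.factorizationData (monomorphisms D) (monomorphisms D).rlp p
  exact ⟨_, d.i, d.p, d.hi, d.hp, d.fac⟩

lemma mono_cokernel_desc_kernelSubobject {D : Type*} [Category* D] [Abelian D] {X Y : D} (f : X ⟶ Y) :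
    Mono (cokernel.desc (kernelSubobject f).arrow f (kernelSubobject_arrow_comp f)) := by
  refine Preadditive.mono_of_cancel_zero _ fun {T} t ht => ?_
  obtain ⟨A, π, _, y, hy⟩ := surjective_up_to_refinements_of_epi (cokernel.π (kernelSubobject f).arrow) t
  have hyf : y ≫ f = 0 := by
    rw [← cokernel.π_desc (kernelSubobject f).arrow f (kernelSubobject_arrow_comp f), ← reassoc_of% hy,
      ht, comp_zero]
  rw [← cancel_epi π, comp_zero, hy,
    ← factorThruKernelSubobject_comp_arrow f y hyf, Category.assoc, cokernel.condition, comp_zero]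

/-- `B₀` is the image in `B` of an enlargement of the separator and `Z₀` is its intersection with
`X`. The quotient `B₀/Z₀` is the image of the enlargement in `cokernel i`, hence acyclic, so `s`
belongs to the generating set. The last clause says that `Z₀` contains everything in `B₀` that comes
from `X`. -/
lemma exists_subobject_cokernel {X B : CochainComplex C ℤ} (i : X ⟶ B) [Mono i] [QuasiIso i]
    (d : separator (CochainComplex C ℤ) ⟶ B) :
    ∃ (Z₀ B₀ : CochainComplex C ℤ) (s : Z₀ ⟶ B₀) (_ : genMonoQuasiIso C s)
      (π : separator (CochainComplex C ℤ) ⟶ B₀) (m : B₀ ⟶ B) (a : Z₀ ⟶ X),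
      π ≫ m = d ∧ Mono m ∧ a ≫ i = s ≫ m ∧ ∀ {T : CochainComplex C ℤ} (t : T ⟶ B₀) (t' : T ⟶ X),
        t ≫ m = t' ≫ i → ∃ w : T ⟶ Z₀, w ≫ s = t := by
  have hS : (ShortComplex.mk i (cokernel.π i) (by simp)).ShortExact :=
    { exact := ShortComplex.exact_cokernel i }
  have hM : (cokernel i).Acyclic := hS.acyclic_X₃ ‹_›
  obtain ⟨l, b, hb, hN⟩ : ∃ (l : separator (CochainComplex C ℤ) ⟶ genEnlarged C)
      (b : genEnlarged C ⟶ B), l ≫ b = d ∧ (image (b ≫ cokernel.π i)).Acyclic :=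
    ⟨_, exists_extension_acyclic_image (isSeparator_separator C) d (cokernel.π i) hM⟩
  let K : Subobject (genEnlarged C) := kernelSubobject b
  let m : cokernel K.arrow ⟶ B := cokernel.desc _ b (kernelSubobject_arrow_comp _)
  have hm : Mono m := mono_cokernel_desc_kernelSubobject b
  let S : Subobject (cokernel K.arrow) := kernelSubobject (m ≫ cokernel.π i)
  have hS' : QuasiIso S.arrow := by
    refine quasiIso_of_acyclic_cokernel _ ?_
    let j : cokernel S.arrow ⟶ cokernel i := cokernel.desc _ _ (kernelSubobject_arrow_comp _)
    have : Mono j := mono_cokernel_desc_kernelSubobject _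
    let e := image.isoStrongEpiMono (cokernel.π K.arrow ≫ cokernel.π S.arrow) j
      (show _ = b ≫ cokernel.π i by
        rw [Category.assoc, cokernel.π_desc, cokernel.π_desc_assoc])
    exact fun n => (hN n).of_iso e.symm
  refine ⟨_, _, S.arrow, ⟨(⟨K, S, hS'⟩ : Σ K : Subobject (genEnlarged C),
    {S : Subobject (cokernel K.arrow) // QuasiIso S.arrow})⟩, l ≫ cokernel.π K.arrow, m,
    hS.exact.lift (S.arrow ≫ m) (by simp [S]), ?_, hm, hS.exact.lift_f _ _, fun t t' h => ?_⟩
  · rw [Category.assoc, cokernel.π_desc, hb]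
  · exact ⟨factorThruKernelSubobject _ t (by rw [reassoc_of% h]; simp),
      factorThruKernelSubobject_comp_arrow _ _ _⟩

/-- Write `p` as a monomorphism `i : X ⟶ B` followed by `r` with the lifting property against
monomorphisms. A lifting problem for a subobject of the separator is solved first in `B`; the
solution lies in some `B₀`, and lifting against the generator `Z₀ ⟶ B₀` moves it to `X` without
changing its image in `Y`. -/
lemma monomorphisms_rlp_of_genMonoQuasiIso_rlp {X Y : CochainComplex C ℤ} (p : X ⟶ Y) [QuasiIso p]
    (hp : (genMonoQuasiIso C).rlp p) : (monomorphisms (CochainComplex C ℤ)).rlp p := by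
  obtain ⟨B, i, r, _, hr, rfl⟩ := exists_mono_monomorphisms_rlp p
  have := quasiIso_of_monomorphisms_rlp r hr
  have : QuasiIso i := quasiIso_of_comp_right i r
  rw [← IsGrothendieckAbelian.generatingMonomorphisms_rlp (isSeparator_separator _)]
  rintro _ _ _ ⟨Z⟩
  refine ⟨fun {u w} sq => ?_⟩
  have := hr Z.arrow (monomorphisms.infer_property _)
  have sq' : CommSq (u ≫ i) Z.arrow r w := ⟨by simpa using sq.w⟩
  obtain ⟨Z₀, B₀, s, hs, π, m, a, hπ, _, ha, hZ⟩ := exists_subobject_cokernel i sq'.lift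
  have := hp s hs
  have sq₀ : CommSq a s (i ≫ r) (m ≫ r) := ⟨by rw [reassoc_of% ha]⟩
  obtain ⟨z, hz⟩ := hZ (Z.arrow ≫ π) u (by rw [Category.assoc, hπ, sq'.fac_left])
  refine ⟨⟨⟨π ≫ sq₀.lift, ?_, ?_⟩⟩⟩
  · rw [← Category.assoc, ← hz, Category.assoc, sq₀.fac_left, ← cancel_mono i, Category.assoc, ha,
      reassoc_of% hz, hπ, sq'.fac_left]
  · rw [Category.assoc, sq₀.fac_right, reassoc_of% hπ, sq'.fac_right]

/-- Retract argument: in the small object factorization of `f` the second factor is a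
quasi-isomorphism, so it lifts against the monomorphism `f`. -/
lemma monoQuasiIso_le_llp_rlp : monoQuasiIso C ≤ (genMonoQuasiIso C).rlp.llp := by
  rintro A B f ⟨hf, hf'⟩
  let d := MorphismProperty.factorizationData (genMonoQuasiIso C).rlp.llp (genMonoQuasiIso C).rlp f
  have hd := (llp_rlp_le_monoQuasiIso genMonoQuasiIso_le) _ d.hi
  have : QuasiIso d.i := hd.2
  have : QuasiIso f := hf'
  have : QuasiIso (d.i ≫ d.p) := by rwa [d.fac]
  have : QuasiIso d.p := quasiIso_of_comp_left d.i d.p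
  have := monomorphisms_rlp_of_genMonoQuasiIso_rlp d.p d.hp f hf
  exact of_retract (RetractArrow.ofLeftLiftingProperty d.fac) d.hi

omit [IsGrothendieckAbelian.{v} C] in
-- A morphism from an acyclic `A` extends along the monomorphic quasi-isomorphism `A ⟶ cone (𝟙 A)`,
-- hence is null-homotopic.
lemma isKInjective_of_rlp {I : CochainComplex C ℤ} (hI : (monoQuasiIso C).rlp (0 : I ⟶ 0)) :
    I.IsKInjective := ⟨fun {A} f hA => by
  have := hI (mappingCone.inr (𝟙 A)) ⟨monomorphisms.infer_property _,
    quasiIso_of_acyclic _ hA (acyclic_mappingCone_id A)⟩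
  have sq : CommSq f (mappingCone.inr (𝟙 A)) (0 : I ⟶ 0) 0 := ⟨by simp⟩
  exact ⟨homotopyOfExtension sq.lift sq.fac_left⟩⟩

/-- Every complex in a Grothendieck abelian category has a K-injective resolution. -/
theorem exists_isKInjective_quasiIso (K : CochainComplex C ℤ) :
    ∃ (I : CochainComplex C ℤ) (f : K ⟶ I), I.IsKInjective ∧ QuasiIso f := by
  let d := MorphismProperty.factorizationData (genMonoQuasiIso C).rlp.llp (genMonoQuasiIso C).rlp
    (0 : K ⟶ 0)
  refine ⟨d.Z, d.i, isKInjective_of_rlp fun A B f hf => ?_,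
    ((llp_rlp_le_monoQuasiIso genMonoQuasiIso_le) _ d.hi).2⟩
  have := monoQuasiIso_le_llp_rlp _ hf _ d.hp
  rwa [(isZero_zero _).eq_of_tgt d.p 0] at this

end KInjectiveResolutions

/-! ### Tensor-Hom adjunction for complexes, on cochains, morphisms and homotopies. -/

section TensorHom

open HomologicalComplex CochainComplex HomComplex MonoidalClosed

variable {C : Type u} [Category.{v} C] [Preadditive C] [MonoidalCategory C] [MonoidalClosed C]
  [MonoidalPreadditive C]

lemma curry_add' {A Y X : C} (f g : A ⊗ Y ⟶ X) : curry (f + g) = curry f + curry g := by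
  simp [curry_eq]

lemma curry_units_smul {A Y X : C} (n : ℤˣ) (f : A ⊗ Y ⟶ X) : curry (n • f) = n • curry f := by
  simp [curry_eq, Functor.map_units_smul]

variable [HasProducts.{0} C]

/-- The projection of `Hom^n(K, L)` to the factor of index `(p, q)`. -/
def homComplexProj (K L : CochainComplex C ℤ) (n p q : ℤ) (h : p + n = q) :
    (homComplex K L).X n ⟶ (ihom (K.X p)).obj (L.X q) := homProj K L n p q h

lemma homComplex_hom_ext {K L : CochainComplex C ℤ} {n : ℤ} {X : C}
    {f g : X ⟶ (homComplex K L).X n}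
    (h : ∀ p q hpq, f ≫ homComplexProj K L n p q hpq = g ≫ homComplexProj K L n p q hpq) : f = g :=
  Pi.hom_ext _ _ fun ⟨⟨p, q⟩, hpq⟩ => h p q hpq

/-- Constructor for morphisms to `Hom^n(K, L)`. -/
def homComplexLift {K L : CochainComplex C ℤ} {n : ℤ} {X : C}
    (f : ∀ p q, p + n = q → (X ⟶ (ihom (K.X p)).obj (L.X q))) : X ⟶ (homComplex K L).X n :=
  Pi.lift fun i => f i.1.1 i.1.2 i.2

@[simp]
lemma homComplexLift_proj {K L : CochainComplex C ℤ} {n : ℤ} {X : C}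
    (f : ∀ p q, p + n = q → (X ⟶ (ihom (K.X p)).obj (L.X q))) (p q : ℤ) (h : p + n = q) :
    homComplexLift f ≫ homComplexProj K L n p q h = f p q h :=
  Pi.lift_π _ _

lemma homComplex_d_proj (K L : CochainComplex C ℤ) (n m p q q' p' : ℤ) (hm : n + 1 = m) (h : p + m = q)
    (hq : q' + 1 = q) (hp : p + 1 = p') :
    (homComplex K L).d n m ≫ homComplexProj K L m p q h =
      homComplexProj K L n p q' (by lia) ≫ (ihom (K.X p)).map (L.d q' q) +
        m.negOnePow • (homComplexProj K L n p' q (by lia) ≫ (pre (K.d p p')).app (L.X q)) := by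
  obtain rfl : q' = q - 1 := by lia
  subst hp
  exact homD_homProj K L n m hm p q h

variable [∀ K L : CochainComplex C ℤ, HasTensor K L]

omit [MonoidalClosed C] [HasProducts.{0} C] in
lemma ιTensorObj_d (F P : CochainComplex C ℤ) (p a m m' : ℤ) (h : p + a = m) (h' : m + 1 = m') :
    ιTensorObj F P p a m h ≫ (tensorObj F P).d m m' =
      F.d p (p + 1) ▷ P.X a ≫ ιTensorObj F P (p + 1) a m' (by lia) +
        p.negOnePow • (F.X p ◁ P.d a (a + 1) ≫ ιTensorObj F P p (a + 1) m' (by lia)) := by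
  rw [mapBifunctor.d_eq, Preadditive.comp_add, mapBifunctor.ι_D₁, mapBifunctor.ι_D₂,
    mapBifunctor.d₁_eq _ _ _ _ (show (ComplexShape.up ℤ).Rel p (p + 1) by simp) _ _ (by dsimp; lia),
    mapBifunctor.d₂_eq _ _ _ _ _ (show (ComplexShape.up ℤ).Rel a (a + 1) by simp) _ (by dsimp; lia)]
  simp

variable [BraidedCategory C]

/-- The bijection between cochains `F ⊗ P ⟶ I` and cochains `F ⟶ Hom^•(P, I)`. -/
def curryCochain {F P I : CochainComplex C ℤ} {n : ℤ} (z : Cochain (tensorObj F P) I n) :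
    Cochain F (homComplex P I) n :=
  Cochain.mk fun p _ _ => homComplexLift fun a b _ =>
    -- The braiding is needed because `ihom` is adjoint to tensoring on the left, whereas `P` stands
    -- on the right.
    curry ((β_ _ _).inv ≫ ιTensorObj F P p a (p + a) rfl ≫ z.v (p + a) b (by lia))

lemma curryCochain_v {F P I : CochainComplex C ℤ} {n : ℤ} (z : Cochain (tensorObj F P) I n)
    (p q a b m : ℤ) (hpq : p + n = q) (hab : a + q = b) (hm : p + a = m) :
    (curryCochain z).v p q hpq ≫ homComplexProj P I q a b hab =
      curry ((β_ _ _).inv ≫ ιTensorObj F P p a m hm ≫ z.v m b (by lia)) := by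
  subst hm
  simp [curryCochain]

lemma curryCochain_injective {F P I : CochainComplex C ℤ} {n : ℤ} :
    Function.Injective (curryCochain (F := F) (P := P) (I := I) (n := n)) := fun z z' h => by
  ext m b hmb p a hpa
  have hpa' : p + a = m := hpa
  have h0 : a + (p + n) = b := by lia
  have := (curryCochain_v z p _ a b m rfl h0 hpa').symm.trans (Eq.trans (by rw [h])
    (curryCochain_v z' p _ a b m rfl h0 hpa'))
  exact (cancel_epi _).1 (curry_injective this)

lemma curryCochain_surjective {F P I : CochainComplex C ℤ} {n : ℤ} :
    Function.Surjective (curryCochain (F := F) (P := P) (I := I) (n := n)) := fun w => by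
  refine ⟨Cochain.mk fun m b h => mapBifunctorDesc fun p a hpa => (β_ (F.X p) (P.X a)).hom ≫
    uncurry (w.v p (p + n) rfl ≫ homComplexProj P I (p + n) a b (by
      have : p + a = m := hpa
      lia)), ?_⟩
  ext p q hpq
  refine homComplex_hom_ext fun a b hab => ?_
  subst hpq
  rw [curryCochain_v _ _ _ _ _ _ rfl hab rfl, Cochain.mk_v, ι_mapBifunctorDesc]
  simp

/-- No sign enters `curryCochain`: the differential of `P` carries (-1)^m (-1)^p on the tensor side
and (-1)^q on the Hom side, and q = p + m. -/
lemma δ_curryCochain {F P I : CochainComplex C ℤ} {n : ℤ} (z : Cochain (tensorObj F P) I n)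
    (m : ℤ) (hm : n + 1 = m) : δ n m (curryCochain z) = curryCochain (δ n m z) := by
  ext p q hpq
  refine homComplex_hom_ext fun a b hab => ?_
  have h1 : p + n = q - 1 := by lia
  have h2 := ιTensorObj_d F P p a (p + a) (p + a + 1) rfl rfl
  rw [curryCochain_v _ _ _ _ _ _ hpq hab rfl,
    δ_v n m hm _ p q hpq (q - 1) (p + 1) (by lia) rfl,
    δ_v n m hm _ (p + a) b (by lia) (b - 1) (p + a + 1) (by lia) rfl,
    Preadditive.add_comp, Category.assoc, homComplex_d_proj _ _ _ _ _ _ (b - 1) (a + 1) (by lia)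
      hab (by lia) rfl,
    Preadditive.comp_add, Linear.comp_units_smul, Linear.units_smul_comp, Category.assoc,
    curryCochain_v z _ _ _ _ (p + a + 1) (by lia) hab (by lia),
    ← Category.assoc, ← Category.assoc,
    curryCochain_v z p (q - 1) a (b - 1) (p + a) h1 _ rfl,
    curryCochain_v z p (q - 1) (a + 1) b (p + a + 1) h1 _ (by lia),
    ← curry_natural_right, curry_pre_app, ← curry_natural_left]
  simp only [Preadditive.comp_add, Linear.comp_units_smul, curry_add', curry_units_smul]
  rw [reassoc_of% h2]
  simp only [Preadditive.comp_add, Preadditive.add_comp, Linear.comp_units_smul,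
    Linear.units_smul_comp, curry_add', curry_units_smul, Category.assoc,
    BraidedCategory.braiding_inv_naturality_left_assoc,
    BraidedCategory.braiding_inv_naturality_right_assoc]
  have h3 : q.negOnePow = (m + p).negOnePow := by rw [show q = m + p by lia]
  rw [smul_add, smul_smul, ← Int.negOnePow_add, h3]
  abel

lemma curryCochain_add {F P I : CochainComplex C ℤ} {n : ℤ} (z z' : Cochain (tensorObj F P) I n) :
    curryCochain (z + z') = curryCochain z + curryCochain z' := by
  ext p q hpq
  refine homComplex_hom_ext fun a b hab => ?_
  simp [curryCochain_v _ _ _ _ _ _ hpq hab rfl, curry_add']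

/-- Tensor-Hom adjunction for morphisms of complexes. -/
def curryHom {F P I : CochainComplex C ℤ} (k : tensorObj F P ⟶ I) : F ⟶ homComplex P I :=
  Cocycle.homOf (Cocycle.mk (curryCochain (Cochain.ofHom k)) 1 (by lia) (by
    rw [δ_curryCochain _ _ (by lia), δ_ofHom]
    simpa using curryCochain_add (0 : Cochain (tensorObj F P) I 1) 0))

lemma ofHom_curryHom {F P I : CochainComplex C ℤ} (k : tensorObj F P ⟶ I) :
    Cochain.ofHom (curryHom k) = curryCochain (Cochain.ofHom k) := by
  simp [curryHom]

lemma curryHom_f {F P I : CochainComplex C ℤ} (k : tensorObj F P ⟶ I) (p a b : ℤ) (hab : a + p = b) :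
    (curryHom k).f p ≫ homComplexProj P I p a b hab =
      curry ((β_ _ _).inv ≫ ιTensorObj F P p a b (by lia) ≫ k.f b) := by
  have := curryCochain_v (Cochain.ofHom k) p p a b b (by lia) hab (by lia)
  rw [← ofHom_curryHom] at this
  simpa using this

lemma curryHom_bijective {F P I : CochainComplex C ℤ} :
    Function.Bijective (curryHom (F := F) (P := P) (I := I)) := by
  constructor
  · intro k k' h
    have := congr_arg Cochain.ofHom h
    rw [ofHom_curryHom, ofHom_curryHom] at this
    exact Cochain.ofHom_injective (curryCochain_injective this)
  · intro g
    obtain ⟨z, hz⟩ := curryCochain_surjective (Cochain.ofHom g)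
    have hδ : δ 0 1 z = 0 := by
      apply curryCochain_injective
      rw [← δ_curryCochain _ _ (by lia), hz, δ_ofHom]
      exact Eq.symm <| by simpa using curryCochain_add (0 : Cochain (tensorObj F P) I 1) 0
    refine ⟨Cocycle.homOf (Cocycle.mk z 1 (by lia) hδ), Cochain.ofHom_injective ?_⟩
    rw [ofHom_curryHom, ← hz]
    congr 1
    simp

/-- Homotopies are cochains of degree -1, where currying is again bijective and compatible with
differentials; the adjunction thus passes to homotopy classes. -/
lemma nonempty_homotopy_curryHom_iff {F P I : CochainComplex C ℤ} (k k' : tensorObj F P ⟶ I) :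
    Nonempty (Homotopy (curryHom k) (curryHom k')) ↔ Nonempty (Homotopy k k') := by
  rw [(Cochain.equivHomotopy _ _).nonempty_congr, (Cochain.equivHomotopy _ _).nonempty_congr]
  constructor
  · rintro ⟨w, hw⟩
    obtain ⟨z, rfl⟩ := curryCochain_surjective w
    refine ⟨z, curryCochain_injective ?_⟩
    rw [curryCochain_add, ← ofHom_curryHom, ← ofHom_curryHom, hw, δ_curryCochain _ _ (by lia)]
  · rintro ⟨z, hz⟩
    exact ⟨curryCochain z, by
      rw [ofHom_curryHom, ofHom_curryHom, hz, δ_curryCochain _ _ (by lia), curryCochain_add]⟩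

/-- The functor `- ⊗ P` on complexes. -/
abbrev tensorRightComplex (P : CochainComplex C ℤ) : CochainComplex C ℤ ⥤ CochainComplex C ℤ :=
  (curriedTensor C).map₂CochainComplex.flip.obj P

omit [MonoidalClosed C] [HasProducts.{0} C] [BraidedCategory C] in
lemma ι_tensorHom {F G P Q : CochainComplex C ℤ} (f : F ⟶ G) (g : P ⟶ Q) (p a m : ℤ) (h : p + a = m) :
    ιTensorObj F P p a m h ≫ (HomologicalComplex.tensorHom f g).f m =
      f.f p ▷ P.X a ≫ G.X p ◁ g.f a ≫ ιTensorObj G Q p a m h :=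
  ι_mapBifunctorMap f g (curriedTensor C) (.up ℤ) p a m h

omit [MonoidalClosed C] [HasProducts.{0} C] [BraidedCategory C] in
lemma ι_tensorHom_assoc {F G P Q : CochainComplex C ℤ} (f : F ⟶ G) (g : P ⟶ Q) (p a m : ℤ)
    (h : p + a = m) {Z : C} (k : (tensorObj G Q).X m ⟶ Z) :
    ιTensorObj F P p a m h ≫ (HomologicalComplex.tensorHom f g).f m ≫ k =
      f.f p ▷ P.X a ≫ G.X p ◁ g.f a ≫ ιTensorObj G Q p a m h ≫ k := by
  rw [← Category.assoc, ι_tensorHom, Category.assoc, Category.assoc]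

lemma curryHom_naturality {F G P I : CochainComplex C ℤ} (f : F ⟶ G) (k : tensorObj G P ⟶ I) :
    curryHom (HomologicalComplex.tensorHom f (𝟙 P) ≫ k) = f ≫ curryHom k := by
  ext p : 1
  refine homComplex_hom_ext fun a b hab => ?_
  rw [curryHom_f, HomologicalComplex.comp_f, HomologicalComplex.comp_f, Category.assoc, curryHom_f,
    ← curry_natural_left, ι_tensorHom_assoc]
  simp

/-- The functor `Hom^•(P, -)`, right adjoint to `- ⊗ P`. -/
def homComplexFunctor (P : CochainComplex C ℤ) : CochainComplex C ℤ ⥤ CochainComplex C ℤ :=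
  Adjunction.rightAdjointOfEquiv (F := tensorRightComplex P) (G_obj := homComplex P)
    (fun F I => Equiv.ofBijective (curryHom (F := F) (P := P) (I := I)) curryHom_bijective)
    (fun _ _ _ f g => curryHom_naturality f g)

/-- The adjunction between `- ⊗ P` and `Hom^•(P, -)`. -/
def tensorHomAdj (P : CochainComplex C ℤ) : tensorRightComplex P ⊣ homComplexFunctor P :=
  Adjunction.adjunctionOfEquivRight _ _

variable [HasZeroObject C] [∀ X : C, PreservesColimit (Functor.empty.{0} C) ((curriedTensor C).flip.obj X)]

/-- This links the morphism ℤ_X → RHom(D, D) to the canonical isomorphism ℤ_X ⊗ D → D. -/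
lemma curryHom_leftUnitor (L : CochainComplex C ℤ) :
    curryHom (HomologicalComplex.leftUnitor L).hom = homUnit L := by
  apply HomologicalComplex.from_single_hom_ext
  rw [← cancel_epi (singleObjXSelf (.up ℤ) 0 (𝟙_ C)).inv]
  refine homComplex_hom_ext fun a b hab => ?_
  obtain rfl : a = b := by lia
  have h1 : (singleObjXSelf (.up ℤ) 0 (𝟙_ C)).inv ▷ L.X a ≫ ιTensorObj _ L 0 a a (zero_add a) ≫
      (HomologicalComplex.leftUnitor L).hom.f a = (λ_ (L.X a)).hom := by
    rw [← cancel_epi (λ_ (L.X a)).inv, Iso.inv_hom_id]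
    have h2 := leftUnitor'_inv L a
    have h3 : (leftUnitor' L).inv a ≫ (HomologicalComplex.leftUnitor L).hom.f a = 𝟙 _ :=
      HomologicalComplex.congr_hom (HomologicalComplex.leftUnitor L).inv_hom_id a
    rw [h2] at h3
    simpa using h3
  have h4 : (homUnit L).f 0 = (singleObjXSelf (.up ℤ) 0 (𝟙_ C)).hom ≫ homComplexLift fun a b hab =>
      curry ((ρ_ (L.X a)).hom ≫ (L.XIsoOfEq (by lia)).hom) := mkHomFromSingle_f _ _
  rw [Category.assoc, Category.assoc, curryHom_f, ← curry_natural_left, h4,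
    BraidedCategory.braiding_inv_naturality_right_assoc, h1,
    Category.assoc, Iso.inv_hom_id_assoc, homComplexLift_proj]
  simp

end TensorHom

/-! ### Tensoring quasi-isomorphisms with a complex that preserves acyclicity. -/

section TensorQuasiIso

open HomologicalComplex CochainComplex HomComplex MonoidalClosed

variable {C : Type u} [Category.{v} C] [Abelian C] [MonoidalCategory C]
  [MonoidalPreadditive C] [∀ K L : CochainComplex C ℤ, HasTensor K L]

section Braiding

variable [BraidedCategory C]

/-- The braiding of the tensor product of complexes, in degree `m`. -/
def tensorBraidingX (K L : CochainComplex C ℤ) (m : ℤ) : (tensorObj K L).X m ≅ (tensorObj L K).X m where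
  hom := mapBifunctorDesc fun p a h => (p * a).negOnePow • ((β_ (K.X p) (L.X a)).hom ≫
    ιTensorObj L K a p m (by
      have : p + a = m := h
      lia))
  inv := mapBifunctorDesc fun a p h => (p * a).negOnePow • ((β_ (K.X p) (L.X a)).inv ≫
    ιTensorObj K L p a m (by
      have : a + p = m := h
      lia))
  hom_inv_id := by
    ext p a h
    simp [smul_smul]
  inv_hom_id := by
    ext p a h
    simp [smul_smul]

lemma ι_tensorBraidingX_hom (K L : CochainComplex C ℤ) (p a m : ℤ) (h : p + a = m) :
    ιTensorObj K L p a m h ≫ (tensorBraidingX K L m).hom =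
      (p * a).negOnePow • ((β_ (K.X p) (L.X a)).hom ≫ ιTensorObj L K a p m (by lia)) := by
  rw [tensorBraidingX, ι_mapBifunctorDesc]

/-- The braiding of the tensor product of complexes. -/
def tensorBraiding (K L : CochainComplex C ℤ) : tensorObj K L ≅ tensorObj L K :=
  Hom.isoOfComponents (tensorBraidingX K L) (by
    intro m m' hm
    ext p a h
    have h1 := ιTensorObj_d K L p a m m' h hm
    have h2 := ιTensorObj_d L K a p m m' (by rw [add_comm]; exact h) hm
    have h' : p + a = m := h
    have h'' : m + 1 = m' := hm
    have h3 := ι_tensorBraidingX_hom K L p a m h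
    have h4 := ι_tensorBraidingX_hom K L (p + 1) a m' (by lia)
    have h5 := ι_tensorBraidingX_hom K L p (a + 1) m' (by lia)
    rw [reassoc_of% h1, reassoc_of% h3, Linear.units_smul_comp, Category.assoc, h2]
    simp only [Preadditive.comp_add, Preadditive.add_comp, Linear.comp_units_smul,
      Linear.units_smul_comp, Category.assoc, h4, h5, smul_add, smul_smul,
      BraidedCategory.braiding_naturality_left_assoc, BraidedCategory.braiding_naturality_right_assoc,
      ← Int.negOnePow_add]
    have hs : (p + p * (a + 1)).negOnePow = (p * a).negOnePow :=
      (Int.negOnePow_eq_iff _ _).2 ⟨p, by ring⟩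
    rw [hs, add_comm, show p * a + a = (p + 1) * a by ring])

lemma ι_tensorBraiding_hom (K L : CochainComplex C ℤ) (p a m : ℤ) (h : p + a = m) :
    ιTensorObj K L p a m h ≫ (tensorBraiding K L).hom.f m =
      (p * a).negOnePow • ((β_ (K.X p) (L.X a)).hom ≫ ιTensorObj L K a p m (by lia)) :=
  ι_tensorBraidingX_hom K L p a m h

lemma tensorBraiding_naturality {K K' L L' : CochainComplex C ℤ} (f : K ⟶ K') (g : L ⟶ L') :
    HomologicalComplex.tensorHom f g ≫ (tensorBraiding K' L').hom =
      (tensorBraiding K L).hom ≫ HomologicalComplex.tensorHom g f := by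
  ext m p a h
  have h' : a + p = m := by rw [add_comm]; exact h
  have h1 := ι_tensorHom f g p a m h
  have h2 := ι_tensorHom g f a p m h'
  have h3 := ι_tensorBraiding_hom K L p a m h
  have h4 := ι_tensorBraiding_hom K' L' p a m h
  dsimp only [HomologicalComplex.comp_f]
  rw [reassoc_of% h1, reassoc_of% h3, h4, Linear.units_smul_comp, Category.assoc, h2]
  simp [whisker_exchange_assoc]

lemma acyclic_tensorObj_comm {K L : CochainComplex C ℤ} (h : (tensorObj K L).Acyclic) :
    (tensorObj L K).Acyclic := fun n => (h n).of_iso (tensorBraiding K L)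

end Braiding

/-- A degreewise split monomorphism stays a monomorphism after tensoring. -/
lemma mono_tensorHom {K L : CochainComplex C ℤ} (f : K ⟶ L) (r : ∀ n, L.X n ⟶ K.X n)
    (hr : ∀ n, f.f n ≫ r n = 𝟙 _) (P : CochainComplex C ℤ) :
    Mono (HomologicalComplex.tensorHom f (𝟙 P)) := by
  have (m : ℤ) : Mono ((HomologicalComplex.tensorHom f (𝟙 P)).f m) := by
    let ρ : (tensorObj L P).X m ⟶ (tensorObj K P).X m :=
      mapBifunctorDesc fun p a h => r p ▷ P.X a ≫ ιTensorObj K P p a m h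
    suffices (HomologicalComplex.tensorHom f (𝟙 P)).f m ≫ ρ = 𝟙 _ from mono_of_mono_fac this
    ext p a h
    have h1 := ι_tensorHom f (𝟙 P) p a m h
    have h2 : ιTensorObj L P p a m h ≫ ρ = r p ▷ P.X a ≫ ιTensorObj K P p a m h :=
      ι_mapBifunctorDesc _ _ _ _
    rw [reassoc_of% h1]
    simp only [id_f, MonoidalCategory.whiskerLeft_id, Category.id_comp, h2, Category.comp_id]
    rw [← comp_whiskerRight_assoc, hr, MonoidalCategory.id_whiskerRight, Category.id_comp]
  exact HomologicalComplex.mono_of_mono_f _ this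

variable [MonoidalClosed C] [BraidedCategory C] [HasProducts.{0} C]

instance (P : CochainComplex C ℤ) : (tensorRightComplex P).IsLeftAdjoint :=
  (tensorHomAdj P).isLeftAdjoint

instance (P : CochainComplex C ℤ) : (tensorRightComplex P).PreservesZeroMorphisms where
  map_zero K L := by
    change HomologicalComplex.tensorHom 0 (𝟙 P) = 0
    ext m p a h
    have := ι_tensorHom (0 : K ⟶ L) (𝟙 P) p a m h
    rw [this]
    simp

/-- A complex `P` such that `A ⊗ P` is acyclic for all acyclic complexes `A`. -/
def PreservesAcyclic (P : CochainComplex C ℤ) : Prop :=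
  ∀ ⦃A : CochainComplex C ℤ⦄, A.Acyclic → (tensorObj A P).Acyclic

/-- Since `- ⊗ P` is a left adjoint, the cokernel of `f ⊗ P` is `cokernel f ⊗ P`, which is acyclic;
splitness keeps `f ⊗ P` a monomorphism. -/
lemma quasiIso_tensorHom_of_split {P : CochainComplex C ℤ} (hP : PreservesAcyclic P)
    {K L : CochainComplex C ℤ} (f : K ⟶ L) [hf : QuasiIso f] (r : ∀ n, L.X n ⟶ K.X n)
    (hr : ∀ n, f.f n ≫ r n = 𝟙 _) : QuasiIso (HomologicalComplex.tensorHom f (𝟙 P)) := by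
  have := mono_tensorHom f r hr P
  have : Mono f := by
    have (n : ℤ) : Mono (f.f n) := mono_of_mono_fac (hr n)
    exact HomologicalComplex.mono_of_mono_f _ this
  have hS : (ShortComplex.mk f (cokernel.π f) (by simp)).ShortExact :=
    { exact := ShortComplex.exact_cokernel f }
  have hM : (cokernel f).Acyclic := hS.acyclic_X₃ hf
  exact quasiIso_of_acyclic_cokernel _
    fun n => (hP hM n).of_iso (PreservesCokernel.iso (tensorRightComplex P) f)

/-- Adding `cone (𝟙 K)` to the target makes `f` degreewise split. The projection back to `L` is
handled through its section, which is degreewise split as well. -/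
lemma quasiIso_tensorHom {P : CochainComplex C ℤ} (hP : PreservesAcyclic P)
    {K L : CochainComplex C ℤ} (f : K ⟶ L) [hf : QuasiIso f] :
    QuasiIso (HomologicalComplex.tensorHom f (𝟙 P)) := by
  let j : L ⟶ L ⊞ mappingCone (𝟙 K) := biprod.inl
  let q : L ⊞ mappingCone (𝟙 K) ⟶ L := biprod.fst
  let f' : K ⟶ L ⊞ mappingCone (𝟙 K) := biprod.lift f (mappingCone.inr (𝟙 K))
  have hjq : j ≫ q = 𝟙 L := biprod.inl_fst
  have hf'q : f' ≫ q = f := biprod.lift_fst _ _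
  have : QuasiIso j := quasiIso_of_acyclic_cokernel _
    fun n => (acyclic_mappingCone_id K n).of_iso cokernelBiprodInlIso.symm
  have hj := quasiIso_tensorHom_of_split hP j (fun n => q.f n)
    (fun n => HomologicalComplex.congr_hom hjq n)
  have : QuasiIso (j ≫ q) := by rw [hjq]; infer_instance
  have : QuasiIso q := quasiIso_of_comp_left j q
  have : QuasiIso (f' ≫ q) := by rwa [hf'q]
  have : QuasiIso f' := quasiIso_of_comp_right f' q
  have h1 := quasiIso_tensorHom_of_split hP f'
    (fun n => (biprod.snd : L ⊞ mappingCone (𝟙 K) ⟶ _).f n ≫ (mappingCone.snd (𝟙 K)).v n n (add_zero n))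
    (fun n => by
      rw [← Category.assoc, ← HomologicalComplex.comp_f, biprod.lift_snd, mappingCone.inr_f_snd_v])
  have h2 : QuasiIso ((tensorRightComplex P).map q) := by
    have : QuasiIso ((tensorRightComplex P).map j) := hj
    have : QuasiIso ((tensorRightComplex P).map j ≫ (tensorRightComplex P).map q) := by
      rw [← Functor.map_comp, hjq, CategoryTheory.Functor.map_id]
      infer_instance
    exact quasiIso_of_comp_left ((tensorRightComplex P).map j) _
  change QuasiIso ((tensorRightComplex P).map f)
  rw [← hf'q, Functor.map_comp]
  have : QuasiIso ((tensorRightComplex P).map f') := h1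
  infer_instance

end TensorQuasiIso

/-! ### Vanishing of morphisms to the cone. -/

section Triangulated

open Pretriangulated

/-- If a morphism in a distinguished triangle induces bijections on morphisms from all the shifts
of an object, then there are no nonzero morphisms from these shifts to the third object. -/
lemma eq_zero_of_distinguished {T : Type*} [Category* T] [HasZeroObject T] [HasShift T ℤ]
    [Preadditive T] [∀ n : ℤ, (shiftFunctor T n).Additive] [Pretriangulated T] {t : Triangle T}
    (ht : t ∈ distTriang T) {S : ℤ → T} (e : ∀ n, (S (n + 1))⟦(1 : ℤ)⟧ ≅ S n)
    (hsurj : ∀ n (y : S n ⟶ t.obj₂), ∃ x, x ≫ t.mor₁ = y)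
    (hinj : ∀ n (x : S n ⟶ t.obj₁), x ≫ t.mor₁ = 0 → x = 0) (n : ℤ) (z : S n ⟶ t.obj₃) : z = 0 := by
  have h : z ≫ t.mor₃ = 0 := by
    obtain ⟨x, hx⟩ := (shiftFunctor T (1 : ℤ)).map_surjective ((e n).hom ≫ z ≫ t.mor₃)
    have : x = 0 := hinj _ _ ((shiftFunctor T (1 : ℤ)).map_injective (by
      rw [Functor.map_comp, hx, Functor.map_zero, Category.assoc, Category.assoc,
        comp_distTriang_mor_zero₃₁ _ ht, comp_zero, comp_zero]))
    rw [← cancel_epi (e n).hom, ← hx, this, Functor.map_zero, comp_zero]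
  obtain ⟨y, rfl⟩ := Triangle.coyoneda_exact₃ t ht z h
  obtain ⟨x, rfl⟩ := hsurj n y
  rw [Category.assoc, comp_distTriang_mor_zero₁₂ _ ht, comp_zero]

end Triangulated

/-! ### Complexes concentrated in one degree as test objects. -/

section Spheres

open HomologicalComplex CochainComplex HomComplex MonoidalClosed

variable {C : Type u} [Category.{v} C] [Abelian C]

/-- A family of objects which detects the vanishing of morphisms. -/
def IsSeparatingFamily {ι : Type*} (Z : ι → C) : Prop :=
  ∀ ⦃A W : C⦄ (h : A ⟶ W), (∀ i (x : Z i ⟶ A), x ≫ h = 0) → h = 0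

/-- The complex with the object `Z` in degree `n`. -/
abbrev sphere (Z : C) (n : ℤ) : CochainComplex C ℤ :=
  (HomologicalComplex.single C (ComplexShape.up ℤ) n).obj Z

/-- The shift of a complex concentrated in one degree. -/
def sphereShiftIso (Z : C) (n : ℤ) : (sphere Z (n + 1))⟦(1 : ℤ)⟧ ≅ sphere Z n :=
  ((CochainComplex.singleFunctors C).shiftIso 1 n (n + 1) (by lia)).app Z

variable {ι : Type*} {Z : ι → C}

/-- A morphism from a sphere is a generalized cocycle, and a null-homotopy exhibits it as a
coboundary. -/
lemma acyclic_of_sphere (hZ : IsSeparatingFamily Z) (K : CochainComplex C ℤ)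
    (hK : ∀ i n (f : sphere (Z i) n ⟶ K), Nonempty (Homotopy f 0)) : K.Acyclic := by
  refine acyclic_of_exact _ fun i j k hij hjk => ?_
  rw [ShortComplex.exact_iff_kernel_ι_comp_cokernel_π_zero]
  refine hZ _ fun a x => ?_
  let f : sphere (Z a) j ⟶ K := mkHomFromSingle (x ≫ kernel.ι (K.d j k)) (fun k' hk' => by
    obtain rfl : k = k' := hjk.symm.trans hk'
    simp)
  obtain ⟨h⟩ := hK a j f
  have h1 := h.comm j
  have h2 : f.f j = (singleObjXSelf _ j (Z a)).hom ≫ x ≫ kernel.ι (K.d j k) := mkHomFromSingle_f _ _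
  have h3 : (sphere (Z a) j).d j k = 0 := rfl
  rw [dNext_eq _ (show (ComplexShape.up ℤ).Rel j k from hjk),
    prevD_eq _ (show (ComplexShape.up ℤ).Rel i j from hij), h3, zero_comp, zero_add, h2,
    HomologicalComplex.zero_f, add_zero] at h1
  dsimp only
  rw [← cancel_epi (singleObjXSelf (.up ℤ) j (Z a)).hom, reassoc_of% h1,
    cokernel.condition, comp_zero, comp_zero]

/-- The hypotheses are bijectivity on homotopy classes from spheres, so the triangle of `p` leaves
no nonzero class from a sphere to the cone, which is therefore acyclic. -/
lemma quasiIso_of_quotient_bijective (hZ : IsSeparatingFamily Z) {X Y : CochainComplex C ℤ} (p : X ⟶ Y)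
    (hsurj : ∀ i n (y : sphere (Z i) n ⟶ Y), ∃ x : sphere (Z i) n ⟶ X, Nonempty (Homotopy (x ≫ p) y))
    (hinj : ∀ i n (x : sphere (Z i) n ⟶ X), Nonempty (Homotopy (x ≫ p) 0) → Nonempty (Homotopy x 0)) :
    QuasiIso p := by
  let Q := HomotopyCategory.quotient C (.up ℤ)
  have hT := HomotopyCategory.mappingCone_triangleh_distinguished p
  have hcone : (mappingCone p).Acyclic := acyclic_of_sphere hZ _ fun i n f => by
    refine ⟨HomotopyCategory.homotopyOfEq _ _ ?_⟩
    rw [Functor.map_zero]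
    refine eq_zero_of_distinguished hT (S := fun n => Q.obj (sphere (Z i) n))
      (fun n => (Q.commShiftIso (1 : ℤ)).symm.app _ ≪≫ Q.mapIso (sphereShiftIso (Z i) n)) ?_ ?_ n (Q.map f)
    · intro n y
      obtain ⟨y, rfl⟩ := Q.map_surjective y
      obtain ⟨x, ⟨hx⟩⟩ := hsurj i n y
      exact ⟨Q.map x, (Q.map_comp x p).symm.trans (HomotopyCategory.eq_of_homotopy _ _ hx)⟩
    · intro n x hx
      obtain ⟨x, rfl⟩ := Q.map_surjective x
      have hx' : Q.map (x ≫ p) = Q.map 0 := (Q.map_comp x p).trans (hx.trans (Q.map_zero _ _).symm)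
      obtain ⟨h⟩ := hinj i n x ⟨HomotopyCategory.homotopyOfEq _ _ hx'⟩
      exact (HomotopyCategory.eq_of_homotopy _ _ h).trans (Q.map_zero _ _)
  have := ObjectProperty.trW.mk (HomotopyCategory.subcategoryAcyclic C) hT
    ((HomotopyCategory.quotient_obj_mem_subcategoryAcyclic_iff_acyclic _).2 hcone)
  rw [← HomotopyCategory.quasiIso_eq_trW_subcategoryAcyclic] at this
  exact (HomotopyCategory.quotient_map_mem_quasiIso_iff p).1 this

lemma acyclic_of_injective_homotopy [EnoughInjectives C] (K : CochainComplex C ℤ)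
    (hK : ∀ (E : C) [Injective E] (n : ℤ) (f : K ⟶ sphere E n), Nonempty (Homotopy f 0)) :
    K.Acyclic := by
  refine acyclic_of_injective_test _ fun E _ i j k hij hjk φ hφ => ?_
  let f : K ⟶ sphere E j := mkHomToSingle φ (fun i' hi' => by
    obtain rfl : i = i' := by
      have : i' + 1 = j := hi'
      lia
    exact hφ)
  obtain ⟨h⟩ := hK E j f
  have h1 := h.comm j
  have h2 : f.f j = φ ≫ (singleObjXSelf _ j E).inv := mkHomToSingle_f _ _
  have h3 : (sphere E j).d i j = 0 := rfl
  rw [dNext_eq _ (show (ComplexShape.up ℤ).Rel j k from hjk),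
    prevD_eq _ (show (ComplexShape.up ℤ).Rel i j from hij), h3, comp_zero, add_zero, h2,
    HomologicalComplex.zero_f, add_zero] at h1
  refine ⟨h.hom k j ≫ (singleObjXSelf _ j E).hom, ?_⟩
  rw [← Category.assoc, ← h1, Category.assoc, Iso.inv_hom_id, Category.comp_id]

variable [MonoidalCategory C] [MonoidalPreadditive C] [MonoidalClosed C] [HasProducts.{0} C]

/-- An object `Z` such that the internal Hom from `Z` preserves injective objects. -/
def PreservesInjectives (Z : C) : Prop := ∀ E : C, Injective E → Injective ((ihom Z).obj E)

/-- The isomorphism of internal Homs induced by an isomorphism of the first argument. -/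
def ihomIso {Z Z' : C} (e : Z ≅ Z') (E : C) : (ihom Z).obj E ≅ (ihom Z').obj E where
  hom := (pre e.inv).app E
  inv := (pre e.hom).app E
  hom_inv_id := by rw [← NatTrans.comp_app, ← pre_map, e.hom_inv_id, pre_id, NatTrans.id_app]
  inv_hom_id := by rw [← NatTrans.comp_app, ← pre_map, e.inv_hom_id, pre_id, NatTrans.id_app]

/-- The complex is an injective object concentrated in degree `m - n`; bounded below complexes of
injectives are K-injective. -/
lemma isKInjective_homComplex_sphere {Z : C} (hZ : PreservesInjectives Z) (n : ℤ) (E : C) [hE : Injective E]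
    (m : ℤ) : (homComplex (sphere Z n) (sphere E m)).IsKInjective := by
  have h0 (p q : ℤ) (h : ¬ (p = n ∧ q = m)) :
      IsZero ((ihom ((sphere Z n).X p)).obj ((sphere E m).X q)) := by
    rw [IsZero.iff_id_eq_zero]
    by_cases hp : p = n
    · have hq : q ≠ m := fun hq => h ⟨hp, hq⟩
      have := (isZero_single_obj_X (.up ℤ) m E q hq).eq_of_src (𝟙 _) 0
      rw [← (ihom _).map_id]
      exact (congr_arg _ this).trans (Functor.map_zero _ _ _)
    · have := (isZero_single_obj_X (.up ℤ) n Z p hp).eq_of_src (𝟙 _) 0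
      have h2 : (pre (𝟙 ((sphere Z n).X p))).app ((sphere E m).X q) = 0 :=
        (congr_arg (fun f => (pre f).app _) this).trans (pre_zero_app _ _ _)
      simpa [pre_id] using h2
  have hinj (p q : ℤ) : Injective ((ihom ((sphere Z n).X p)).obj ((sphere E m).X q)) := by
    by_cases h : p = n ∧ q = m
    · obtain ⟨rfl, rfl⟩ := h
      have h1 : Injective ((sphere E q).X q) := Injective.of_iso (singleObjXSelf (.up ℤ) q E).symm hE
      exact Injective.of_iso (ihomIso (singleObjXSelf (.up ℤ) p Z).symm _) (hZ _ h1)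
    · exact (h0 p q h).injective
  have (k : ℤ) : Injective ((homComplex (sphere Z n) (sphere E m)).X k) := ⟨fun g f _ =>
    ⟨homComplexLift fun p q h => Injective.factorThru (g ≫ homComplexProj _ _ k p q h) f,
      homComplex_hom_ext fun p q h => by simp⟩⟩
  have : (homComplex (sphere Z n) (sphere E m)).IsStrictlyGE (m - n) := by
    rw [isStrictlyGE_iff]
    intro k hk
    rw [IsZero.iff_id_eq_zero]
    exact homComplex_hom_ext fun p q h => (h0 p q (by lia)).eq_of_tgt _ _
  exact isKInjective_of_injective _ (m - n)

variable [∀ K L : CochainComplex C ℤ, HasTensor K L] [BraidedCategory C]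

lemma curryHom_zero {F P I : CochainComplex C ℤ} : curryHom (0 : tensorObj F P ⟶ I) = 0 := by
  apply Cochain.ofHom_injective
  rw [ofHom_curryHom, Cochain.ofHom_zero, Cochain.ofHom_zero]
  simpa using curryCochain_add (0 : Cochain (tensorObj F P) I 0) 0

/-- Acyclicity of `A ⊗ S` is tested by morphisms to injective spheres; by adjunction these are
morphisms from the acyclic `A` to a K-injective complex. -/
lemma preservesAcyclic_sphere [EnoughInjectives C] {Z : C} (hZ : PreservesInjectives Z) (n : ℤ) :
    PreservesAcyclic (sphere Z n) := fun A hA => acyclic_of_injective_homotopy _ fun E _ m f => by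
  have := isKInjective_homComplex_sphere hZ n E m
  rw [← nonempty_homotopy_curryHom_iff, curryHom_zero]
  exact IsKInjective.nonempty_homotopy_zero _ hA

lemma acyclic_tensorObj_mappingCone_id (K A : CochainComplex C ℤ) :
    (tensorObj (mappingCone (𝟙 K)) A).Acyclic := by
  obtain ⟨h⟩ : Nonempty (Homotopy (𝟙 (tensorObj (mappingCone (𝟙 K)) A)) 0) := by
    rw [← nonempty_homotopy_curryHom_iff, curryHom_zero]
    exact ⟨(Homotopy.ofEq (by simp)).trans (((mappingCone.homotopyToZeroOfId K).compRight
      (curryHom (𝟙 _))).trans (Homotopy.ofEq (by simp)))⟩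
  intro n
  rw [exactAt_iff_isZero_homology, IsZero.iff_id_eq_zero, ← HomologicalComplex.homologyMap_id,
    h.homologyMap_eq, HomologicalComplex.homologyMap_zero]

end Spheres

/-! ### K-flat resolutions by cell complexes. -/

section FlatResolutions

open HomologicalComplex CochainComplex HomComplex MonoidalClosed MorphismProperty ZeroObject

/-- `F g` lifts against `t` exactly when `g` lifts against `G t`, so a lifting property of the
images of the generators passes to everything they generate. -/
lemma rlp_llp_le_inverseImage {C D : Type*} [Category* C] [Category* D] {F : C ⥤ D} {G : D ⥤ C}
    (adj : F ⊣ G) {S : MorphismProperty C} {T : MorphismProperty D} (h : S ≤ T.llp.inverseImage F) :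
    S.rlp.llp ≤ T.llp.inverseImage F := by
  intro A B g hg X Y t ht
  rw [adj.hasLiftingProperty_iff]
  refine hg _ fun _ _ s hs => ?_
  rw [← adj.hasLiftingProperty_iff]
  exact h _ hs _ ht

variable {C : Type u} [Category.{v} C] [Abelian C]

lemma exists_extension_of_homotopy {K L : CochainComplex C ℤ} {f : K ⟶ L} (h : Homotopy f 0) :
    ∃ g : mappingCone (𝟙 K) ⟶ L, mappingCone.inr (𝟙 K) ≫ g = f := by
  obtain ⟨z, hz⟩ := Cochain.equivHomotopy _ _ h
  exact ⟨mappingCone.desc (𝟙 K) z f (by rw [Category.id_comp, hz]; simp), mappingCone.inr_desc _ _ _ _⟩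

variable {ι : Type v} (Z : ι → C)

/-- The morphisms `0 ⟶ S` and `S ⟶ cone (𝟙 S)` where `S` runs through the spheres of the objects
of a given family. -/
def sphereCells : MorphismProperty (CochainComplex C ℤ) :=
  .ofHoms (fun i : ι × ℤ => (0 : (0 : CochainComplex C ℤ) ⟶ sphere (Z i.1) i.2)) ⊔
    .ofHoms (fun i : ι × ℤ => mappingCone.inr (𝟙 (sphere (Z i.1) i.2)))

instance : IsSmall.{v} (sphereCells Z) := by
  rw [sphereCells, sup_eq_iSup]
  have (b : Bool) : IsSmall.{v} (cond b
      (.ofHoms (fun i : ι × ℤ => (0 : (0 : CochainComplex C ℤ) ⟶ sphere (Z i.1) i.2)))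
      (.ofHoms (fun i : ι × ℤ => mappingCone.inr (𝟙 (sphere (Z i.1) i.2))))) := by
    cases b <;> exact isSmall_ofHoms _
  infer_instance

lemma sphereCells_le_monomorphisms : sphereCells Z ≤ monomorphisms _ := by
  rw [sphereCells, sup_le_iff, ofHoms_le_iff, ofHoms_le_iff]
  exact ⟨fun i => (isZero_zero _).mono _, fun i => mono_mappingCone_inr _⟩

instance [IsGrothendieckAbelian.{v} C] : HasSmallObjectArgument.{v} (sphereCells Z) :=
  hasSmallObjectArgument_of_le_monomorphisms _ (sphereCells_le_monomorphisms Z)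

variable {Z}

/-- Lifting against `0 ⟶ S` gives surjectivity on homotopy classes from `S`, lifting against `S ⟶
cone (𝟙 S)` gives injectivity. -/
lemma quasiIso_of_sphereCells_rlp (hZ : IsSeparatingFamily Z) {X Y : CochainComplex C ℤ} (p : X ⟶ Y)
    (hp : (sphereCells Z).rlp p) : QuasiIso p := by
  refine quasiIso_of_quotient_bijective hZ p (fun i n y => ?_) fun i n x ⟨h⟩ => ?_
  · have := hp _ (Or.inl ⟨((i, n) : ι × ℤ)⟩)
    have sq : CommSq 0 (0 : (0 : CochainComplex C ℤ) ⟶ sphere (Z i) n) p y := ⟨by simp⟩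
    exact ⟨sq.lift, ⟨Homotopy.ofEq sq.fac_right⟩⟩
  · have := hp _ (Or.inr ⟨((i, n) : ι × ℤ)⟩)
    obtain ⟨g, hg⟩ := exists_extension_of_homotopy h
    have sq : CommSq x (mappingCone.inr (𝟙 (sphere (Z i) n))) p g := ⟨hg.symm⟩
    exact ⟨homotopyOfExtension sq.lift sq.fac_left⟩

variable [IsGrothendieckAbelian.{v} C] [MonoidalCategory C] [MonoidalPreadditive C] [MonoidalClosed C]
  [HasProducts.{0} C] [∀ K L : CochainComplex C ℤ, HasTensor K L] [BraidedCategory C]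

omit [IsGrothendieckAbelian.{v} C] [MonoidalClosed C] [HasProducts.{0} C] [BraidedCategory C] in
lemma acyclic_tensorObj_zero (A : CochainComplex C ℤ) :
    (HomologicalComplex.tensorObj 0 A).Acyclic :=
  acyclic_of_isZero _ (Functor.map_isZero (tensorRightComplex A) (isZero_zero _))

omit [IsGrothendieckAbelian.{v} C] [MonoidalClosed C] [HasProducts.{0} C] [BraidedCategory C] in
lemma acyclic_tensorObj_of_quasiIso {K A : CochainComplex C ℤ}
    (h : QuasiIso (HomologicalComplex.tensorHom (0 : 0 ⟶ K) (𝟙 A))) :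
    (HomologicalComplex.tensorObj K A).Acyclic := fun n =>
  (exactAt_iff_of_quasiIsoAt (HomologicalComplex.tensorHom (0 : 0 ⟶ K) (𝟙 A)) n).1
    (acyclic_tensorObj_zero A n)

lemma acyclic_sphere_tensorObj {Z : C} (hZ : PreservesInjectives Z) (n : ℤ)
    {A : CochainComplex C ℤ} (hA : A.Acyclic) :
    (HomologicalComplex.tensorObj (sphere Z n) A).Acyclic :=
  acyclic_tensorObj_comm (preservesAcyclic_sphere hZ n hA)

lemma monoQuasiIso_sphere_inr {Z : C} (hZ : PreservesInjectives Z) (n : ℤ)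
    {A : CochainComplex C ℤ} (hA : A.Acyclic) :
    monoQuasiIso C (HomologicalComplex.tensorHom (mappingCone.inr (𝟙 (sphere Z n))) (𝟙 A)) :=
  ⟨mono_tensorHom (mappingCone.inr (𝟙 (sphere Z n)))
    (fun n => (mappingCone.snd (𝟙 _)).v n n (add_zero n))
    (fun n => mappingCone.inr_f_snd_v (𝟙 _) n) A,
    quasiIso_of_acyclic _ (acyclic_sphere_tensorObj hZ n hA)
      (acyclic_tensorObj_mappingCone_id _ _)⟩

lemma monoQuasiIso_sphere_zero {Z : C} (hZ : PreservesInjectives Z) (n : ℤ)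
    {A : CochainComplex C ℤ} (hA : A.Acyclic) :
    monoQuasiIso C (HomologicalComplex.tensorHom (0 : 0 ⟶ sphere Z n) (𝟙 A)) :=
  ⟨(Functor.map_isZero (tensorRightComplex A) (isZero_zero _)).mono _,
    quasiIso_of_acyclic _ (acyclic_tensorObj_zero A) (acyclic_sphere_tensorObj hZ n hA)⟩

lemma sphereCells_le_inverseImage (hZ : ∀ i, PreservesInjectives (Z i)) {A : CochainComplex C ℤ}
    (hA : A.Acyclic) : sphereCells Z ≤ (monoQuasiIso C).inverseImage (tensorRightComplex A) := by
  rw [sphereCells, sup_le_iff, ofHoms_le_iff, ofHoms_le_iff]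
  exact ⟨fun i => monoQuasiIso_sphere_zero (hZ i.1) i.2 hA,
    fun i => monoQuasiIso_sphere_inr (hZ i.1) i.2 hA⟩

/-- Every complex is quasi-isomorphic to a complex with which the tensor product preserves
acyclic complexes. -/
theorem exists_preservesAcyclic_quasiIso (hZ : IsSeparatingFamily Z)
    (hZ' : ∀ i, PreservesInjectives (Z i)) (K : CochainComplex C ℤ) :
    ∃ (P : CochainComplex C ℤ) (p : P ⟶ K), PreservesAcyclic P ∧ QuasiIso p := by
  let d := MorphismProperty.factorizationData (sphereCells Z).rlp.llp (sphereCells Z).rlp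
    (0 : 0 ⟶ K)
  refine ⟨d.Z, d.p, fun A hA => acyclic_tensorObj_comm ?_, quasiIso_of_sphereCells_rlp hZ _ d.hp⟩
  -- For each acyclic `A`, the cells tensored with `A` are monomorphic quasi-isomorphisms, a class
  -- defined by left lifting; hence so is `0 ⊗ A ⟶ P ⊗ A`.
  have h := sphereCells_le_inverseImage hZ' hA
  rw [← llp_monoQuasiIsoTest] at h
  have h' := rlp_llp_le_inverseImage (tensorHomAdj A) h _ d.hi
  rw [llp_monoQuasiIsoTest] at h'
  refine acyclic_tensorObj_of_quasiIso ?_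
  rw [← (isZero_zero _).eq_of_src d.i 0]
  exact h'.2

end FlatResolutions

lemma monoidal_whiskerLeft_map {C D : Type*} [Category* C] [Category* D] [MonoidalCategory C]
    [MonoidalCategory D] (F : C ⥤ D) [F.Monoidal] (Y : C) {A B : C} (f : A ⟶ B) :
    F.obj Y ◁ F.map f =
      Functor.LaxMonoidal.μ F _ _ ≫ F.map (Y ◁ f) ≫ Functor.OplaxMonoidal.δ F _ _ := by
  rw [Functor.Monoidal.map_whiskerLeft, Category.assoc, Category.assoc, Functor.Monoidal.μ_δ,
    Functor.Monoidal.μ_δ_assoc, Category.comp_id]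

/-! ### The sheaves ℤ_U separate morphisms and are flat. -/

section ExtZ

open Opposite

variable {X : TopCat.{u}}

/-- The morphism `ℤ_U ⟶ A` given by a section of `A` on `U`. -/
def extZDesc {U : Opens X} (A : Shv X) (a : A.obj.obj (op U)) : extZ U ⟶ A :=
  ((sheafificationAdjunction (Opens.grothendieckTopology X) ModZ.{u}).homEquiv
      (yoneda.obj U ⋙ ModuleCat.free (ULift.{u} ℤ)) A).symm
    { app V := ModuleCat.freeDesc (↾fun f : V.unop ⟶ U => A.obj.map f.op a)
      naturality V W g := by
        apply ModuleCat.free_hom_ext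
        intro x
        simp }

lemma app_eq_zero_of_extZDesc_comp {U : Opens X} {A W : Shv X} (h : A ⟶ W)
    (a : A.obj.obj (op U)) (ha : extZDesc A a ≫ h = 0) : h.hom.app (op U) a = 0 := by
  replace ha := ((sheafificationAdjunction _ _).homEquiv_naturality_right_symm _ h).trans ha
  replace ha := (Equiv.symm_apply_eq _).1 ha
  have h1 : ((sheafificationAdjunction (Opens.grothendieckTopology X) ModZ.{u}).homEquiv
      (yoneda.obj U ⋙ ModuleCat.free (ULift.{u} ℤ)) W) 0 = 0 := by
    rw [Adjunction.homEquiv_unit]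
    simp
  replace ha := ha.trans h1
  have h2 := congr($(NatTrans.congr_app ha (op U)) (ModuleCat.freeMk (𝟙 U)))
  simpa using h2

/-- Morphisms out of ℤ_U detect sections over `U`, and a morphism of sheaves that vanishes on
sections over a basis vanishes. -/
lemma isSeparatingFamily_extZ {B : Set (Opens X)} (hB : Opens.IsBasis B) :
    IsSeparatingFamily (fun U : B => extZ (U : Opens X)) := by
  intro A W h H
  have hU (U : Opens X) (hU : U ∈ B) : h.hom.app (op U) = 0 := by
    ext a
    exact app_eq_zero_of_extZDesc_comp h a (H ⟨U, hU⟩ _)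
  apply Sheaf.hom_ext
  ext V : 2
  induction V using Opposite.rec with | op V
  let S : Sieve V :=
    { arrows U' _ := ∃ U ∈ B, U' ≤ U ∧ U ≤ V
      downward_closed := fun ⟨U, hU, h1, h2⟩ g => ⟨U, hU, (leOfHom g).trans h1, h2⟩ }
  have hS : S ∈ Opens.grothendieckTopology X V := by
    intro x hx
    obtain ⟨_, ⟨U, hU, rfl⟩, hxU, hUV⟩ := hB.exists_subset_of_mem_open hx V.2
    exact ⟨U, homOfLE hUV, ⟨U, hU, le_rfl, hUV⟩, hxU⟩
  apply Presheaf.IsSheaf.hom_ext W.property ⟨S, hS⟩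
  rintro ⟨U', f, ⟨U, hU', h1, h2⟩⟩
  change h.hom.app (op V) ≫ W.obj.map f.op = 0 ≫ _
  have e : f = homOfLE h1 ≫ homOfLE h2 := rfl
  rw [zero_comp, e, op_comp, Functor.map_comp, ← h.hom.naturality_assoc, hU U hU']
  simp

instance (U : Opens X) (V : (Opens X)ᵒᵖ) :
    (tensorLeft ((yoneda.obj U ⋙ ModuleCat.free (ULift.{u} ℤ)).obj V)).PreservesMonomorphisms where
  preserves f hf := by
    rw [ModuleCat.mono_iff_injective] at hf ⊢
    have : Module.Flat (ULift.{u} ℤ)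
        ((yoneda.obj U ⋙ ModuleCat.free (ULift.{u} ℤ)).obj V) :=
      inferInstanceAs (Module.Flat _ ((V.unop ⟶ U) →₀ ULift.{u} ℤ))
    exact Module.Flat.lTensor_preserves_injective_linearMap f.hom hf

/-- ℤ_U is the sheafification of a presheaf of free modules. Tensoring presheaves with it preserves
monomorphisms sectionwise, and sheafification is monoidal and exact. -/
lemma mono_extZ_whiskerLeft (U : Opens X) {A B : Shv X} (f : A ⟶ B) [Mono f] :
    Mono (extZ U ◁ f) := by
  let a := presheafToSheaf (Opens.grothendieckTopology X) ModZ.{u}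
  let Y := yoneda.obj U ⋙ ModuleCat.free (ULift.{u} ℤ)
  have h0 : Mono f.hom := inferInstanceAs (Mono ((sheafToPresheaf _ _).map f))
  have h1 : Mono (Y ◁ f.hom) := by
    have (V : (Opens X)ᵒᵖ) : Mono ((Y ◁ f.hom).app V) := by
      change Mono ((tensorLeft (Y.obj V)).map (f.hom.app V))
      infer_instance
    exact NatTrans.mono_of_mono_app _
  have h2 : Mono (a.obj Y ◁ a.map f.hom) := by
    have e : a.obj Y ◁ a.map f.hom = Functor.LaxMonoidal.μ a _ _ ≫ a.map (Y ◁ f.hom) ≫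
        Functor.OplaxMonoidal.δ a _ _ := monoidal_whiskerLeft_map a Y f.hom
    rw [e]
    infer_instance
  let e (A : Shv X) : a.obj A.obj ≅ A :=
    asIso ((sheafificationAdjunction (Opens.grothendieckTopology X) ModZ.{u}).counit.app A)
  have h3 : f = (e A).inv ≫ a.map f.hom ≫ (e B).hom := by
    rw [Iso.eq_inv_comp]
    exact ((sheafificationAdjunction _ _).counit.naturality f).symm
  have h4 : a.obj Y ◁ f = a.obj Y ◁ (e A).inv ≫ a.obj Y ◁ a.map f.hom ≫ a.obj Y ◁ (e B).hom := by
    rw [← MonoidalCategory.whiskerLeft_comp, ← MonoidalCategory.whiskerLeft_comp, ← h3]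
  change Mono (a.obj Y ◁ f)
  rw [h4]
  have := mono_comp (a.obj Y ◁ a.map f.hom) (a.obj Y ◁ (e B).hom)
  exact mono_comp _ _

lemma preservesInjectives_extZ (U : Opens X) : PreservesInjectives (extZ U) := by
  intro E hE
  have : (tensorLeft (extZ U)).PreservesMonomorphisms := ⟨fun f _ => mono_extZ_whiskerLeft U f⟩
  exact Injective.injective_of_adjoint (ihom.adjunction (extZ U)) E

end ExtZ

/-! ### Morphisms in the derived category as homotopy classes. -/

section DerivedHom

open CochainComplex DerivedCategory

variable {C : Type u} [Category.{v} C] [Abelian C] [HasDerivedCategory.{w₂} C]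

lemma exists_Q_map_eq {K L : CochainComplex C ℤ} (hL : L.IsKInjective) (f : Q.obj K ⟶ Q.obj L) :
    ∃ g : K ⟶ L, Q.map g = f := by
  obtain ⟨g, hg⟩ := (IsKInjective.Qh_map_bijective ((HomotopyCategory.quotient C (.up ℤ)).obj K)
    L).surjective ((quotientCompQhIso C).hom.app K ≫ f ≫ (quotientCompQhIso C).inv.app L)
  obtain ⟨g, rfl⟩ := (HomotopyCategory.quotient C (.up ℤ)).map_surjective g
  refine ⟨g, ?_⟩
  rw [← cancel_epi ((quotientCompQhIso C).hom.app K), ← quotientCompQhIso_hom_naturality, hg]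
  simp

lemma Q_map_eq_iff {K L : CochainComplex C ℤ} (hL : L.IsKInjective) (f g : K ⟶ L) :
    Q.map f = Q.map g ↔ Nonempty (Homotopy f g) := by
  refine ⟨fun h => ⟨HomotopyCategory.homotopyOfEq _ _
    ((IsKInjective.Qh_map_bijective ((HomotopyCategory.quotient C (.up ℤ)).obj K)
      L).injective ?_)⟩, fun ⟨h⟩ => Q_map_eq_of_homotopy _ h⟩
  rw [← cancel_mono ((quotientCompQhIso C).hom.app L), quotientCompQhIso_hom_naturality,
    quotientCompQhIso_hom_naturality, h]

lemma exists_Q_obj_iso_isKInjective [IsGrothendieckAbelian.{v} C] (A : DerivedCategory C) :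
    ∃ (I : CochainComplex C ℤ) (_ : A ≅ Q.obj I), I.IsKInjective := by
  obtain ⟨I, f, hI, hf⟩ := exists_isKInjective_quasiIso (Q.objPreimage A)
  exact ⟨I, (Q.objObjPreimageIso A).symm ≪≫ asIso (Q.map f), hI⟩

/-- With K-injective representatives of `A` and `B`, derived morphisms from spheres become homotopy
classes, although the spheres themselves are not resolved. -/
lemma isIso_of_sphere_bijective [IsGrothendieckAbelian.{v} C] {ι : Type*} {Z : ι → C}
    (hZ : IsSeparatingFamily Z) {A B : DerivedCategory C} (f : A ⟶ B)
    (hf : ∀ i n, Function.Bijective fun x : Q.obj (sphere (Z i) n) ⟶ A => x ≫ f) : IsIso f := by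
  obtain ⟨I, e, hI⟩ := exists_Q_obj_iso_isKInjective A
  obtain ⟨J, e', hJ⟩ := exists_Q_obj_iso_isKInjective B
  obtain ⟨p, hp⟩ := exists_Q_map_eq hJ (e.inv ≫ f ≫ e'.hom)
  have : QuasiIso p := by
    refine quasiIso_of_quotient_bijective hZ p (fun i n y => ?_) fun i n x hx => ?_
    · obtain ⟨x, hx⟩ := (hf i n).2 (Q.map y ≫ e'.inv)
      obtain ⟨g, hg⟩ := exists_Q_map_eq hI (x ≫ e.hom)
      refine ⟨g, (Q_map_eq_iff hJ _ _).1 ?_⟩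
      dsimp only at hx
      rw [Functor.map_comp, hg, hp, Category.assoc, e.hom_inv_id_assoc, reassoc_of% hx,
        e'.inv_hom_id, Category.comp_id]
    · rw [← Q_map_eq_iff hJ, Functor.map_comp, hp, Functor.map_zero] at hx
      rw [← Q_map_eq_iff hI, Functor.map_zero, ← cancel_mono e.inv, zero_comp]
      apply (hf i n).1
      dsimp only
      rw [← cancel_mono e'.hom, zero_comp, zero_comp, Category.assoc, Category.assoc, hx]
  have h : f = e.hom ≫ Q.map p ≫ e'.inv := by simp [hp]
  rw [h]
  infer_instance

end DerivedHom

/-! ### Changing the source of the internal Hom complex. -/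

section Restriction

open HomologicalComplex CochainComplex MonoidalClosed

variable {C : Type u} [Category.{v} C] [Abelian C] [MonoidalCategory C] [MonoidalPreadditive C]
  [MonoidalClosed C] [HasProducts.{0} C] [∀ K L : CochainComplex C ℤ, HasTensor K L]

/-- The evaluation `Hom^•(P, I) ⊗ P ⟶ I`. -/
def evalHom [BraidedCategory C] (P I : CochainComplex C ℤ) :
    HomologicalComplex.tensorObj (homComplex P I) P ⟶ I :=
  (curryHom_bijective.2 (𝟙 (homComplex P I))).choose

variable [BraidedCategory C]

lemma curryHom_evalHom (P I : CochainComplex C ℤ) : curryHom (evalHom P I) = 𝟙 _ :=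
  (curryHom_bijective.2 (𝟙 (homComplex P I))).choose_spec

lemma curryHom_tensorHom_evalHom {F P I : CochainComplex C ℤ} (f : F ⟶ homComplex P I) :
    curryHom (HomologicalComplex.tensorHom f (𝟙 P) ≫ evalHom P I) = f := by
  rw [curryHom_naturality, curryHom_evalHom, Category.comp_id]

/-- The morphism `Hom^•(P', I) ⟶ Hom^•(P, I)` given by a morphism `P ⟶ P'`. -/
def homComplexPre {P P' : CochainComplex C ℤ} (φ : P ⟶ P') (I : CochainComplex C ℤ) :
    homComplex P' I ⟶ homComplex P I :=
  curryHom (HomologicalComplex.tensorHom (𝟙 _) φ ≫ evalHom P' I)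

omit [MonoidalClosed C] [HasProducts.{0} C] [BraidedCategory C] in
lemma tensorHom_comp_tensorHom {K K' K'' L L' L'' : CochainComplex C ℤ} (f : K ⟶ K') (f' : K' ⟶ K'')
    (g : L ⟶ L') (g' : L' ⟶ L'') :
    HomologicalComplex.tensorHom f g ≫ HomologicalComplex.tensorHom f' g' =
      HomologicalComplex.tensorHom (f ≫ f') (g ≫ g') := by
  ext m p a h
  have h1 := ι_tensorHom f g p a m h
  have h2 := ι_tensorHom f' g' p a m h
  have h3 := ι_tensorHom (f ≫ f') (g ≫ g') p a m h
  refine Eq.trans ?_ h3.symm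
  rw [HomologicalComplex.comp_f]
  refine (Category.assoc _ _ _).symm.trans ((congrArg (· ≫ _) h1).trans ?_)
  rw [Category.assoc, Category.assoc, h2, whisker_exchange_assoc (f'.f p) (g.f a)]
  simp

lemma curryHom_comp_homComplexPre {F P P' I : CochainComplex C ℤ} (φ : P ⟶ P')
    (k : HomologicalComplex.tensorObj F P' ⟶ I) :
    curryHom k ≫ homComplexPre φ I = curryHom (HomologicalComplex.tensorHom (𝟙 F) φ ≫ k) := by
  rw [homComplexPre, ← curryHom_naturality, ← Category.assoc, tensorHom_comp_tensorHom,
    Category.comp_id, Category.id_comp]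
  congr 1
  have h : HomologicalComplex.tensorHom (curryHom k) φ =
      HomologicalComplex.tensorHom (𝟙 F) φ ≫ HomologicalComplex.tensorHom (curryHom k) (𝟙 P') := by
    rw [tensorHom_comp_tensorHom, Category.comp_id, Category.id_comp]
  rw [h, Category.assoc]
  congr 1
  exact curryHom_bijective.1 (curryHom_tensorHom_evalHom _)

lemma quasiIso_tensorHom_left {F : CochainComplex C ℤ} (hF : PreservesAcyclic F)
    {K L : CochainComplex C ℤ} (f : K ⟶ L) [QuasiIso f] :
    QuasiIso (HomologicalComplex.tensorHom (𝟙 F) f) := by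
  have := quasiIso_tensorHom hF f
  have h : HomologicalComplex.tensorHom (𝟙 F) f = (tensorBraiding F K).hom ≫
      HomologicalComplex.tensorHom f (𝟙 F) ≫ (tensorBraiding F L).inv := by
    rw [← Category.assoc, ← tensorBraiding_naturality, Category.assoc, Iso.hom_inv_id,
      Category.comp_id]
  rw [h]
  infer_instance

variable [IsGrothendieckAbelian.{v} C]

/-- Homotopy classes from a sphere S to `homComplex P I` are those from S ⊗ P to `I`, that is,
derived morphisms. Flatness of S makes S ⊗ φ invertible in the derived category. -/
lemma quasiIso_homComplexPre {ι : Type*} {Z : ι → C} (hZ : IsSeparatingFamily Z)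
    (hZ' : ∀ i, PreservesInjectives (Z i)) {P P' I : CochainComplex C ℤ} (φ : P ⟶ P') [QuasiIso φ]
    (hI : I.IsKInjective) : QuasiIso (homComplexPre φ I) := by
  let : HasDerivedCategory C := HasDerivedCategory.standard C
  refine quasiIso_of_quotient_bijective hZ _ (fun i n y => ?_) fun i n x hx => ?_
  · obtain ⟨k, rfl⟩ := curryHom_bijective.2 y
    have := quasiIso_tensorHom_left (preservesAcyclic_sphere (hZ' i) n) φ
    obtain ⟨g, hg⟩ := exists_Q_map_eq hI (inv (DerivedCategory.Q.map
      (HomologicalComplex.tensorHom (𝟙 (sphere (Z i) n)) φ)) ≫ DerivedCategory.Q.map k)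
    refine ⟨curryHom g, ?_⟩
    rw [curryHom_comp_homComplexPre, nonempty_homotopy_curryHom_iff, ← Q_map_eq_iff hI,
      Functor.map_comp, hg, IsIso.hom_inv_id_assoc]
  · obtain ⟨k, rfl⟩ := curryHom_bijective.2 x
    have := quasiIso_tensorHom_left (preservesAcyclic_sphere (hZ' i) n) φ
    rw [curryHom_comp_homComplexPre, ← curryHom_zero, nonempty_homotopy_curryHom_iff,
      ← Q_map_eq_iff hI, Functor.map_comp, Functor.map_zero] at hx
    rw [← curryHom_zero, nonempty_homotopy_curryHom_iff, ← Q_map_eq_iff hI, Functor.map_zero]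
    exact zero_of_epi_comp _ hx

omit [IsGrothendieckAbelian.{v} C] in
lemma isKInjective_homComplex {P I : CochainComplex C ℤ} (hP : PreservesAcyclic P)
    (hI : I.IsKInjective) : (homComplex P I).IsKInjective where
  nonempty_homotopy_zero f hA := by
    obtain ⟨k, rfl⟩ := curryHom_bijective.2 f
    rw [← curryHom_zero, nonempty_homotopy_curryHom_iff]
    exact IsKInjective.nonempty_homotopy_zero _ (hP hA)

omit [IsGrothendieckAbelian.{v} C] [MonoidalClosed C] [HasProducts.{0} C] [BraidedCategory C] in
lemma leftUnitor_hom_naturality [∀ X : C, PreservesColimit (Functor.empty.{0} C) ((curriedTensor C).flip.obj X)]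
    {K L : CochainComplex C ℤ} (f : K ⟶ L) :
    HomologicalComplex.tensorHom (𝟙 _) f ≫ (HomologicalComplex.leftUnitor L).hom =
      (HomologicalComplex.leftUnitor K).hom ≫ f := by
  rw [← Iso.inv_comp_eq, ← Category.assoc, ← Iso.eq_comp_inv]
  ext n : 1
  have h1 (K : CochainComplex C ℤ) : (HomologicalComplex.leftUnitor K).inv.f n =
      (λ_ (K.X n)).inv ≫ ((singleObjXSelf (.up ℤ) 0 (𝟙_ C)).inv ▷ (K.X n)) ≫
        ιTensorObj (HomologicalComplex.tensorUnit C (.up ℤ)) K 0 n n (zero_add n) := leftUnitor'_inv K n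
  have h2 := ι_tensorHom (𝟙 (HomologicalComplex.tensorUnit C (.up ℤ))) f 0 n n (zero_add n)
  rw [HomologicalComplex.comp_f, HomologicalComplex.comp_f, h1, h1, Category.assoc, Category.assoc,
    h2]
  rw [HomologicalComplex.id_f, id_whiskerRight, Category.id_comp, leftUnitor_inv_naturality_assoc,
    whisker_exchange_assoc]

end Restriction

/-! ### Tensor-Hom adjunction in D(X), and the third condition as bijectivity of F ↦ F ⊗ D. -/

section DualizingHom

open DerivedCategory ZeroObject

variable {X : TopCat.{u}}

lemma isBasis_univ : Opens.IsBasis (Set.univ : Set (Opens X)) :=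
  Opens.isBasis_iff_nbhd.2 fun hx => ⟨_, trivial, hx, le_rfl⟩

lemma IsKFlat.preservesAcyclic {P : CochainComplex (Shv X) ℤ} (hP : IsKFlat P) :
    PreservesAcyclic P := fun A hA => by
  have h0 : QuasiIso (0 : 0 ⟶ A) :=
    quasiIso_of_acyclic _ (HomologicalComplex.acyclic_of_isZero _ (isZero_zero _)) hA
  exact acyclic_tensorObj_of_quasiIso (hP _ h0)

lemma isKFlat_of_preservesAcyclic {P : CochainComplex (Shv X) ℤ} (hP : PreservesAcyclic P) :
    IsKFlat P := fun _ _ f _ => quasiIso_tensorHom hP f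

lemma exists_isKFlat_quasiIso (K : CochainComplex (Shv X) ℤ) :
    ∃ (P : CochainComplex (Shv X) ℤ) (p : P ⟶ K), IsKFlat P ∧ QuasiIso p := by
  let Z : ↥(Set.univ : Set (Opens X)) → Shv X := fun U => extZ (U : Opens X)
  have hZ : IsSeparatingFamily Z := isSeparatingFamily_extZ isBasis_univ
  have hZ' (U) : PreservesInjectives (Z U) := preservesInjectives_extZ _
  obtain ⟨P, p, hP, hp⟩ := exists_preservesAcyclic_quasiIso hZ hZ' K
  exact ⟨P, p, isKFlat_of_preservesAcyclic hP, hp⟩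

lemma quasiIso_homComplexPre_of_isKInjective {P P' I : CochainComplex (Shv X) ℤ} (φ : P ⟶ P')
    [QuasiIso φ] (hI : I.IsKInjective) : QuasiIso (homComplexPre φ I) :=
  quasiIso_homComplexPre (isSeparatingFamily_extZ (X := X) isBasis_univ)
    (fun U => preservesInjectives_extZ (U : Opens X)) φ hI

variable [HasDerivedCategory.{w₂} (Shv X)]

/-- Since a K-flat resolution exists, the `Classical.epsilon` choice is one. -/
instance (K : DX X) : IsIso (flatModel K).map := by
  refine Classical.epsilon_spec (p := fun M : KFlatModel K => IsIso M.map) ?_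
  obtain ⟨P, p, hP, hp⟩ := exists_isKFlat_quasiIso (X := X) (Q.objPreimage K)
  have : IsIso (Q.map p) := (isIso_Q_map_iff_quasiIso _ p).2 hp
  exact ⟨⟨P, hP, Q.map p ≫ (Q.objObjPreimageIso K).hom⟩, IsIso.comp_isIso⟩

instance (K : DX X) : IsIso (injModel K).map := by
  refine Classical.epsilon_spec (p := fun M : KInjModel K => IsIso M.map) ?_
  obtain ⟨I, e, hI⟩ := exists_Q_obj_iso_isKInjective K
  exact ⟨⟨I, hI, e.hom⟩, inferInstance⟩

variable (D : DX X)

/-- The internal Hom complex from the K-flat to the K-injective resolution of an object of the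
derived category. -/
abbrev resolutionHom : CochainComplex (Shv X) ℤ := homComplex (flatModel D).P (injModel D).I

lemma exists_flat_to_inj : ∃ φ : (flatModel D).P ⟶ (injModel D).I,
    Q.map φ = (flatModel D).map ≫ (injModel D).map :=
  exists_Q_map_eq (injModel D).inj _

/-- The morphism from the K-flat to the K-injective resolution of an object of the derived
category. -/
def flatToInj : (flatModel D).P ⟶ (injModel D).I := (exists_flat_to_inj D).choose

lemma Q_map_flatToInj : Q.map (flatToInj D) = (flatModel D).map ≫ (injModel D).map :=
  (exists_flat_to_inj D).choose_spec

instance : QuasiIso (flatToInj D) := by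
  rw [← isIso_Q_map_iff_quasiIso, Q_map_flatToInj]
  exact IsIso.comp_isIso

/-- The derived tensor product is computed by the K-flat resolution. -/
def derivedTensorIso (F : CochainComplex (Shv X) ℤ) :
    (derivedTensor D).obj (Q.obj F) ≅ Q.obj (HomologicalComplex.tensorObj F (flatModel D).P) :=
  (derivedTensorFactors D).app F

lemma derivedTensorIso_hom_naturality {F G : CochainComplex (Shv X) ℤ} (f : F ⟶ G) :
    (derivedTensor D).map (Q.map f) ≫ (derivedTensorIso D G).hom =
      (derivedTensorIso D F).hom ≫
        Q.map (HomologicalComplex.tensorHom f (𝟙 (flatModel D).P)) :=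
  (derivedTensorFactors D).hom.naturality f

/-- The evaluation `Hom^•(P, I) ⊗^L D ⟶ D`. -/
def derivedEval : (derivedTensor D).obj (Q.obj (resolutionHom D)) ⟶ D :=
  (derivedTensorIso D _).hom ≫ Q.map (evalHom _ _) ≫ inv (injModel D).map

lemma derivedTensor_map_Q_map_comp_derivedEval {F : CochainComplex (Shv X) ℤ}
    (k : HomologicalComplex.tensorObj F (flatModel D).P ⟶ (injModel D).I) :
    (derivedTensor D).map (Q.map (curryHom k)) ≫ derivedEval D =
      (derivedTensorIso D F).hom ≫ Q.map k ≫ inv (injModel D).map := by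
  rw [derivedEval, ← Category.assoc, derivedTensorIso_hom_naturality, Category.assoc,
    ← Functor.map_comp_assoc, curryHom_bijective.1 (curryHom_tensorHom_evalHom (curryHom k))]

/-- As P is K-flat and I is K-injective, `resolutionHom D` is K-injective; both sides are then
homotopy classes, matched by `curryHom`. -/
lemma derivedEval_bijective_Q (F : CochainComplex (Shv X) ℤ) :
    Function.Bijective fun g : Q.obj F ⟶ Q.obj (resolutionHom D) =>
      (derivedTensor D).map g ≫ derivedEval D := by
  have hJ := isKInjective_homComplex (flatModel D).flat.preservesAcyclic (injModel D).inj
  constructor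
  · intro g g' h
    obtain ⟨g, rfl⟩ := exists_Q_map_eq hJ g
    obtain ⟨g', rfl⟩ := exists_Q_map_eq hJ g'
    obtain ⟨k, rfl⟩ := curryHom_bijective.2 g
    obtain ⟨k', rfl⟩ := curryHom_bijective.2 g'
    dsimp only at h
    rw [derivedTensor_map_Q_map_comp_derivedEval, derivedTensor_map_Q_map_comp_derivedEval,
      cancel_epi, cancel_mono, Q_map_eq_iff (injModel D).inj, ← nonempty_homotopy_curryHom_iff] at h
    exact (Q_map_eq_iff hJ _ _).2 h
  · intro y
    obtain ⟨k, hk⟩ := exists_Q_map_eq (injModel D).inj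
      ((derivedTensorIso D F).inv ≫ y ≫ (injModel D).map)
    refine ⟨Q.map (curryHom k), ?_⟩
    dsimp only
    rw [derivedTensor_map_Q_map_comp_derivedEval, hk]
    simp

lemma derivedEval_bijective (F : DX X) :
    Function.Bijective fun g : F ⟶ Q.obj (resolutionHom D) =>
      (derivedTensor D).map g ≫ derivedEval D := by
  let e := Q.objObjPreimageIso F
  have h := derivedEval_bijective_Q D (Q.objPreimage F)
  constructor
  · intro g g' hg
    rw [← cancel_epi e.hom]
    apply h.1
    dsimp only at hg ⊢
    rw [Functor.map_comp, Functor.map_comp, Category.assoc, Category.assoc, hg]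
  · intro y
    obtain ⟨g, hg⟩ := h.2 ((derivedTensor D).map e.hom ≫ y)
    refine ⟨e.inv ≫ g, ?_⟩
    dsimp only at hg ⊢
    rw [Functor.map_comp, Category.assoc, hg, ← Functor.map_comp_assoc]
    simp

/-- The morphism `ℤ_X ⟶ Hom^•(P, I)` given by the natural morphism `P ⟶ I`. -/
def resolutionUnit :
    (singleFunctor (Shv X) 0).obj (𝟙_ (Shv X)) ⟶ Q.obj (resolutionHom D) :=
  unitRHHom D ≫ Q.map (homComplexPre (flatToInj D) (injModel D).I)

/-- `unitRHHom` has values in Hom^•(I, I) whereas the adjunction needs Hom^•(P, I); restriction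
along P → I is a quasi-isomorphism. -/
lemma isIso_resolutionUnit_iff : IsIso (resolutionUnit D) ↔ IsIso (unitRHHom D) := by
  have : IsIso (Q.map (homComplexPre (flatToInj D) (injModel D).I)) :=
    (isIso_Q_map_iff_quasiIso _ _).2 (quasiIso_homComplexPre_of_isKInjective _ (injModel D).inj)
  exact @isIso_comp_right_iff _ _ _ _ _ (unitRHHom D) _ this

/-- The unit object of the derived category is represented by a complex concentrated in degree
`0`. -/
def unitIsoQ (X : TopCat.{u}) [HasDerivedCategory.{w₂} (Shv X)] :
    (singleFunctor (Shv X) 0).obj (𝟙_ (Shv X)) ≅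
      Q.obj ((HomologicalComplex.single (Shv X) (.up ℤ) 0).obj (𝟙_ (Shv X))) :=
  (singleFunctorIsoCompQ (Shv X) 0).app (𝟙_ (Shv X))

lemma resolutionUnit_eq : resolutionUnit D = (unitIsoQ X).hom ≫
    Q.map (homUnit (injModel D).I ≫ homComplexPre (flatToInj D) (injModel D).I) := by
  rw [Functor.map_comp]
  exact Category.assoc _ _ _

lemma tensorUnit_eq : tensorUnit D = (derivedTensor D).map (unitIsoQ X).hom ≫
    (derivedTensorIso D _).hom ≫ Q.map (HomologicalComplex.leftUnitor (flatModel D).P).hom ≫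
      (flatModel D).map := rfl

/-- Under the adjunction, ℤ_X → RHom(D, D) corresponds to ℤ_X ⊗ D → D. -/
lemma derivedTensor_map_resolutionUnit :
    (derivedTensor D).map (resolutionUnit D) ≫ derivedEval D = tensorUnit D := by
  have h : homUnit (injModel D).I ≫ homComplexPre (flatToInj D) (injModel D).I =
      curryHom ((HomologicalComplex.leftUnitor (flatModel D).P).hom ≫ flatToInj D) := by
    rw [← curryHom_leftUnitor, curryHom_comp_homComplexPre, leftUnitor_hom_naturality]
  have h' := derivedTensor_map_Q_map_comp_derivedEval D
    ((HomologicalComplex.leftUnitor (flatModel D).P).hom ≫ flatToInj D)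
  rw [← h] at h'
  rw [resolutionUnit_eq, tensorUnit_eq, 
    Functor.map_comp (derivedTensor D), Category.assoc, h', Functor.map_comp Q, Q_map_flatToInj,
    Category.assoc, Category.assoc, IsIso.hom_inv_id, Category.comp_id]

/-- The map `Hom(F, ℤ_X) ⟶ Hom(F ⊗^L D, D)`. -/
def tensorUnitMap (F : DX X) (f : F ⟶ (singleFunctor (Shv X) 0).obj (𝟙_ (Shv X))) :
    (derivedTensor D).obj F ⟶ D := (derivedTensor D).map f ≫ tensorUnit D

lemma tensorUnitMap_bijective_iff (F : DX X) : Function.Bijective (tensorUnitMap D F) ↔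
    Function.Bijective fun f : F ⟶ (singleFunctor (Shv X) 0).obj (𝟙_ (Shv X)) =>
      f ≫ resolutionUnit D := by
  rw [← (derivedEval_bijective D F).of_comp_iff' (fun f => f ≫ resolutionUnit D)]
  have : tensorUnitMap D F = (fun g => (derivedTensor D).map g ≫ derivedEval D) ∘
      fun f => f ≫ resolutionUnit D := by
    ext f
    dsimp only [tensorUnitMap, Function.comp]
    rw [Functor.map_comp, Category.assoc, derivedTensor_map_resolutionUnit]
  rw [this]

lemma tensorUnitMap_bijective_of_isIso (h : IsIso (unitRHHom D)) (F : DX X) :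
    Function.Bijective (tensorUnitMap D F) := by
  rw [tensorUnitMap_bijective_iff]
  have := (isIso_resolutionUnit_iff D).2 h
  exact ⟨fun f g hfg => (cancel_mono _).1 hfg, fun g => ⟨g ≫ inv (resolutionUnit D), by simp⟩⟩

/-- The object `ℤ_U[n]` of the derived category is represented by a complex concentrated in one
degree. -/
def sphereIsoShift (U : Opens X) (n : ℤ) :
    Q.obj (sphere (extZ U) n) ≅ (extZD U)⟦-n⟧ :=
  ((singleFunctorIsoCompQ (Shv X) n).app (extZ U)).symm ≪≫
    (((singleFunctors (Shv X)).shiftIso (-n) n 0 (by lia)).app (extZ U)).symm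

lemma isIso_unitRHHom_of_bijective {B : Set (Opens X)} (hB : Opens.IsBasis B)
    (h : ∀ U ∈ B, ∀ n : ℤ, Function.Bijective (tensorUnitMap D ((extZD U)⟦-n⟧))) :
    IsIso (unitRHHom D) := by
  rw [← isIso_resolutionUnit_iff]
  refine isIso_of_sphere_bijective (isSeparatingFamily_extZ hB) _ fun U n => ?_
  have hU := (tensorUnitMap_bijective_iff D _).1 (h U U.2 n)
  let e := sphereIsoShift (U : Opens X) n
  constructor
  · intro x y hxy
    rw [← cancel_epi e.inv]
    apply hU.1
    dsimp only at hxy ⊢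
    rw [Category.assoc, Category.assoc, hxy]
  · intro y
    obtain ⟨x, hx⟩ := hU.2 (e.inv ≫ y)
    exact ⟨e.hom ≫ x, by dsimp only at hx ⊢; rw [Category.assoc, hx, e.hom_inv_id_assoc]⟩

end DualizingHom

/-! ### Derived morphisms to an injective object, read off on cohomology. -/

section HomologyToInjective

open HomologicalComplex DerivedCategory Pretriangulated

variable {C : Type u} [Category.{v} C] [Abelian C]

/-- The morphism `H^n(K) ⟶ E` given by a morphism from `K` to a complex concentrated in
degree `n`. -/
def homologyDesc {K : CochainComplex C ℤ} {E : C} {n : ℤ} (f : K ⟶ sphere E n) :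
    K.homology n ⟶ E :=
  K.homologyι n ≫ K.descOpcycles (f.f n ≫ (singleObjXSelf (.up ℤ) n E).hom) (n - 1) (by simp)
    (by
      have h : (sphere E n).d (n - 1) n = 0 := rfl
      rw [← Category.assoc, ← f.comm, h, comp_zero, zero_comp])

lemma homologyDesc_comp {K : CochainComplex C ℤ} {E E' : C} {n : ℤ} (f : K ⟶ sphere E n)
    (p : E ⟶ E') : homologyDesc (f ≫ (single C (.up ℤ) n).map p) = homologyDesc f ≫ p := by
  rw [homologyDesc, homologyDesc, Category.assoc]
  congr 1
  rw [← cancel_epi (K.pOpcycles n)]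
  simp [single_map_f_self]

lemma homologyDesc_sub {K : CochainComplex C ℤ} {E : C} {n : ℤ} (f g : K ⟶ sphere E n) :
    homologyDesc (f - g) = homologyDesc f - homologyDesc g := by
  rw [homologyDesc, homologyDesc, homologyDesc, ← Preadditive.comp_sub]
  congr 1
  rw [← cancel_epi (K.pOpcycles n)]
  simp

lemma exists_homologyDesc_eq {K : CochainComplex C ℤ} {E : C} [Injective E] {n : ℤ}
    (h : K.homology n ⟶ E) : ∃ f : K ⟶ sphere E n, homologyDesc f = h := by
  refine ⟨mkHomToSingle (K.pOpcycles n ≫ Injective.factorThru h (K.homologyι n)) (by simp), ?_⟩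
  conv_rhs => rw [← Injective.comp_factorThru h (K.homologyι n)]
  rw [homologyDesc]
  congr 1
  rw [← cancel_epi (K.pOpcycles n)]
  simp

lemma homologyDesc_eq_zero {K : CochainComplex C ℤ} {E : C} {n : ℤ} {f : K ⟶ sphere E n}
    (h : Homotopy f 0) : homologyDesc f = 0 := by
  have h1 := h.comm n
  have h3 : (sphere E n).d (n - 1) n = 0 := rfl
  rw [dNext_eq _ (show (ComplexShape.up ℤ).Rel n (n + 1) from rfl),
    prevD_eq _ (show (ComplexShape.up ℤ).Rel (n - 1) n by simp), h3, comp_zero, add_zero,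
    HomologicalComplex.zero_f, add_zero] at h1
  have h2 : K.descOpcycles (f.f n ≫ (singleObjXSelf (.up ℤ) n E).hom) (n - 1) (by simp) (by
      rw [h1]; simp) = K.fromOpcycles n (n + 1) ≫ h.hom (n + 1) n ≫
        (singleObjXSelf (.up ℤ) n E).hom := by
    rw [← cancel_epi (K.pOpcycles n)]
    simp [h1]
  rw [homologyDesc, h2, homologyι_comp_fromOpcycles_assoc, zero_comp]

/-- A morphism on opcycles that vanishes on cohomology factors through the next differential by
injectivity of `E`; the factor is the homotopy. -/
lemma nonempty_homotopy_of_homologyDesc_eq_zero {K : CochainComplex C ℤ} {E : C} [Injective E]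
    {n : ℤ} {f : K ⟶ sphere E n} (hf : homologyDesc f = 0) : Nonempty (Homotopy f 0) := by
  let S : ShortComplex C := ShortComplex.mk (K.homologyι n) (K.fromOpcycles n (n + 1)) (by simp)
  have hS : S.Exact := S.exact_of_f_is_kernel (K.homologyIsKernel n (n + 1) (by simp))
  obtain ⟨s, hs⟩ : ∃ s : K.X (n + 1) ⟶ E, K.fromOpcycles n (n + 1) ≫ s =
      K.descOpcycles (f.f n ≫ (singleObjXSelf (.up ℤ) n E).hom) (n - 1) (by simp) _ :=
    ⟨hS.descToInjective _ hf, hS.comp_descToInjective _ hf⟩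
  have hs' : f.f n = K.d n (n + 1) ≫ s ≫ (singleObjXSelf (.up ℤ) n E).inv := by
    have := K.pOpcycles n ≫= hs
    rw [p_fromOpcycles_assoc, p_descOpcycles] at this
    rw [reassoc_of% this]
    simp
  let z : CochainComplex.HomComplex.Cochain K (sphere E n) (-1) := 
    CochainComplex.HomComplex.Cochain.single (s ≫ (singleObjXSelf (.up ℤ) n E).inv) (-1)
  let h (i j : ℤ) (hij : (ComplexShape.up ℤ).Rel j i) : K.X i ⟶ (sphere E n).X j :=
    z.v i j (by have : j + 1 = i := hij; lia)
  have hh : h (n + 1) n rfl = s ≫ (singleObjXSelf (.up ℤ) n E).inv :=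
    CochainComplex.HomComplex.Cochain.single_v _ _ _
  have e : f = Homotopy.nullHomotopicMap' h := by
    apply to_single_hom_ext
    have h3 : (sphere E n).d (n - 1) n = 0 := rfl
    rw [Homotopy.nullHomotopicMap'_f (k₂ := n - 1) (k₁ := n) (k₀ := n + 1) (by simp) rfl, h3,
      comp_zero, add_zero, hh, hs']
  exact ⟨(Homotopy.ofEq e).trans (Homotopy.nullHomotopy' h)⟩

lemma isKInjective_sphere (E : C) [Injective E] (n : ℤ) : (sphere E n).IsKInjective where
  nonempty_homotopy_zero _ hK :=
    nonempty_homotopy_of_homologyDesc_eq_zero ((hK n).isZero_homology.eq_of_src _ _)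

variable [HasDerivedCategory.{w₁} C]

lemma homologyDesc_eq_zero_iff {K : CochainComplex C ℤ} {E : C} [Injective E] (n : ℤ)
    (f : K ⟶ sphere E n) : homologyDesc f = 0 ↔ Q.map f = 0 := by
  rw [← Functor.map_zero Q, Q_map_eq_iff (isKInjective_sphere E n)]
  exact ⟨nonempty_homotopy_of_homologyDesc_eq_zero, fun ⟨h⟩ => homologyDesc_eq_zero h⟩

/-- The triangle of the sequence makes derived morphisms from `K` to `S.X₂` and `S.X₃` correspond;
as both are injective, these are morphisms from `K.homology 0`. -/
lemma bijective_homology_comp {S : ShortComplex C} (hS : S.ShortExact) [Injective S.X₂]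
    [Injective S.X₃] {K : CochainComplex C ℤ}
    (h0 : ∀ f : Q.obj K ⟶ (singleFunctor C 0).obj S.X₁, f = 0)
    (h1 : ∀ f : Q.obj K ⟶ ((singleFunctor C 0).obj S.X₁)⟦(1 : ℤ)⟧, f = 0) :
    Function.Bijective fun g : K.homology 0 ⟶ S.X₂ => g ≫ S.g := by
  have hT := hS.singleTriangle_distinguished
  let e (A : C) : Q.obj (sphere A 0) ≅ (singleFunctor C 0).obj A :=
    ((singleFunctorIsoCompQ C 0).app A).symm
  have he : Q.map ((single C (.up ℤ) 0).map S.g) ≫ (e S.X₃).hom =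
      (e S.X₂).hom ≫ (singleFunctor C 0).map S.g := (singleFunctorIsoCompQ C 0).inv.naturality S.g
  constructor
  · suffices ∀ g : K.homology 0 ⟶ S.X₂, g ≫ S.g = 0 → g = 0 from fun a b hab =>
      sub_eq_zero.1 (this _ (by rw [Preadditive.sub_comp, sub_eq_zero]; exact hab))
    intro g hg
    obtain ⟨f, rfl⟩ := exists_homologyDesc_eq g
    rw [← homologyDesc_comp, homologyDesc_eq_zero_iff, Functor.map_comp] at hg
    obtain ⟨y, hy⟩ : ∃ y : Q.obj K ⟶ (singleFunctor C 0).obj S.X₁,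
        Q.map f ≫ (e S.X₂).hom = y ≫ (singleFunctor C 0).map S.f :=
      Triangle.coyoneda_exact₂ _ hT (Q.map f ≫ (e S.X₂).hom) (by
        change (Q.map f ≫ (e S.X₂).hom) ≫ (singleFunctor C 0).map S.g = 0
        rw [Category.assoc, ← he, reassoc_of% hg, zero_comp])
    rw [homologyDesc_eq_zero_iff, ← cancel_mono (e S.X₂).hom, hy, h0 y, zero_comp, zero_comp]
  · intro g
    obtain ⟨f, rfl⟩ := exists_homologyDesc_eq g
    obtain ⟨y, hy⟩ : ∃ y : Q.obj K ⟶ (singleFunctor C 0).obj S.X₂,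
        Q.map f ≫ (e S.X₃).hom = y ≫ (singleFunctor C 0).map S.g :=
      Triangle.coyoneda_exact₃ _ hT (Q.map f ≫ (e S.X₃).hom) (h1 _)
    obtain ⟨k, hk⟩ := exists_Q_map_eq (isKInjective_sphere S.X₂ 0) (y ≫ (e S.X₂).inv)
    refine ⟨homologyDesc k, ?_⟩
    dsimp only
    rw [← homologyDesc_comp, ← sub_eq_zero, ← homologyDesc_sub, homologyDesc_eq_zero_iff,
      Functor.map_sub, sub_eq_zero, Functor.map_comp, hk, ← cancel_mono (e S.X₃).hom,
      Category.assoc, he, hy, Category.assoc, (e S.X₂).inv_hom_id_assoc]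

end HomologyToInjective

/-! ### Vanishing of morphisms from the cone. -/

section Cone

open Pretriangulated

lemma eq_zero_of_distinguished_of_bijective {T : Type*} [Category* T] [HasZeroObject T]
    [HasShift T ℤ] [Preadditive T] [∀ n : ℤ, (shiftFunctor T n).Additive] [Pretriangulated T]
    {t : Triangle T} (ht : t ∈ distTriang T) {O : T}
    (h : ∀ n : ℤ, Function.Bijective fun g : t.obj₂ ⟶ O⟦n⟧ => t.mor₁ ≫ g) (n : ℤ)
    (z : t.obj₃ ⟶ O⟦n⟧) : z = 0 := by
  have h2 : t.mor₂ ≫ z = 0 := (h n).1 (by simp [comp_distTriang_mor_zero₁₂_assoc _ ht])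
  obtain ⟨w, rfl⟩ := Triangle.yoneda_exact₃ _ ht z h2
  -- A morphism from `t.obj₁⟦1⟧` to `O⟦n⟧` is a shifted morphism to `O⟦n - 1⟧`, hence the hypothesis
  -- is used at `n - 1`.
  let e := (shiftFunctorAdd' T (n - 1) 1 n (by lia)).app O
  obtain ⟨w', hw'⟩ := (shiftFunctor T (1 : ℤ)).map_surjective (w ≫ e.hom)
  obtain ⟨v, rfl⟩ := (h (n - 1)).2 w'
  rw [← cancel_mono e.hom, Category.assoc, ← hw', zero_comp, Functor.map_comp,
    comp_distTriang_mor_zero₃₁_assoc _ ht, zero_comp]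

end Cone

/-! ### Abelian groups whose characters lift uniquely to ℚ vanish. -/

section Algebra

/-- The hypotheses say Hom(H, ℚ) → Hom(H, ℚ/ℤ) is bijective. A torsion element is killed by every
lifted character, so `H` is torsion-free. A character killing nH lifts to ψ with nψ integral, hence
nψ = 0, so `H` is divisible. The primes 2 and 3 then give a contradiction. -/
lemma eq_zero_of_lift_characters {H : Type*} [AddCommGroup H]
    (hinj : ∀ ψ : H →+ ℚ, (∀ x, ∃ n : ℤ, ψ x = n) → ψ = 0)
    (hsurj : ∀ φ : CharacterModule H, ∃ ψ : H →+ ℚ, ∀ x, φ x = (ψ x : AddCircle (1 : ℚ)))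
    (h : H) : h = 0 := by
  have htf (n : ℤ) (hn : n ≠ 0) (x : H) (hx : n • x = 0) : x = 0 := by
    refine CharacterModule.eq_zero_of_character_apply fun φ => ?_
    obtain ⟨ψ, hψ⟩ := hsurj φ
    have : n • ψ x = 0 := by rw [← map_zsmul, hx, map_zero]
    rw [hψ, (smul_eq_zero.1 this).resolve_left hn]
    rfl
  have hsep (A : AddSubgroup H) (x : H) (hx : ∀ φ : CharacterModule H, (∀ a ∈ A, φ a = 0) → φ x = 0) :
      x ∈ A := by
    rw [← QuotientAddGroup.eq_zero_iff]
    refine CharacterModule.eq_zero_of_character_apply fun φ => ?_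
    refine hx ((show H ⧸ A →+ AddCircle (1 : ℚ) from φ).comp (QuotientAddGroup.mk' A)) fun a ha => ?_
    have h0 : QuotientAddGroup.mk' A a = 0 := (QuotientAddGroup.eq_zero_iff a).2 ha
    exact (congrArg φ h0).trans (map_zero φ)
  have hint (q : ℚ) (hq : (q : AddCircle (1 : ℚ)) = 0) : ∃ n : ℤ, q = n := by
    obtain ⟨n, hn⟩ := (AddCircle.coe_eq_zero_iff (1 : ℚ)).1 hq
    exact ⟨n, by simpa using hn.symm⟩
  have hdiv (n : ℤ) (hn : n ≠ 0) (x : H) : ∃ y, n • y = x := by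
    have : x ∈ (zsmulAddGroupHom n : H →+ H).range := by
      refine hsep _ _ fun φ hφ => ?_
      obtain ⟨ψ, hψ⟩ := hsurj φ
      have h1 : n • ψ = 0 := hinj _ fun x => hint _ (by
        rw [AddMonoidHom.zsmul_apply, ← map_zsmul, ← hψ]
        exact hφ _ ⟨x, rfl⟩)
      rw [hψ, (smul_eq_zero.1 (DFunLike.congr_fun h1 x : n • ψ x = 0)).resolve_left hn]
      rfl
    exact this
  obtain ⟨x, rfl⟩ := hdiv 3 (by norm_num) h
  by_contra hx
  -- `A` is the span of `3 • x` over ℤ[1/2]. Characters killing `A` will be shown to kill `x`, so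
  -- `x` lies in `A` and 2^k x = 3m x, impossible in a torsion-free group.
  let A : AddSubgroup H :=
    { carrier := {y | ∃ (k : ℕ) (m : ℤ), (2 ^ k : ℤ) • y = m • (3 : ℤ) • x}
      zero_mem' := ⟨0, 0, by simp⟩
      add_mem' := by
        rintro a b ⟨k, m, h1⟩ ⟨l, n, h2⟩
        refine ⟨k + l, 2 ^ l * m + 2 ^ k * n, ?_⟩
        rw [add_smul, mul_smul, mul_smul, ← h1, ← h2, smul_add]
        simp only [← mul_smul]
        ring_nf
      neg_mem' := by
        rintro a ⟨k, m, h1⟩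
        exact ⟨k, -m, by rw [smul_neg, h1, neg_smul]⟩ }
  have hxA : x ∈ A := by
    refine hsep _ _ fun φ hφ => ?_
    obtain ⟨ψ, hψ⟩ := hsurj φ
    have hpow (k : ℕ) : ∃ n : ℤ, ψ ((3 : ℤ) • x) = (2 ^ k * n : ℤ) := by
      obtain ⟨y, hy⟩ := hdiv (2 ^ k) (by positivity) ((3 : ℤ) • x)
      obtain ⟨n, hn⟩ := hint (ψ y) ((hψ y).symm.trans (hφ y ⟨k, 1, by rw [hy, one_smul]⟩))
      exact ⟨n, by rw [← hy, map_zsmul, hn, zsmul_eq_mul]; push_cast; rfl⟩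
    obtain ⟨N, hN⟩ := hpow 0
    -- ψ is integral on the 2-divisible `A`, so `N` is divisible by every power of 2; since |N| <
    -- 2^|N|, the exponent |N| already forces N = 0.
    obtain ⟨M, hM⟩ := hpow N.natAbs
    have hNM : N = 2 ^ N.natAbs * M := by
      have := hN.symm.trans hM
      simpa using Int.cast_injective this
    have hN0 : N = 0 := Int.eq_zero_of_abs_lt_dvd ⟨M, hNM⟩ (by
      rw [Int.abs_eq_natAbs]
      exact_mod_cast Nat.lt_two_pow_self)
    rw [hN0, map_zsmul] at hN
    have h3 : (3 : ℤ) • ψ x = 0 := by simpa using hN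
    rw [hψ, (smul_eq_zero.1 h3).resolve_left (by norm_num)]
    rfl
  obtain ⟨k, m, hk⟩ := hxA
  refine hx ?_
  rw [htf (2 ^ k - 3 * m) ?_ x (by rw [sub_smul, hk, ← mul_smul, mul_comm, sub_self]), smul_zero]
  intro h0
  have h1 : (3 : ℤ) ∣ 2 ^ k := ⟨m, by lia⟩
  have h2 := Int.prime_three.dvd_of_dvd_pow h1
  norm_num at h2

end Algebra

/-! ### The injective resolution ℚ → ℚ/ℤ of ℤ. -/

section Rationals

instance : IsPrincipalIdealRing (ULift.{u} ℤ) :=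
  .of_surjective (ULift.ringEquiv.symm : ℤ ≃+* ULift.{u} ℤ) (RingEquiv.surjective _)

lemma injective_of_divisible {R : Type u} [CommRing R] [IsPrincipalIdealRing R] (A : Type u)
    [AddCommGroup A] [Module R A] (hA : ∀ r : R, r ≠ 0 → ∀ a : A, ∃ b, r • b = a) :
    Injective (ModuleCat.of R A) := by
  suffices h : Module.Baer R A from
    Module.injective_object_of_injective_module (inj := h.injective)
  intro I g
  obtain ⟨m, rfl⟩ := IsPrincipalIdealRing.principal I
  by_cases h0 : m = 0
  · refine ⟨0, fun n hn => ?_⟩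
    have : n = 0 := by simpa [h0] using hn
    subst this
    exact (map_zero g).symm
  obtain ⟨b, hb⟩ := hA m h0 (g ⟨m, Submodule.mem_span_singleton_self m⟩)
  refine ⟨LinearMap.toSpanSingleton R A b, fun n hn => ?_⟩
  obtain ⟨n, rfl⟩ := Submodule.mem_span_singleton.1 hn
  rw [LinearMap.toSpanSingleton_apply, smul_assoc, hb, ← map_smul]
  rfl

/-- The linear map given by a homomorphism of abelian groups. -/
def linearOfAddHom {A B : Type*} [AddCommGroup A] [AddCommGroup B] [Module (ULift.{u} ℤ) A]
    [Module (ULift.{u} ℤ) B] (f : A →+ B) : A →ₗ[ULift.{u} ℤ] B where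
  toFun := f
  map_add' := map_add f
  map_smul' r a := by
    obtain ⟨n, rfl⟩ : ∃ n : ℤ, r = (n : ULift.{u} ℤ) := ⟨r.down, rfl⟩
    rw [Int.cast_smul_eq_zsmul, map_zsmul, RingHom.id_apply, Int.cast_smul_eq_zsmul]

/-- The short exact sequence `0 ⟶ ℤ ⟶ ℚ ⟶ ℚ/ℤ ⟶ 0`. -/
def rationalSequence : ShortComplex ModZ.{u} where
  X₁ := 𝟙_ ModZ.{u}
  X₂ := ModuleCat.of _ (ULift.{u} ℚ)
  X₃ := ModuleCat.of _ (ULift.{u} (AddCircle (1 : ℚ)))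
  f := ModuleCat.ofHom (Y := ULift.{u} ℚ) (X := ULift.{u} ℤ) (linearOfAddHom
    (AddEquiv.ulift.symm.toAddMonoidHom.comp ((Int.castAddHom ℚ).comp AddEquiv.ulift.toAddMonoidHom)))
  g := ModuleCat.ofHom (linearOfAddHom (AddEquiv.ulift.symm.toAddMonoidHom.comp
    ((QuotientAddGroup.mk' _).comp AddEquiv.ulift.toAddMonoidHom)))
  zero := by
    refine ModuleCat.hom_ext (LinearMap.ext fun n => ULift.ext _ _ ?_)
    exact (AddCircle.coe_eq_zero_iff (1 : ℚ)).2 ⟨n.down, by simp; rfl⟩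

lemma rationalSequence_shortExact : rationalSequence.{u}.ShortExact where
  exact := by
    rw [ShortComplex.moduleCat_exact_iff]
    rintro ⟨q⟩ hq
    obtain ⟨n, hn⟩ := (AddCircle.coe_eq_zero_iff (1 : ℚ)).1 (congrArg ULift.down hq)
    have hn' : (n : ℚ) = q := by
      rw [zsmul_one] at hn
      exact hn
    exact ⟨ULift.up n, ULift.ext _ _ hn'⟩
  mono_f := by
    rw [ModuleCat.mono_iff_injective]
    rintro ⟨m⟩ ⟨n⟩ h
    exact ULift.ext _ _ (Int.cast_injective (congrArg ULift.down h : (m : ℚ) = n))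
  epi_g := by
    rw [ModuleCat.epi_iff_surjective]
    rintro ⟨x⟩
    obtain ⟨q, rfl⟩ := QuotientAddGroup.mk_surjective x
    exact ⟨ULift.up q, rfl⟩

lemma exists_smul_eq_rational (r : ULift.{u} ℤ) (hr : r ≠ 0) (a : ULift.{u} ℚ) :
    ∃ b : ULift.{u} ℚ, r • b = a := by
  refine ⟨ULift.up (a.down / r.down), ULift.ext _ _ ?_⟩
  have hr' : (r.down : ℚ) ≠ 0 := fun h => hr (ULift.ext _ _ (by exact_mod_cast h))
  change r.down • (a.down / r.down) = a.down
  rw [zsmul_eq_mul]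
  field_simp

instance : Injective rationalSequence.{u}.X₂ :=
  injective_of_divisible (ULift.{u} ℚ) exists_smul_eq_rational

instance : Injective rationalSequence.{u}.X₃ :=
  injective_of_divisible (ULift.{u} (AddCircle (1 : ℚ))) fun r hr a => by
    have hg : Function.Surjective rationalSequence.{u}.g :=
      (ModuleCat.epi_iff_surjective _).1 rationalSequence_shortExact.epi_g
    obtain ⟨q, rfl⟩ := hg a
    obtain ⟨b, rfl⟩ := exists_smul_eq_rational r hr q
    exact ⟨rationalSequence.{u}.g b, (map_smul rationalSequence.{u}.g.hom r b).symm⟩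

lemma isZero_of_bijective_rationalSequence (H : ModZ.{u})
    (h : Function.Bijective fun g : H ⟶ rationalSequence.X₂ => g ≫ rationalSequence.g) :
    IsZero H := by
  suffices ∀ x : H, x = 0 from
    have : Subsingleton H := ⟨fun x y => (this x).trans (this y).symm⟩
    ModuleCat.isZero_of_subsingleton H
  refine eq_zero_of_lift_characters (fun ψ hψ => ?_) fun φ => ?_
  · let g : H ⟶ rationalSequence.X₂ := ModuleCat.ofHom (Y := ULift.{u} ℚ)
      (linearOfAddHom (AddEquiv.ulift.symm.toAddMonoidHom.comp ψ))
    have hg : g = 0 := h.1 (by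
      dsimp only
      rw [zero_comp]
      refine ModuleCat.hom_ext (LinearMap.ext fun x => ULift.ext _ _ ?_)
      obtain ⟨n, hn⟩ := hψ x
      exact (AddCircle.coe_eq_zero_iff (1 : ℚ)).2 ⟨n, (zsmul_one n).trans hn.symm⟩)
    ext x
    exact congrArg ULift.down (ConcreteCategory.congr_hom hg x)
  · obtain ⟨g, hg⟩ := h.2 (ModuleCat.ofHom (Y := ULift.{u} (AddCircle (1 : ℚ)))
      (linearOfAddHom (AddEquiv.ulift.symm.toAddMonoidHom.comp
        (show H →+ AddCircle (1 : ℚ) from φ))))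
    let g' : H →ₗ[ULift.{u} ℤ] ULift.{u} ℚ := g.hom
    let d : ULift.{u} ℚ →+ ℚ := AddEquiv.ulift.toAddMonoidHom
    exact ⟨d.comp g'.toAddMonoidHom,
      fun x => (congrArg ULift.down (ConcreteCategory.congr_hom hg x)).symm⟩

end Rationals

/-! ### The shifts of ℤ detect isomorphisms in D(ℤ). -/

section Conservative

open DerivedCategory ZeroObject

variable [HasDerivedCategory.{w₁} ModZ.{u}]

/-- Each cohomology group is moved to degree 0 by a shift; there the vanishing of morphisms to ℤ and
ℤ[1] is all that is used. -/
lemma isZero_of_hom_int_eq_zero {A : DZ.{w₁, u}} (hA : ∀ (n : ℤ) (f : A ⟶ intDZ⟦n⟧), f = 0) :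
    IsZero A := by
  have hn (n : ℤ) : IsZero ((homologyFunctor _ n).obj A) := by
    let K := Q.objPreimage (A⟦n⟧)
    let e : Q.obj K ≅ A⟦n⟧ := Q.objObjPreimageIso (A⟦n⟧)
    have h (m : ℤ) (f : Q.obj K ⟶ intDZ⟦m⟧) : f = 0 := by
      let e' := (shiftFunctorAdd' DZ.{w₁, u} (m - n) n m (by lia)).app intDZ
      obtain ⟨w, hw⟩ := (shiftFunctor _ n).map_surjective (e.inv ≫ f ≫ e'.hom)
      rw [hA _ w, Functor.map_zero] at hw
      rw [← cancel_epi e.inv, ← cancel_mono e'.hom, Category.assoc, ← hw, comp_zero, zero_comp]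
    have h0 (f : Q.obj K ⟶ intDZ) : f = 0 := by
      rw [← cancel_mono ((shiftFunctorZero DZ.{w₁, u} ℤ).inv.app intDZ), zero_comp]
      exact h 0 _
    have hK := isZero_of_bijective_rationalSequence _
      (bijective_homology_comp rationalSequence_shortExact h0 (h 1))
    refine IsZero.of_iso hK (((homologyFunctor ModZ.{u} 0).shiftIso n 0 n (by lia)).symm.app A ≪≫
      (homologyFunctor ModZ.{u} 0).mapIso e.symm ≪≫ (homologyFunctorFactors ModZ.{u} 0).app K)
  have : IsIso (0 : A ⟶ 0) := (isIso_iff _ _).2 fun n =>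
    (hn n).isIso ((homologyFunctor _ n).map_isZero (isZero_zero _)) _
  exact IsZero.of_iso (isZero_zero _) (asIso (0 : A ⟶ 0))

lemma isIso_of_hom_int_bijective {A B : DZ.{w₁, u}} (φ : A ⟶ B)
    (h : ∀ n : ℤ, Function.Bijective fun g : B ⟶ intDZ⟦n⟧ => φ ≫ g) : IsIso φ := by
  obtain ⟨C, g, k, ht⟩ := Pretriangulated.distinguished_cocone_triangle φ
  exact (Pretriangulated.Triangle.isZero₃_iff_isIso₁ _ ht).1
    (isZero_of_hom_int_eq_zero (eq_zero_of_distinguished_of_bijective ht h))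

end Conservative

/-! ### Translating Φ_F through the adjunctions. -/

section Comparison

open DerivedCategory DualityTheory

variable {X : TopCat.{u}} [HasDerivedCategory.{w₁} ModZ.{u}] [HasDerivedCategory.{w₂} (Shv X)]

instance : IsIso (piInvUnit.{w₁, w₂, u} X) :=
  inferInstanceAs (IsIso (((constSheaf X).mapDerivedCategorySingleFunctor 0).hom.app (𝟙_ ModZ.{u})))

variable {Ω : DualityTheory.{w₁, w₂, u} X}

namespace DualityTheory.DualMorphism

variable (δ : Ω.DualMorphism)

/-- The map `Hom(F, π⁻¹ G) ⟶ Hom(F ⊗^L D_X^ω, ω^! G)` given by a dual morphism. -/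
def homMap (F : DX X) (G : DZ.{w₁, u}) (f : F ⟶ (piInv X).obj G) :
    (derivedTensor Ω.dualizing).obj F ⟶ Ω.shriek.obj G :=
  (derivedTensor Ω.dualizing).map f ≫ δ.hom.app G

lemma homMap_bijective_iff_of_iso {F F' : DX X} (e : F ≅ F') (G : DZ.{w₁, u}) :
    Function.Bijective (δ.homMap F G) ↔ Function.Bijective (δ.homMap F' G) := by
  have h : δ.homMap F G ∘ e.symm.homFromEquiv =
      ((derivedTensor Ω.dualizing).mapIso e.symm).homFromEquiv ∘ δ.homMap F' G := by
    ext f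
    simp [homMap]
  rw [← e.symm.homFromEquiv.bijective.of_comp_iff, h, Equiv.comp_bijective]

/-- The bijection between `Hom(F, ℤ_X)` and `Hom(F[n], π⁻¹(ℤ[n]))`. -/
def shiftUnitEquiv (F : DX X) (n : ℤ) :
    (F ⟶ (singleFunctor (Shv X) 0).obj (𝟙_ (Shv X))) ≃
      (F⟦n⟧ ⟶ (piInv.{w₁, w₂, u} X).obj (intDZ⟦n⟧)) :=
  ((asIso (piInvUnit.{w₁, w₂, u} X)).symm.homToEquiv.trans
    (Functor.FullyFaithful.ofFullyFaithful (shiftFunctor (DX X) n)).homEquiv).trans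
    (((piInv.{w₁, w₂, u} X).commShiftIso n).symm.app intDZ).homToEquiv

/-- The bijection between `Hom(F ⊗^L D_X^ω, D_X^ω)` and `Hom(F[n] ⊗^L D_X^ω, ω^!(ℤ[n]))`. -/
def shiftDualizingEquiv (Ω : DualityTheory.{w₁, w₂, u} X) (F : DX X) (n : ℤ) :
    ((derivedTensor Ω.dualizing).obj F ⟶ Ω.dualizing) ≃
      ((derivedTensor Ω.dualizing).obj (F⟦n⟧) ⟶ Ω.shriek.obj (intDZ⟦n⟧)) :=
  ((Functor.FullyFaithful.ofFullyFaithful (shiftFunctor (DX X) n)).homEquiv.trans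
    (((derivedTensor Ω.dualizing).commShiftIso n).symm.app F).homFromEquiv).trans
    ((Ω.shriek.commShiftIso n).symm.app intDZ).homToEquiv

/-- Compatibility of δ with shifts reduces its value at ℤ[n] to its value at ℤ, which is canonical
by `app_int`. -/
lemma homMap_shiftUnitEquiv (F : DX X) (n : ℤ)
    (f : F ⟶ (singleFunctor (Shv X) 0).obj (𝟙_ (Shv X))) :
    δ.homMap (F⟦n⟧) (intDZ⟦n⟧) (shiftUnitEquiv F n f) =
      shiftDualizingEquiv Ω F n (tensorUnitMap Ω.dualizing F f) := by
  obtain ⟨g, rfl⟩ : ∃ g, f = g ≫ piInvUnit.{w₁, w₂, u} X :=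
    ⟨f ≫ inv (piInvUnit.{w₁, w₂, u} X), by simp⟩
  have h1 : shiftUnitEquiv F n (g ≫ piInvUnit.{w₁, w₂, u} X) =
      g⟦n⟧' ≫ ((piInv.{w₁, w₂, u} X).commShiftIso n).inv.app intDZ := by
    simp [shiftUnitEquiv]
  have h2 (k : (derivedTensor Ω.dualizing).obj F ⟶ Ω.shriek.obj intDZ) : shiftDualizingEquiv Ω F n k =
      ((derivedTensor Ω.dualizing).commShiftIso n).hom.app F ≫ k⟦n⟧' ≫
        (Ω.shriek.commShiftIso n).inv.app intDZ := Category.assoc _ _ _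
  have h3 : tensorUnitMap Ω.dualizing F (g ≫ piInvUnit.{w₁, w₂, u} X) =
      (derivedTensor Ω.dualizing).map g ≫ δ.hom.app intDZ := by
    rw [δ.app_int, tensorUnitMap, Functor.map_comp, Category.assoc]
    rfl
  have := δ.commShift
  have h4 : ((piInv.{w₁, w₂, u} X ⋙ derivedTensor Ω.dualizing).commShiftIso n).hom.app intDZ ≫
      (δ.hom.app intDZ)⟦n⟧' = δ.hom.app (intDZ⟦n⟧) ≫ (Ω.shriek.commShiftIso n).hom.app intDZ :=
    NatTrans.congr_app (NatTrans.CommShift.shift_comm (τ := δ.hom) n) intDZ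
  have h5 : (derivedTensor Ω.dualizing).map (((piInv.{w₁, w₂, u} X).commShiftIso n).inv.app intDZ) ≫
      ((piInv.{w₁, w₂, u} X ⋙ derivedTensor Ω.dualizing).commShiftIso n).hom.app intDZ =
        ((derivedTensor Ω.dualizing).commShiftIso n).hom.app _ := by
    rw [Functor.commShiftIso_comp_hom_app, ← Functor.map_comp_assoc, Iso.inv_hom_id_app,
      CategoryTheory.Functor.map_id, Category.id_comp]
  have h6 : (derivedTensor Ω.dualizing).map (g⟦n⟧') ≫
      ((derivedTensor Ω.dualizing).commShiftIso n).hom.app _ =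
        ((derivedTensor Ω.dualizing).commShiftIso n).hom.app F ≫
          ((derivedTensor Ω.dualizing).map g)⟦n⟧' :=
    ((derivedTensor Ω.dualizing).commShiftIso n).hom.naturality g
  rw [h1, h3, h2, homMap, ← cancel_mono ((Ω.shriek.commShiftIso n).hom.app intDZ), Category.assoc,
    ← h4, Functor.map_comp, Category.assoc, reassoc_of% h5, reassoc_of% h6, Category.assoc,
    Category.assoc, Iso.inv_hom_id_app, Functor.map_comp]
  congr 1
  exact (Category.comp_id _).symm

lemma homMap_bijective_iff (F : DX X) (n : ℤ) :
    Function.Bijective (δ.homMap F (intDZ⟦n⟧)) ↔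
      Function.Bijective (tensorUnitMap Ω.dualizing (F⟦-n⟧)) := by
  have e : F ≅ (F⟦-n⟧)⟦n⟧ := (shiftFunctorCompIsoId (DX X) (-n) n (by lia)).symm.app F
  have h : δ.homMap ((F⟦-n⟧)⟦n⟧) (intDZ⟦n⟧) ∘ shiftUnitEquiv (F⟦-n⟧) n =
      shiftDualizingEquiv Ω (F⟦-n⟧) n ∘ tensorUnitMap Ω.dualizing (F⟦-n⟧) :=
    funext fun f => δ.homMap_shiftUnitEquiv _ n f
  rw [δ.homMap_bijective_iff_of_iso e, ← (shiftUnitEquiv (F⟦-n⟧) n).bijective.of_comp_iff, h,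
    Equiv.comp_bijective]

variable [(piInv.{w₁, w₂, u} X).IsRightAdjoint]

/-- Naturality of δ in `g` moves the composition with `g` inside, where it meets the unit of the
adjunction for L(X, -). -/
lemma homEquiv_comparison_comp (F : DX X) {G : DZ.{w₁, u}} (g : (homologyL X).obj F ⟶ G) :
    Ω.adj.homEquiv _ _ (δ.comparison.app F ≫ g) =
      δ.homMap F G ((homologyLAdj X).homEquiv _ _ g) := by
  have h := δ.hom.naturality g
  rw [Adjunction.homEquiv_naturality_right, comparison, Equiv.apply_symm_apply, Category.assoc, ← h,
    homMap, Adjunction.homEquiv_unit, Functor.map_comp, Category.assoc]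
  rfl

lemma comparison_comp_bijective_iff (F : DX X) (G : DZ.{w₁, u}) :
    Function.Bijective (fun g : (homologyL.{w₁, w₂, u} X).obj F ⟶ G => δ.comparison.app F ≫ g) ↔
      Function.Bijective (δ.homMap F G) := by
  have h : Ω.adj.homEquiv _ _ ∘
      (fun g : (homologyL.{w₁, w₂, u} X).obj F ⟶ G => δ.comparison.app F ≫ g) =
        δ.homMap F G ∘ (homologyLAdj X).homEquiv _ _ :=
    funext fun g => δ.homEquiv_comparison_comp F g
  rw [← (Ω.adj.homEquiv _ _).comp_bijective, h, Equiv.bijective_comp]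

/-- The pivot of the proof: the right-hand side no longer mentions ω or L(X, -), only tensoring with
the dualizing complex. -/
lemma isIso_comparison_iff (F : DX X) : IsIso (δ.comparison.app F) ↔
    ∀ n : ℤ, Function.Bijective (tensorUnitMap Ω.dualizing (F⟦-n⟧)) := by
  simp only [← δ.homMap_bijective_iff, ← δ.comparison_comp_bijective_iff]
  refine ⟨fun h n => ⟨fun f g hfg => (cancel_epi _).1 hfg, fun g => ⟨inv (δ.comparison.app F) ≫ g, ?_⟩⟩,
    isIso_of_hom_int_bijective _⟩
  simp

lemma isIso_comparisonH_iff (F : DX X) :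
    (∀ i : ℤ, IsIso (δ.comparisonH F i)) ↔ IsIso (δ.comparison.app F) := by
  rw [isIso_iff]
  refine ⟨fun h n => ?_, fun h i => h (-i)⟩
  obtain ⟨m, rfl⟩ : ∃ m, n = -m := ⟨-n, by simp⟩
  exact h m

end DualityTheory.DualMorphism

end Comparison

end SheafDuality

end

theorem mainTheorem8 (X : TopCat.{u}) [HasDerivedCategory.{w₁} SheafDuality.ModZ.{u}]
    [HasDerivedCategory.{w₂} (SheafDuality.Shv X)]
    [(SheafDuality.piInv.{w₁, w₂, u} X).IsRightAdjoint]
    (Ω : SheafDuality.DualityTheory.{w₁, w₂, u} X) (δ : Ω.DualMorphism) :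
    List.TFAE [
      ∀ (F : SheafDuality.DX X) (i : ℤ), IsIso (δ.comparisonH F i),
      ∃ B : Set (Opens X), Opens.IsBasis B ∧
        ∀ U ∈ B, ∀ i : ℤ, IsIso (δ.comparisonH (SheafDuality.extZD U) i),
      IsIso (SheafDuality.unitRHHom Ω.dualizing)] := by
  simp only [δ.isIso_comparisonH_iff]
  tfae_have 1 → 2 := fun h => ⟨Set.univ, SheafDuality.isBasis_univ, fun U _ => h _⟩
  -- Each ℤ_U alone suffices, without its shifts, because `isIso_comparison_iff` yields bijectivity
  -- for all shifts at once.
  tfae_have 2 → 3 := fun ⟨B, hB, h⟩ => SheafDuality.isIso_unitRHHom_of_bijective _ hB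
    fun U hU => (δ.isIso_comparison_iff _).1 (h U hU)
  tfae_have 3 → 1 := fun h F => (δ.isIso_comparison_iff F).2
    fun _ => SheafDuality.tensorUnitMap_bijective_of_isIso _ h _
  tfae_finish
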